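/- Let $k$ be an algebraically closed field of characteristic $0$; a smooth curve means a smooth projective irreducible curve over $k$. For a line bundle $\mathcal L$ on such a curve $X$ write $h^i(X,\mathcal L)=\dim_k H^i(X,\mathcal L)$; $\mathcal L$ is nonspecial if $h^1(X,\mathcal L)=0$. For divisors $D,E$ let $(D,E)$ be their greatest common divisor (the coefficientwise minimum), let $\deg(D,E)$ be its degree, and let $\mathcal K_X$ be the canonical line bundle. The symbols $g^0_d,\xi^0_d$ denote effective divisors $D$ of degree $d$ with $h^0(X,\mathcal O_X(D))=1$. If $\mathcal L$ is a nonspecial line bundle, a presentation of $\mathcal L$ is an isomorphism $\mathcal L\simeq\mathcal K_X-D+E$ (that is, $\mathcal L\simeq\mathcal K_X\otimes\mathcal O_X(-D+E)$), where $D\ge 0$ and $E>0$ are divisors with $h^0(X,\mathcal O_X(D))=1$ and $(D,E)=0$; it is minimal if every presentation $\mathcal L\simeq\mathcal K_X-D'+E'$ satisfies $\deg E'\ge\deg E$. **Theorem.** Let $X$ and $Y$ be smooth curves and $\phi:X\to Y$ an $n$-fold covering, that is, a finite morphism of degree $n$. Say that a line bundle $\mathcal M$ on $X$ is composed with $\phi$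 if there is a line bundle $\mathcal N$ on $Y$ with $\mathcal M\simeq\phi^*\mathcal N$ and $h^0(X,\mathcal M)=h^0(Y,\mathcal N)$, and let $$\mu:=\min\{\deg\mathcal N \mid \mathcal N \text{ a globally generated line bundle on } X \text{ that is not composed with } \phi\}$$ (with $\mu=\infty$ if there is no such $\mathcal N$). Let $g^0_d$ and $\xi^0_e$ be divisors on $X$ as above with $(g^0_d,\xi^0_e)=0$, $e\ge 2$ and $d+e\le\mu$, such that $$\deg(g^0_d,\phi^*(P))+\deg(\xi^0_e,\phi^*(Q))\le n\qquad\text{for all } P,Q\in Y.$$ Then there is a line bundle $\mathcal L\simeq\mathcal K_X-g^0_d+\xi^0_e$, and every such $\mathcal L$ is nonspecial and $\mathcal L\simeq\mathcal K_X-g^0_d+\xi^0_e$ is a minimal presentation of it. -/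

import Mathlib

open CategoryTheory AlgebraicGeometry IsLocalRing TensorProduct

universe u

noncomputable section

namespace CurvePresentation

/-! ### Local rings of smooth curves -/

/-- A formally smooth local `R`-algebra with residue field `R` and differentials free of rank one
has a one-dimensional cotangent space. -/
theorem finrank_cotangentSpace {R O : Type u} [CommRing R] [CommRing O] [IsLocalRing O] [Algebra R O]
    [Algebra.FormallySmooth R O]
    (h : Function.Bijective (algebraMap R (ResidueField O)))
    [Module.Free O (Ω[O⁄R])] (hr : Module.finrank O (Ω[O⁄R]) = 1) :
    Module.finrank (ResidueField O) (CotangentSpace O) = 1 := by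
  have hsurj : Function.Surjective (algebraMap O (ResidueField O)) := residue_surjective
  have hfs : Algebra.FormallySmooth R (ResidueField O) :=
    Algebra.FormallySmooth.of_equiv (AlgEquiv.ofBijective (Algebra.ofId R _) h)
  have hfe : Subsingleton (Ω[ResidueField O⁄R]) :=
    KaehlerDifferential.subsingleton_of_surjective R _ h.2
  obtain ⟨l, hl⟩ := (Algebra.FormallySmooth.iff_split_injection (R := R) (P := O) hsurj).mp hfs
  have hinj : Function.Injective (KaehlerDifferential.kerCotangentToTensor R O (ResidueField O)) :=
    Function.LeftInverse.injective (g := l) (fun x => DFunLike.congr_fun hl x)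
  have hs : Function.Surjective
      (KaehlerDifferential.kerCotangentToTensor R O (ResidueField O)) := fun y =>
    (KaehlerDifferential.exact_kerCotangentToTensor_mapBaseChange R O (ResidueField O) hsurj y).mp
      (Subsingleton.elim _ _)
  have key : ∀ J : Ideal O, J = maximalIdeal O →
      (J.Cotangent ≃ₗ[O] ResidueField O ⊗[O] Ω[O⁄R]) →
      Nonempty (CotangentSpace O ≃ₗ[O] ResidueField O ⊗[O] Ω[O⁄R]) := by
    rintro _ rfl e
    exact ⟨e⟩
  obtain ⟨e⟩ := key _ ker_residue (LinearEquiv.ofBijective _ ⟨hinj, hs⟩)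
  rw [(e.extendScalarsOfSurjective hsurj).finrank_eq, Module.finrank_baseChange, hr]

/-- A local ring of a standard smooth algebra of relative dimension one, at a rational point,
is a discrete valuation ring. -/
theorem isDiscreteValuationRing_of_smooth {R A O : Type u} [CommRing R] [CommRing A] [CommRing O] [IsLocalRing O]
    [IsDomain O] [IsNoetherianRing O] [IsDomain A]
    [Algebra R A] [Algebra A O] [Algebra R O] [IsScalarTower R A O]
    (p : Ideal A) [p.IsPrime] [IsLocalization.AtPrime O p]
    [Algebra.IsStandardSmoothOfRelativeDimension 1 R A]
    (h : Function.Bijective (algebraMap R (ResidueField O))) :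
    IsDiscreteValuationRing O := by
  have : Algebra.IsStandardSmooth R A :=
    Algebra.IsStandardSmoothOfRelativeDimension.isStandardSmooth 1
  have : Algebra.FormallySmooth A O := Algebra.FormallySmooth.of_isLocalization p.primeCompl
  have : Algebra.FormallySmooth R O := Algebra.FormallySmooth.comp R A O
  have hfe : Algebra.FormallyEtale A O := Algebra.FormallyEtale.of_isLocalization p.primeCompl
  let e := KaehlerDifferential.tensorKaehlerEquivOfFormallyEtale R A O
  have : Module.Free O (Ω[O⁄R]) := Module.Free.of_equiv e
  have hr : Module.finrank O (Ω[O⁄R]) = 1 := by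
    rw [← e.finrank_eq, Module.finrank_baseChange]
    have := Algebra.IsStandardSmoothOfRelativeDimension.rank_kaehlerDifferential (R := R) (S := A) 1
    exact Module.finrank_eq_of_rank_eq (by simpa using this)
  exact finrank_CotangentSpace_eq_one_iff.mp (finrank_cotangentSpace h hr)

/-- Over an algebraically closed field the residue field at a closed point is the base field. -/
theorem isIso_base_to_residue {k : Type u} [Field k] [IsAlgClosed k] {X : Scheme.{u}}
    (f : X ⟶ Spec (.of k)) [LocallyOfFiniteType f] (x : X) (hx : IsClosed {x}) :
    IsIso (f.appTop ≫ X.presheaf.germ ⊤ x (by trivial) ≫ X.residue x) := by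
  have h1 := Scheme.ΓSpecIso_inv_naturality (residueFieldIsoBase f x hx).inv
  have h2 : f.appTop ≫ X.presheaf.germ ⊤ x (by trivial) ≫ X.residue x =
      (Scheme.ΓSpecIso (.of k)).hom ≫ (residueFieldIsoBase f x hx).inv := by
    rw [← cancel_mono (Scheme.ΓSpecIso _).inv]
    simp only [Category.assoc]
    erw [h1]
    rw [SpecMap_residueFieldIsoBase_inv, Scheme.fromSpecResidueField]
    rw [Iso.hom_inv_id_assoc, Scheme.Hom.comp_appTop, Scheme.Hom.comp_appTop,
      Scheme.fromSpecStalk_appTop]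
    have h3 := Scheme.ΓSpecIso_inv_naturality (X.residue x)
    simp only [Category.assoc, homOfLE_refl, op_id, CategoryTheory.Functor.map_id, Category.id_comp]
    erw [h3]
  rw [h2]
  infer_instance

/-- The local rings of a smooth integral curve at its closed points are discrete valuation rings. -/
theorem isDiscreteValuationRing_stalk {k : Type u} [Field k] [IsAlgClosed k] {X : Scheme.{u}}
    (f : X ⟶ Spec (.of k)) [IsIntegral X] [SmoothOfRelativeDimension 1 f]
    (x : X) (hx : IsClosed {x}) : IsDiscreteValuationRing (X.presheaf.stalk x) := by
  have : Smooth f := SmoothOfRelativeDimension.smooth 1 f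
  have : IsLocallyNoetherian X := LocallyOfFiniteType.isLocallyNoetherian f
  obtain ⟨U, hU, V, hV, hxV, e, hs⟩ :=
    SmoothOfRelativeDimension.exists_isStandardSmoothOfRelativeDimension (n := 1) (f := f) x
  obtain rfl : U = ⊤ := top_le_iff.mp fun y _ => by
    rw [Subsingleton.elim y (f x)]; exact e hxV
  have : Nonempty V := ⟨⟨x, hxV⟩⟩
  algebraize [(f.appLE ⊤ V e).hom]
  let : Algebra Γ(X, V) (X.presheaf.stalk x) := X.presheaf.algebra_section_stalk ⟨x, hxV⟩
  have := hV.isLocalization_stalk ⟨x, hxV⟩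
  let : Algebra Γ(Spec (.of k), ⊤) (X.presheaf.stalk x) :=
    ((algebraMap Γ(X, V) (X.presheaf.stalk x)).comp (f.appLE ⊤ V e).hom).toAlgebra
  have : IsScalarTower Γ(Spec (.of k), ⊤) Γ(X, V) (X.presheaf.stalk x) := .of_algebraMap_eq' rfl
  refine isDiscreteValuationRing_of_smooth (R := Γ(Spec (.of k), ⊤)) (A := Γ(X, V))
    (hV.primeIdealOf ⟨x, hxV⟩).asIdeal ?_
  have h := isIso_base_to_residue f x hx
  rw [ConcreteCategory.isIso_iff_bijective] at h
  have heq : f.appTop ≫ X.presheaf.germ ⊤ x (by trivial) ≫ X.residue x =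
      f.appLE ⊤ V e ≫ X.presheaf.germ V x hxV ≫ X.residue x := by
    rw [Scheme.Hom.appLE, Category.assoc, X.presheaf.germ_res_assoc]; rfl
  rw [heq] at h
  exact h

/-! ### Curves, points and rational functions -/

/-- A smooth projective curve over `k`: an integral scheme, proper over `Spec k` and smooth of
relative dimension one. -/
structure SmoothCurve (k : Type u) [Field k] where
  /-- The underlying scheme. -/
  scheme : Scheme.{u}
  /-- The structure morphism to `Spec k`. -/
  structureMap : scheme ⟶ Spec (.of k)
  isIntegral : IsIntegral scheme
  isProper : IsProper structureMap
  isSmooth : SmoothOfRelativeDimension 1 structureMap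

namespace SmoothCurve

section Basic

variable {k : Type u} [Field k] (X : SmoothCurve k)

attribute [instance] SmoothCurve.isIntegral SmoothCurve.isProper SmoothCurve.isSmooth

instance isLocallyNoetherian : IsLocallyNoetherian X.scheme :=
  LocallyOfFiniteType.isLocallyNoetherian X.structureMap

/-- The points of the curve, that is, the closed points of the scheme. -/
abbrev Point : Type u := closedPoints X.scheme

/-- The function field of the curve. -/
abbrev K : Type u := X.scheme.functionField

instance nonemptyTop : Nonempty (⊤ : X.scheme.Opens) := ⟨⟨genericPoint X.scheme, trivial⟩⟩

/-- The base field as constant functions on the curve. -/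
def constants : k →+* Γ(X.scheme, ⊤) :=
  X.structureMap.appTop.hom.comp (Scheme.ΓSpecIso (.of k)).inv.hom

/-- The function field is a `k`-algebra through the structure morphism. -/
instance algebraFunctionField : Algebra k X.K :=
  ((X.scheme.germToFunctionField ⊤).hom.comp X.constants).toAlgebra

/-- The order of vanishing of a rational function at a point (with value `0` at `f = 0`). -/
def ord (P : X.Point) (f : X.K) : ℤ := Scheme.ord f P.1

theorem ord_zero (P : X.Point) : X.ord P 0 = 0 := by simp [ord]

theorem ord_le_smul (P : X.Point) {c : k} (hc : c ≠ 0) (f : X.K) :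
    X.ord P f ≤ X.ord P (c • f) := by
  have ha : X.constants c ≠ 0 := (map_ne_zero_iff _ X.constants.injective).mpr hc
  have h : c • f = X.constants c • f := rfl
  rw [h]
  exact Scheme.ord_le_smul (U := ⊤) (by trivial) ha f

/-! ### Divisors -/

/-- Divisors on the curve. The divisor `D` also stands for the line bundle `𝒪(D)`; two divisors
give isomorphic line bundles exactly when they are linearly equivalent. -/
abbrev Divisor : Type u := X.Point →₀ ℤ

/-- The degree of a divisor (all residue fields are `k`). -/
def deg (D : X.Divisor) : ℤ := D.sum fun _ m => m

/-- Linear equivalence, that is, isomorphism of the line bundles `𝒪(D)` and `𝒪(E)`: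
`D - E` is the divisor of a nonzero rational function. -/
def LinEquiv (D E : X.Divisor) : Prop :=
  ∃ f : X.K, f ≠ 0 ∧ ∀ P, D P - E P = X.ord P f

/-- `W` is a canonical divisor: the divisor of a nonzero rational differential `ω`. At a point `P`
with local parameter `t` one writes `ω = g dt`, and the order of `ω` at `P` is that of `g`. -/
def IsCanonical (W : X.Divisor) : Prop :=
  ∃ ω : Ω[X.K⁄k], ω ≠ 0 ∧ ∀ P, ∃ t g : X.K, X.ord P t = 1 ∧ g ≠ 0 ∧
    ω = g • KaehlerDifferential.D k X.K t ∧ X.ord P g = W P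

end Basic

/-! ### Cohomology of line bundles -/

section Cohomology

variable {k : Type u} [Field k] [IsAlgClosed k] (X : SmoothCurve k)

instance isDiscreteValuationRing (P : X.Point) :
    IsDiscreteValuationRing (X.scheme.presheaf.stalk P.1) :=
  isDiscreteValuationRing_stalk X.structureMap P.1 P.2

/-- The stalk at `P` of the line bundle `𝒪(D)` with `D P = m`: the rational functions that are zero
or have order at least `-m` at `P`. -/
def stalkSections (P : X.Point) (m : ℤ) : Submodule k X.K where
  carrier := {f | f = 0 ∨ 0 ≤ X.ord P f + m}
  zero_mem' := Or.inl rfl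
  add_mem' := by
    intro f g hf hg
    by_cases hfg : f + g = 0
    · exact Or.inl hfg
    by_cases hf0 : f = 0
    · simpa [hf0] using hg
    by_cases hg0 : g = 0
    · simpa [hg0] using hf
    have h := Scheme.ord_add (x := P.1) hfg
    have h1 := hf.resolve_left hf0
    have h2 := hg.resolve_left hg0
    refine Or.inr ?_
    simp only [ord] at *
    omega
  smul_mem' := by
    intro c f hf
    by_cases hc : c = 0
    · exact Or.inl (by simp [hc])
    rcases hf with rfl | hf
    · exact Or.inl (smul_zero c)
    · have := X.ord_le_smul P hc f
      exact Or.inr (by omega)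

/-- The global sections `H⁰(X, 𝒪(D))`. -/
def H0 (D : X.Divisor) : Submodule k X.K := ⨅ P, X.stalkSections P (D P)

/-- `h⁰(X, 𝒪(D))`. -/
def h0 (D : X.Divisor) : ℕ := Module.finrank k (X.H0 D)

/-- Repartitions: families of rational functions indexed by the points, all but finitely many of
which are regular at their point. -/
def repartitions : Submodule k (X.Point → X.K) where
  carrier := {α | {P | α P ∉ X.stalkSections P 0}.Finite}
  zero_mem' := by simp
  add_mem' := by
    intro α β hα hβ
    refine (Set.Finite.union hα hβ).subset fun P hP => ?_
    by_contra h
    simp only [Set.mem_union, Set.mem_ofPred_eq, not_or, not_not] at h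
    exact hP (Submodule.add_mem _ h.1 h.2)
  smul_mem' := by
    intro c α hα
    exact Set.Finite.subset hα fun P hP h => hP (Submodule.smul_mem _ c h)

/-- The families of rational functions that lie in the stalk of `𝒪(D)` at every point. -/
def boundedRepartitions (D : X.Divisor) : Submodule k (X.Point → X.K) :=
  Submodule.pi Set.univ fun P => X.stalkSections P (D P)

/-- The rational functions, as constant families. -/
def principalRepartitions : Submodule k (X.Point → X.K) :=
  LinearMap.range (LinearMap.pi fun _ : X.Point => (LinearMap.id : X.K →ₗ[k] X.K))

/-- `H¹(X, 𝒪(D))`, the cokernel of `K(X) → ⨁_P K(X) / 𝒪(D)_P`, which is the map on global sections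
of the flasque resolution `0 → 𝒪(D) → K(X) → K(X) / 𝒪(D) → 0`. It is written as the quotient of the
repartitions by those in `∏_P 𝒪(D)_P` and the constant ones. -/
abbrev H1 (D : X.Divisor) : Type u :=
  X.repartitions ⧸
    (X.boundedRepartitions D ⊔ X.principalRepartitions).comap X.repartitions.subtype

/-- The line bundle `𝒪(D)` is nonspecial: `H¹(X, 𝒪(D)) = 0`. -/
def Nonspecial (D : X.Divisor) : Prop := Subsingleton (X.H1 D)

/-- The line bundle `𝒪(D)` is globally generated: at each point `P` some global section
generates the stalk at `P`. -/
def GloballyGenerated (D : X.Divisor) : Prop :=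
  ∀ P, ∃ f ∈ X.H0 D, f ≠ 0 ∧ X.ord P f = -D P

/-! ### Presentations -/

/-- `D` is a divisor `g⁰_d`: effective of degree `d` with `h⁰(X, 𝒪(D)) = 1`. -/
def IsG0 (D : X.Divisor) (d : ℕ) : Prop := 0 ≤ D ∧ X.deg D = d ∧ X.h0 D = 1

/-- `L ≃ K_X - D + E` as line bundles. -/
def IsResidual (L D E : X.Divisor) : Prop :=
  ∃ W, X.IsCanonical W ∧ X.LinEquiv L (W - D + E)

/-- `L ≃ K_X - D + E` is a presentation of `L`: `D` is effective with `h⁰(X, 𝒪(D)) = 1`, `E > 0`,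
and `D`, `E` have greatest common divisor `0`. -/
def IsPresentation (L D E : X.Divisor) : Prop :=
  0 ≤ D ∧ X.h0 D = 1 ∧ 0 < E ∧ D ⊓ E = 0 ∧ X.IsResidual L D E

/-- A presentation `L ≃ K_X - D + E` is minimal if every presentation `L ≃ K_X - D' + E'` has
`deg E ≤ deg E'`. -/
def IsMinimalPresentation (L D E : X.Divisor) : Prop :=
  X.IsPresentation L D E ∧ ∀ D' E', X.IsPresentation L D' E' → X.deg E ≤ X.deg E'

end Cohomology

end SmoothCurve

/-! ### Coverings -/

/-- A covering morphism `X → Y` of curves over `k`: a finite morphism over `k`. -/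
structure Covering {k : Type u} [Field k] (X Y : SmoothCurve k) where
  /-- The underlying morphism of schemes. -/
  hom : X.scheme ⟶ Y.scheme
  isOver : hom ≫ Y.structureMap = X.structureMap
  isFinite : IsFinite hom

namespace Covering

section Basic

variable {k : Type u} [Field k] {X Y : SmoothCurve k} (φ : Covering X Y)

attribute [instance] Covering.isFinite

/-- The map on points. -/
def onPoints (P : X.Point) : Y.Point :=
  ⟨φ.hom P.1, by
    have h := φ.hom.isClosedMap _ P.2
    rwa [Set.image_singleton] at h⟩

/-- The degree `[K(X) : K(Y)]` of the covering, with `K(Y)` taken as the local ring of `Y` at the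
image of the generic point of `X`, which is the generic point of `Y`. -/
def degree : ℕ :=
  letI := (φ.hom.stalkMap (genericPoint X.scheme)).hom.toAlgebra
  Module.finrank (Y.scheme.presheaf.stalk (φ.hom (genericPoint X.scheme))) X.K

/-- The ramification index of the covering at a point of `X`. -/
def ramification (P : X.Point) : ℕ :=
  letI := (φ.hom.stalkMap P.1).hom.toAlgebra
  Ideal.ramificationIdx' (maximalIdeal (Y.scheme.presheaf.stalk (φ.hom P.1)))
    (maximalIdeal (X.scheme.presheaf.stalk P.1))

/-- The pullback `φ^* D` of a divisor, with coefficient `e_P · D(φ(P))` at `P`. -/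
def pullback (D : Y.Divisor) : X.Divisor :=
  Finsupp.ofSupportFinite (fun P => (φ.ramification P : ℤ) * D (φ.onPoints P)) <| by
    have h : (φ.onPoints ⁻¹' (D.support : Set Y.Point)).Finite := by
      refine D.support.finite_toSet.preimage' fun Q _ => ?_
      have h := φ.hom.finite_preimage_singleton Q.1
      refine (h.preimage (Subtype.val_injective (p := (· ∈ closedPoints X.scheme))).injOn).subset ?_
      intro P hP
      exact congrArg Subtype.val hP
    refine h.subset fun P hP => ?_
    simp only [Set.mem_preimage, Finset.mem_coe, Finsupp.mem_support_iff]
    intro h0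
    exact hP (by simp [h0])

/-- The pullback `φ^* Q` of a point of `Y`. -/
def pullbackPoint (Q : Y.Point) : X.Divisor := φ.pullback (Finsupp.single Q 1)

end Basic

section Composed

variable {k : Type u} [Field k] [IsAlgClosed k] {X Y : SmoothCurve k} (φ : Covering X Y)

/-- The line bundle `𝒪(M)` is composed with `φ`: it is isomorphic to `φ^* 𝒪(N)` for a divisor `N`
on `Y` with `h⁰(X, 𝒪(M)) = h⁰(Y, 𝒪(N))`. -/
def Composed (M : X.Divisor) : Prop :=
  ∃ N : Y.Divisor, X.LinEquiv M (φ.pullback N) ∧ X.h0 M = Y.h0 N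

/-- `μ`, the minimal degree of a globally generated line bundle on `X` that is not composed
with `φ`, with the value `∞` if there is none. The degree of a globally generated line bundle is
nonnegative. -/
def mu : ℕ∞ :=
  sInf {m | ∃ N : X.Divisor, X.GloballyGenerated N ∧ ¬ φ.Composed N ∧ m = ((X.deg N).toNat : ℕ∞)}

end Composed

end Covering

end CurvePresentation

end

open CurvePresentation

/-!
A presentation `𝓛 ≃ 𝒦 - D + E` forces `𝓛` to be nonspecial by Serre duality: `h¹(𝓛) = h⁰(𝒪(D - E))`
vanishes, because the sections of `𝒪(D)` are constants, and a constant that vanishes on `E > 0`,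
where `D` has no points, is zero. Only this half of the duality is needed: if `H⁰(D) = 0` and `W` is
canonical, then `H¹(W - D) = 0`. It is proved for the repartitions of the function field
(`PlaceSystem.IsCanonical.exists_sub_mem_sect`). A nonzero functional on `H¹(W - D)` is nonzero at
some place `P₁`. Choose a function `x` with a pole at `P₁`. By weak approximation, restriction of
the functional to the places over `x = ∞` gives a nonzero functional on `K`, which is local at these
places and, as functions are killed globally, also at all the other places. It therefore has the
form `β ↦ Res_∞ (Tr (f β) dx)`, with the trace from `K` to `k(x)`
(`PlaceSystem.IsResidue.exists_eq_trace`), and testing it on functions `β` concentrated at one place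
shows that `f dx` is a differential whose divisor is at least `W - D`. Dividing by a differential
with divisor `W` gives a nonzero section of `𝒪(D)`. Only the residue at infinity on the line is
used, so that no residues at the places of `K` and no residue theorem are needed.

This argument concerns a `PlaceSystem`, an abstract family of discrete valuations of a function
field. The closed points of a smooth curve form one (`SmoothCurve.placeSystem`): by the valuative
criterion of properness every valuation ring of the function field that contains the constants is
the local ring of exactly one point, and the differentials have rank one by smoothness. The
fundamental equality (`PlaceSystem.IsUniformizerBelow.sum_ord_fibre`) yields both `deg (div f) = 0`,
over `k(x)`, and `deg (φ^* D) = n deg D`, over the function field of `Y`.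

For the minimality let `𝒦 - g + ξ ≃ 𝒦 - D + E` with `deg E < e`. There is a function `f` with
divisor `g + E - D - ξ`. Its divisor of poles `N` is globally generated, by `1` and `f`, and has the
same degree as its divisor of zeros, at most `d + deg E < d + e ≤ μ`. So `𝒪(N)` is composed with
`φ`, and as `1` is a section of it, `f` is the pullback of a function on `Y`
(`Covering.exists_eq_pullbackFun`), with zeros `A` and poles `B` of the same degree `m`. The part of
`φ^* A` that does not come from `g` and the part of `ξ` that is not in `φ^* B` are both contained in
`E`, and as `g` and `ξ` are disjoint, so is their sum: `E ≥ (φ^* A - (g, φ^* A)) + (ξ - (ξ, φ^*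
B))`. The hypothesis on the fibres, averaged over the pairs of a point of `A` and a point of `B`,
gives `deg (g, φ^* A) + deg (ξ, φ^* B) ≤ n m = deg φ^* A` (`Covering.deg_inf_pullback_add_le`),
hence `deg E ≥ deg ξ = e`.
-/

noncomputable section

namespace CurvePresentation

/-! ### Places of a function field -/

/-- The places of a function field `K` in one variable over `k`, indexed by `ι`: the order
functions of all discrete valuation rings of `K` that contain `k`, all of them with residue field
`k`. Orders take the value `0` at the function `0`. The field `generators` says that the valuation
rings are localizations of finitely many finitely generated `k`-algebras. -/
structure PlaceSystem (k K ι : Type*) [Field k] [Field K] [Algebra k K] where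
  /-- The order of a function at a place. -/
  ord : ι → K → ℤ
  ord_zero : ∀ P, ord P 0 = 0
  ord_mul : ∀ P {f g}, f ≠ 0 → g ≠ 0 → ord P (f * g) = ord P f + ord P g
  ord_add : ∀ P {f g}, f + g ≠ 0 → min (ord P f) (ord P g) ≤ ord P (f + g)
  ord_algebraMap : ∀ P (c : k), ord P (algebraMap k K c) = 0
  exists_uniformizer : ∀ P, ∃ t, ord P t = 1
  exists_residue : ∀ P {f}, 0 ≤ ord P f →
    ∃ c : k, f - algebraMap k K c = 0 ∨ 1 ≤ ord P (f - algebraMap k K c)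
  finite_support : ∀ {f}, f ≠ 0 → {P | ord P f ≠ 0}.Finite
  complete : ∀ V : ValuationSubring K, (∀ c : k, algebraMap k K c ∈ V) → V ≠ ⊤ →
    ∃ P, ∀ f, f ∈ V ↔ 0 ≤ ord P f
  separated : ∀ P Q, (∀ f, 0 ≤ ord P f ↔ 0 ≤ ord Q f) → P = Q
  generators : ∃ 𝒯 : Finset (Finset K), ∀ P, ∃ T ∈ 𝒯, (∀ a ∈ T, 0 ≤ ord P a) ∧
    ∀ f, 0 ≤ ord P f → ∃ a ∈ Algebra.adjoin k (T : Set K), ∃ b ∈ Algebra.adjoin k (T : Set K),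
      b ≠ 0 ∧ ord P b = 0 ∧ f = a / b
  finrank_kaehler : Module.finrank K (Ω[K⁄k]) = 1

namespace PlaceSystem

variable {k K ι : Type*} [Field k] [Field K] [Algebra k K] (𝒮 : PlaceSystem k K ι)

/-! ### Orders of functions -/

theorem ord_one (P : ι) : 𝒮.ord P 1 = 0 := by
  simpa using 𝒮.ord_algebraMap P 1

theorem ord_neg (P : ι) (f : K) : 𝒮.ord P (-f) = 𝒮.ord P f := by
  by_cases hf : f = 0
  · simp [hf]
  have h : 𝒮.ord P (-1) = 0 := by simpa using 𝒮.ord_algebraMap P (-1)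
  rw [neg_eq_neg_one_mul, 𝒮.ord_mul P (by simp) hf, h, zero_add]

theorem ord_inv (P : ι) (f : K) : 𝒮.ord P f⁻¹ = -𝒮.ord P f := by
  by_cases hf : f = 0
  · simp [hf, 𝒮.ord_zero]
  have h := 𝒮.ord_mul P hf (inv_ne_zero hf)
  rw [mul_inv_cancel₀ hf, 𝒮.ord_one] at h
  omega

theorem ord_div (P : ι) {f g : K} (hf : f ≠ 0) (hg : g ≠ 0) :
    𝒮.ord P (f / g) = 𝒮.ord P f - 𝒮.ord P g := by
  rw [div_eq_mul_inv, 𝒮.ord_mul P hf (inv_ne_zero hg), ord_inv]; rfl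

theorem ord_pow (P : ι) (f : K) (n : ℕ) : 𝒮.ord P (f ^ n) = n * 𝒮.ord P f := by
  by_cases hf : f = 0
  · rcases n with _ | n
    · simp [𝒮.ord_one]
    · simp [hf, 𝒮.ord_zero]
  induction n with
  | zero => simp [𝒮.ord_one]
  | succ n ih =>
    rw [pow_succ, 𝒮.ord_mul P (pow_ne_zero n hf) hf, ih]
    push_cast
    ring

theorem ord_zpow (P : ι) (f : K) (n : ℤ) : 𝒮.ord P (f ^ n) = n * 𝒮.ord P f := by
  rcases n with n | n
  · simpa using 𝒮.ord_pow P f n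
  · rw [zpow_negSucc, ord_inv, ord_pow, Int.negSucc_eq]
    push_cast
    ring

theorem ne_zero_of_ord_ne_zero {P : ι} {f : K} (h : 𝒮.ord P f ≠ 0) : f ≠ 0 := by
  rintro rfl
  exact h (𝒮.ord_zero P)

theorem ord_prod (P : ι) {α : Type*} (s : Finset α) (f : α → K) (h : ∀ a ∈ s, f a ≠ 0) :
    𝒮.ord P (∏ a ∈ s, f a) = ∑ a ∈ s, 𝒮.ord P (f a) := by
  classical
  induction s using Finset.induction_on with
  | empty => simp [𝒮.ord_one]
  | insert a s ha ih =>
    rw [Finset.prod_insert ha, Finset.sum_insert ha, 𝒮.ord_mul P (h a (by simp))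
      (Finset.prod_ne_zero_iff.mpr fun b hb => h b (by simp [hb])),
      ih fun b hb => h b (by simp [hb])]

/-- The order of a sum of two functions of different orders is the smaller one. -/
theorem ord_add_eq_left {P : ι} {f g : K} (hf : f ≠ 0) (h : g = 0 ∨ 𝒮.ord P f < 𝒮.ord P g) :
    f + g ≠ 0 ∧ 𝒮.ord P (f + g) = 𝒮.ord P f := by
  rcases h with rfl | h
  · simp [hf]
  have h0 : f + g ≠ 0 := fun h0 => by
    rw [eq_neg_of_add_eq_zero_left h0, 𝒮.ord_neg] at h
    exact lt_irrefl _ h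
  refine ⟨h0, ?_⟩
  have h1 := 𝒮.ord_add P h0
  have h2 := 𝒮.ord_add P (f := f + g) (g := -g) (by simpa using hf)
  rw [𝒮.ord_neg, add_neg_cancel_right] at h2
  omega

/-! ### Local sections -/

/-- The functions that are zero or of order at least `-m` at `P`. -/
def sect (P : ι) (m : ℤ) : Submodule k K where
  carrier := {f | f = 0 ∨ 0 ≤ 𝒮.ord P f + m}
  zero_mem' := Or.inl rfl
  add_mem' := by
    intro f g hf hg
    by_cases hfg : f + g = 0
    · exact Or.inl hfg
    by_cases hf0 : f = 0
    · simpa [hf0] using hg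
    by_cases hg0 : g = 0
    · simpa [hg0] using hf
    have h := 𝒮.ord_add P hfg
    have h1 := hf.resolve_left hf0
    have h2 := hg.resolve_left hg0
    exact Or.inr (by omega)
  smul_mem' := by
    intro c f hf
    by_cases hc : c = 0
    · exact Or.inl (by simp [hc])
    rcases hf with rfl | hf
    · exact Or.inl (smul_zero c)
    · by_cases hf0 : f = 0
      · exact Or.inl (by simp [hf0])
      refine Or.inr ?_
      rw [Algebra.smul_def, 𝒮.ord_mul P (by simpa using hc) hf0, 𝒮.ord_algebraMap]
      omega

variable {𝒮}

theorem mem_sect {P : ι} {m : ℤ} {f : K} : f ∈ 𝒮.sect P m ↔ f = 0 ∨ 0 ≤ 𝒮.ord P f + m := Iff.rfl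

theorem mem_sect_of_ne {P : ι} {m : ℤ} {f : K} (hf : f ≠ 0) :
    f ∈ 𝒮.sect P m ↔ -m ≤ 𝒮.ord P f := by
  rw [mem_sect, or_iff_right hf]
  omega

theorem mem_sect_zero {P : ι} {f : K} : f ∈ 𝒮.sect P 0 ↔ 0 ≤ 𝒮.ord P f := by
  rw [mem_sect, add_zero, or_iff_right_of_imp]
  rintro rfl
  exact (𝒮.ord_zero P).ge

theorem sect_mono (P : ι) {m n : ℤ} (h : m ≤ n) : 𝒮.sect P m ≤ 𝒮.sect P n := by
  rintro f (hf | hf)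
  · exact Or.inl hf
  · exact Or.inr (by omega)

theorem mul_mem_sect {P : ι} {m n l : ℤ} {f g : K} (hf : f ∈ 𝒮.sect P m) (hg : g ∈ 𝒮.sect P n)
    (h : m + n ≤ l) : f * g ∈ 𝒮.sect P l := by
  by_cases hf0 : f = 0
  · exact Or.inl (by simp [hf0])
  by_cases hg0 : g = 0
  · exact Or.inl (by simp [hg0])
  rw [mem_sect_of_ne hf0] at hf
  rw [mem_sect_of_ne hg0] at hg
  rw [mem_sect_of_ne (mul_ne_zero hf0 hg0), 𝒮.ord_mul P hf0 hg0]
  omega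

theorem self_mem_sect (P : ι) (f : K) {m : ℤ} (h : -𝒮.ord P f ≤ m) : f ∈ 𝒮.sect P m :=
  Or.inr (by omega)

theorem algebraMap_mem_sect (P : ι) (c : k) : algebraMap k K c ∈ 𝒮.sect P 0 :=
  self_mem_sect P _ (by rw [𝒮.ord_algebraMap]; rfl)

/-- A function congruent to `1` at `P` has order `0`. -/
theorem ord_eq_zero_of_sub_one_mem {P : ι} {f : K} (h : f - 1 ∈ 𝒮.sect P (-1)) :
    f ≠ 0 ∧ 𝒮.ord P f = 0 := by
  have := 𝒮.ord_add_eq_left (P := P) (f := 1) (g := f - 1) one_ne_zero (by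
    rcases h with h | h
    · exact Or.inl h
    · rw [𝒮.ord_one]
      exact Or.inr (by omega))
  rwa [add_sub_cancel, 𝒮.ord_one] at this

variable (𝒮) in
/-- The valuation ring of a place. -/
def valRing (P : ι) : ValuationSubring K where
  carrier := 𝒮.sect P 0
  mul_mem' hf hg := mul_mem_sect hf hg (by simp)
  one_mem' := by simpa using algebraMap_mem_sect (𝒮 := 𝒮) P 1
  add_mem' := add_mem
  zero_mem' := zero_mem _
  neg_mem' := neg_mem
  mem_or_inv_mem' f := by
    simp only [SetLike.mem_coe, mem_sect_zero, 𝒮.ord_inv]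
    omega

theorem mem_valRing {P : ι} {f : K} : f ∈ 𝒮.valRing P ↔ 0 ≤ 𝒮.ord P f := mem_sect_zero

theorem algebraMap_mem_valRing (P : ι) (c : k) : algebraMap k K c ∈ 𝒮.valRing P :=
  algebraMap_mem_sect P c

theorem exists_pos_ord (P : ι) : ∃ t, t ≠ 0 ∧ 𝒮.ord P t = 1 := by
  obtain ⟨t, ht⟩ := 𝒮.exists_uniformizer P
  exact ⟨t, 𝒮.ne_zero_of_ord_ne_zero (P := P) (by omega), ht⟩

theorem valRing_ne_top (P : ι) : 𝒮.valRing P ≠ ⊤ := by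
  obtain ⟨t, -, ht⟩ := 𝒮.exists_pos_ord P
  intro h
  have : t⁻¹ ∈ 𝒮.valRing P := h ▸ ValuationSubring.mem_top _
  rw [mem_valRing, 𝒮.ord_inv] at this
  omega

/-- The valuation ring of a place is a maximal proper subring. -/
theorem eq_of_valRing_le {P : ι} {V : ValuationSubring K} (h : 𝒮.valRing P ≤ V) :
    V = ⊤ ∨ V = 𝒮.valRing P := by
  by_contra! hV
  obtain ⟨f, hfV, hf⟩ : ∃ f ∈ V, f ∉ 𝒮.valRing P := by
    by_contra! h'
    exact hV.2 (le_antisymm h' h)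
  refine hV.1 (top_le_iff.mp fun g _ => ?_)
  rw [mem_valRing, not_le] at hf
  have hf0 := 𝒮.ne_zero_of_ord_ne_zero hf.ne
  have key : g / f ^ (𝒮.ord P g).natAbs ∈ 𝒮.valRing P := by
    by_cases hg : g = 0
    · simp [hg]
    rw [mem_valRing, 𝒮.ord_div P hg (pow_ne_zero _ hf0), 𝒮.ord_pow]
    have : ((𝒮.ord P g).natAbs : ℤ) * 𝒮.ord P f ≤ ((𝒮.ord P g).natAbs : ℤ) * (-1) :=
      mul_le_mul_of_nonneg_left (by omega) (by positivity)
    omega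
  have := mul_mem (h key) (pow_mem hfV (𝒮.ord P g).natAbs)
  rwa [div_mul_cancel₀ _ (pow_ne_zero _ hf0)] at this

theorem eq_of_valRing_le_valRing {P Q : ι} (h : 𝒮.valRing P ≤ 𝒮.valRing Q) : P = Q := by
  refine 𝒮.separated P Q fun f => ?_
  rw [← mem_valRing, ← mem_valRing, (eq_of_valRing_le h).resolve_left (valRing_ne_top Q)]

/-! ### Weak approximation -/

theorem exists_pos_neg {P Q : ι} (h : P ≠ Q) : ∃ u, 0 < 𝒮.ord P u ∧ 𝒮.ord Q u < 0 := by
  have aux : ∀ {P Q : ι}, P ≠ Q → ∃ f, 0 ≤ 𝒮.ord P f ∧ 𝒮.ord Q f < 0 := by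
    intro P Q h
    by_contra! h'
    exact h (eq_of_valRing_le_valRing fun f hf => mem_valRing.mpr (h' f (mem_valRing.mp hf)))
  obtain ⟨f, hf1, hf2⟩ := aux h
  obtain ⟨g, hg1, hg2⟩ := aux h.symm
  have hf0 := 𝒮.ne_zero_of_ord_ne_zero hf2.ne
  have hg0 := 𝒮.ne_zero_of_ord_ne_zero hg2.ne
  exact ⟨f / g, by rw [𝒮.ord_div _ hf0 hg0]; omega, by rw [𝒮.ord_div _ hf0 hg0]; omega⟩

/-- Independence of places: the functions of `exists_pos_neg` for the places of `S` are combined one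
at a time, by adding a power of the next one. -/
theorem exists_pos_forall_neg (P : ι) (S : Finset ι) (h : P ∉ S) :
    ∃ u, 0 < 𝒮.ord P u ∧ ∀ Q ∈ S, 𝒮.ord Q u < 0 := by
  classical
  induction S using Finset.induction_on with
  | empty =>
    obtain ⟨t, -, ht⟩ := 𝒮.exists_pos_ord P
    exact ⟨t, by omega, by simp⟩
  | insert R S hR ih =>
    simp only [Finset.mem_insert, not_or] at h
    obtain ⟨u, hu, huS⟩ := ih h.2
    obtain ⟨w, hw, hwR⟩ := 𝒮.exists_pos_neg h.1
    by_cases huR : 𝒮.ord R u < 0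
    · refine ⟨u, hu, fun Q hQ => ?_⟩
      rcases Finset.mem_insert.mp hQ with rfl | hQ
      exacts [huR, huS Q hQ]
    have hu0 := 𝒮.ne_zero_of_ord_ne_zero hu.ne'
    have hw0 := 𝒮.ne_zero_of_ord_ne_zero hw.ne'
    -- the exponent makes the orders of `u` and `w ^ r` distinct at all points of `S`
    set r : ℕ := 1 + ∑ Q ∈ S, (𝒮.ord Q u).natAbs with hr
    have hwr0 : w ^ r ≠ 0 := pow_ne_zero _ hw0
    have hR' : u + w ^ r ≠ 0 ∧ 𝒮.ord R (u + w ^ r) = 𝒮.ord R (w ^ r) := by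
      rw [add_comm]
      refine 𝒮.ord_add_eq_left hwr0 (Or.inr ?_)
      rw [𝒮.ord_pow]
      have : (r : ℤ) * 𝒮.ord R w ≤ 1 * 𝒮.ord R w :=
        mul_le_mul_of_nonpos_right (by omega) hwR.le
      omega
    refine ⟨u + w ^ r, ?_, fun Q hQ => ?_⟩
    · have := 𝒮.ord_add P hR'.1
      rw [𝒮.ord_pow] at this
      have h2 : 1 * 𝒮.ord P w ≤ (r : ℤ) * 𝒮.ord P w :=
        mul_le_mul_of_nonneg_right (by omega) hw.le
      omega
    rcases Finset.mem_insert.mp hQ with rfl | hQ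
    · rw [hR'.2, 𝒮.ord_pow]
      exact mul_neg_of_pos_of_neg (by omega) hwR
    have h1 := huS Q hQ
    have h2 : (𝒮.ord Q u).natAbs < r := by
      have := Finset.single_le_sum (f := fun Q => (𝒮.ord Q u).natAbs) (fun _ _ => Nat.zero_le _) hQ
      omega
    rcases lt_trichotomy (𝒮.ord Q w) 0 with h3 | h3 | h3
    · rw [add_comm, (𝒮.ord_add_eq_left (P := Q) hwr0 (Or.inr ?_)).2]
      · rw [𝒮.ord_pow]
        exact mul_neg_of_pos_of_neg (by omega) h3
      · rw [𝒮.ord_pow]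
        have : (r : ℤ) * 𝒮.ord Q w ≤ r * (-1) :=
          mul_le_mul_of_nonneg_left (by omega) (by positivity)
        omega
    · rw [(𝒮.ord_add_eq_left (P := Q) hu0 (Or.inr ?_)).2]
      · exact h1
      · rw [𝒮.ord_pow, h3]
        simpa using h1
    · rw [(𝒮.ord_add_eq_left (P := Q) hu0 (Or.inr ?_)).2]
      · exact h1
      · rw [𝒮.ord_pow]
        exact h1.trans (mul_pos (by omega) h3)

/-- A function close to `1` at `P` and close to `0` on `S`, namely `1 / (1 + u ^ (N + 1))` where `u`
vanishes at `P` and has poles on `S`. -/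
theorem exists_approx_idempotent (P : ι) (S : Finset ι) (h : P ∉ S) (N : ℕ) :
    ∃ e, e - 1 ∈ 𝒮.sect P (-N) ∧ ∀ Q ∈ S, e ∈ 𝒮.sect Q (-N) := by
  obtain ⟨u, hu, huS⟩ := 𝒮.exists_pos_forall_neg P S h
  have hu0 := 𝒮.ne_zero_of_ord_ne_zero hu.ne'
  have hN : u ^ (N + 1) ≠ 0 := pow_ne_zero _ hu0
  have h1 : (1 : K) + u ^ (N + 1) ≠ 0 ∧ 𝒮.ord P (1 + u ^ (N + 1)) = 𝒮.ord P 1 := by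
    refine 𝒮.ord_add_eq_left one_ne_zero (Or.inr ?_)
    rw [𝒮.ord_one, 𝒮.ord_pow]
    exact mul_pos (by omega) hu
  refine ⟨(1 + u ^ (N + 1))⁻¹, ?_, fun Q hQ => ?_⟩
  · have : (1 + u ^ (N + 1))⁻¹ - 1 = -(u ^ (N + 1) / (1 + u ^ (N + 1))) := by
      field_simp [h1.1]
      ring
    rw [this]
    refine neg_mem (self_mem_sect P _ ?_)
    rw [𝒮.ord_div P hN h1.1, h1.2, 𝒮.ord_one, 𝒮.ord_pow]
    have : ((N + 1 : ℕ) : ℤ) * 1 ≤ ((N + 1 : ℕ) : ℤ) * 𝒮.ord P u :=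
      mul_le_mul_of_nonneg_left (by omega) (by positivity)
    push_cast at this ⊢
    omega
  · refine self_mem_sect Q _ ?_
    have h2 : 𝒮.ord Q (1 + u ^ (N + 1)) = 𝒮.ord Q (u ^ (N + 1)) := by
      rw [add_comm]
      refine (𝒮.ord_add_eq_left hN (Or.inr ?_)).2
      rw [𝒮.ord_one, 𝒮.ord_pow]
      exact mul_neg_of_pos_of_neg (by omega) (huS Q hQ)
    rw [𝒮.ord_inv, h2, 𝒮.ord_pow]
    have := huS Q hQ
    have : ((N + 1 : ℕ) : ℤ) * 𝒮.ord Q u ≤ ((N + 1 : ℕ) : ℤ) * (-1) :=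
      mul_le_mul_of_nonneg_left (by omega) (by positivity)
    push_cast at this ⊢
    omega

/-- Weak approximation: a function can be prescribed up to any order at finitely many places. -/
theorem weak_approximation (S : Finset ι) (a : ι → K) (m : ι → ℤ) :
    ∃ f, ∀ P ∈ S, f - a P ∈ 𝒮.sect P (m P) := by
  classical
  set N : ℕ := ∑ P ∈ S, ((m P).natAbs + ∑ Q ∈ S, (𝒮.ord P (a Q)).natAbs) with hN
  have hle : ∀ P ∈ S, ∀ Q ∈ S, (m P).natAbs + (𝒮.ord P (a Q)).natAbs ≤ N := by
    intro P hP Q hQ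
    have h1 := Finset.single_le_sum (s := S)
      (f := fun P => (m P).natAbs + ∑ Q ∈ S, (𝒮.ord P (a Q)).natAbs)
      (fun _ _ => Nat.zero_le _) hP
    have h2 := Finset.single_le_sum (s := S)
      (f := fun Q => (𝒮.ord P (a Q)).natAbs) (fun _ _ => Nat.zero_le _) hQ
    omega
  have := fun P => 𝒮.exists_approx_idempotent P (S.erase P) (by simp) N
  choose e he1 he2 using this
  refine ⟨∑ Q ∈ S, a Q * e Q, fun P hP => ?_⟩
  rw [← Finset.add_sum_erase S _ hP]
  have : a P * e P + ∑ Q ∈ S.erase P, a Q * e Q - a P =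
      a P * (e P - 1) + ∑ Q ∈ S.erase P, a Q * e Q := by ring
  rw [this]
  refine add_mem ?_ (sum_mem fun Q hQ => ?_)
  · refine mul_mem_sect (self_mem_sect P (a P) le_rfl) (he1 P) ?_
    have := hle P hP P hP
    omega
  · have hQ' := Finset.mem_erase.mp hQ
    refine mul_mem_sect (self_mem_sect P (a Q) le_rfl)
      (he2 Q P (by simp [hQ'.1.symm, hP])) ?_
    have := hle P hP Q hQ'.2
    omega

end PlaceSystem

namespace PlaceSystem

variable {k K ι : Type*} [Field k] [Field K] [Algebra k K] {𝒮 : PlaceSystem k K ι}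

/-! ### Coefficients of local expansions -/

/-- The leading coefficient of a function of order at least `-m`, as a linear form. -/
theorem exists_leadingCoeff (P : ι) (m : ℤ) :
    ∃ h : K →ₗ[k] k, 𝒮.sect P m ⊓ LinearMap.ker h = 𝒮.sect P (m - 1) ∧
      ∀ c, ∃ f ∈ 𝒮.sect P m, h f = c := by
  obtain ⟨t, ht0, ht⟩ := 𝒮.exists_pos_ord P
  have h1 : (1 : K) ∉ 𝒮.sect P (-1) := by
    rw [mem_sect_of_ne one_ne_zero, 𝒮.ord_one]
    simp
  obtain ⟨φ, hφ1, hφ⟩ := Submodule.exists_le_ker_of_notMem h1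
  have htm : t ^ m ≠ 0 := zpow_ne_zero m ht0
  have hshift : ∀ f (l : ℤ), f ∈ 𝒮.sect P l ↔ f * t ^ m ∈ 𝒮.sect P (l - m) := by
    intro f l
    by_cases hf : f = 0
    · simp [hf]
    rw [mem_sect_of_ne hf, mem_sect_of_ne (mul_ne_zero hf htm), 𝒮.ord_mul P hf htm, 𝒮.ord_zpow, ht]
    constructor <;> intro <;> omega
  refine ⟨φ ∘ₗ LinearMap.mulRight k (t ^ m), ?_, fun c => ?_⟩
  · ext f
    simp only [Submodule.mem_inf, LinearMap.mem_ker, LinearMap.comp_apply,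
      LinearMap.mulRight_apply]
    rw [hshift f m, hshift f (m - 1), sub_self, show m - 1 - m = -1 by ring]
    constructor
    · rintro ⟨hf, hφf⟩
      obtain ⟨c, hc⟩ := 𝒮.exists_residue P (mem_sect_zero.mp hf)
      have hmem : f * t ^ m - algebraMap k K c ∈ 𝒮.sect P (-1) :=
        hc.imp id fun h => by omega
      have h0 := hφ hmem
      rw [LinearMap.mem_ker, map_sub, hφf, Algebra.algebraMap_eq_smul_one, map_smul,
        zero_sub, neg_eq_zero, smul_eq_mul, mul_eq_zero, or_iff_left hφ1] at h0
      simpa [h0] using hmem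
    · intro hf
      exact ⟨sect_mono P (by omega) hf, hφ hf⟩
  · refine ⟨(c / φ 1) • (t ^ m)⁻¹, Submodule.smul_mem _ _ (self_mem_sect P _ ?_), ?_⟩
    · rw [𝒮.ord_inv, 𝒮.ord_zpow, ht]
      omega
    · simp [htm, hφ1]

/-- The first `r` coefficients of the expansion at `P` of a function of order at least `-m`. -/
theorem exists_coeffs (P : ι) (m : ℤ) (r : ℕ) :
    ∃ g : K →ₗ[k] (Fin r → k), 𝒮.sect P m ⊓ LinearMap.ker g = 𝒮.sect P (m - r) ∧
      ∀ v, ∃ f ∈ 𝒮.sect P m, g f = v := by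
  induction r with
  | zero =>
    refine ⟨0, by simp, fun v => ⟨0, zero_mem _, Subsingleton.elim _ _⟩⟩
  | succ r ih =>
    obtain ⟨g, hg, hgs⟩ := ih
    obtain ⟨h, hh, hhs⟩ := 𝒮.exists_leadingCoeff P (m - r)
    refine ⟨LinearMap.pi (Fin.cons h fun i => LinearMap.proj i ∘ₗ g), ?_, fun v => ?_⟩
    · have : LinearMap.ker (LinearMap.pi (Fin.cons h fun i => LinearMap.proj i ∘ₗ g) :
          K →ₗ[k] (Fin (r + 1) → k)) = LinearMap.ker g ⊓ LinearMap.ker h := by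
        ext f
        simp only [LinearMap.mem_ker, Submodule.mem_inf, funext_iff, LinearMap.pi_apply,
          Fin.forall_fin_succ]
        simp [and_comm]
      rw [this, ← inf_assoc, hg, hh]
      congr 1
      push_cast
      ring
    · obtain ⟨f, hf, hfv⟩ := hgs fun i => v i.succ
      obtain ⟨f', hf', hfv'⟩ := hhs (v 0 - h f)
      rw [← hg] at hf'
      refine ⟨f + f', add_mem hf hf'.1, ?_⟩
      ext i
      refine Fin.cases ?_ (fun i => ?_) i
      · simp [hfv']
      · have := LinearMap.mem_ker.mp hf'.2
        simp [hfv, this]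

/-! ### Functions without poles -/

/-- A function that is regular at all places lying over a subring is integral over it. -/
theorem isIntegral_of_forall {R : Type*} [CommRing R] [Algebra R K]
    (hk : ∀ c : k, algebraMap k K c ∈ (algebraMap R K).range) {f : K}
    (h : ∀ P, (∀ r, algebraMap R K r ∈ 𝒮.valRing P) → f ∈ 𝒮.valRing P) : IsIntegral R f := by
  by_contra hf
  have hf' : f ∉ (integralClosure R K).toSubring := hf
  have : IsIntegrallyClosedIn (integralClosure R K).toSubring K :=
    inferInstanceAs (IsIntegrallyClosedIn (integralClosure R K) K)
  obtain ⟨V, hV, hfV⟩ := Subring.exists_le_valuationSubring_of_isIntegrallyClosedIn hf'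
  have hRV : ∀ r, algebraMap R K r ∈ V := fun r => hV (algebraMap_mem (integralClosure R K) r)
  obtain ⟨P, hP⟩ := 𝒮.complete V (fun c => by
    obtain ⟨r, hr⟩ := hk c
    exact hr ▸ hRV r) (by
      rintro rfl
      exact hfV trivial)
  exact hfV ((hP f).mpr (mem_valRing.mp (h P fun r => mem_valRing.mpr ((hP _).mp (hRV r)))))

/-- A function without poles is constant. -/
theorem exists_const_of_forall [IsAlgClosed k] {f : K} (h : ∀ P, 0 ≤ 𝒮.ord P f) :
    ∃ c : k, algebraMap k K c = f := by
  have hf : IsIntegral k f :=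
    isIntegral_of_forall (𝒮 := 𝒮) (fun c => ⟨c, rfl⟩) fun P _ => mem_valRing.mpr (h P)
  exact minpoly.mem_range_of_degree_eq_one k f
    (IsAlgClosed.degree_eq_one_of_irreducible k (minpoly.irreducible hf))

end PlaceSystem

namespace PlaceSystem

variable {k K ι : Type*} [Field k] [Field K] [Algebra k K] {𝒮 : PlaceSystem k K ι}

/-! ### Places over a subfield -/

section Below

variable (F : Type*) [Field F] [Algebra F K]

variable (𝒮) in
/-- The valuation ring of the place of `F` below a place of `K`. -/
def below (P : ι) : ValuationSubring F := (𝒮.valRing P).comap (algebraMap F K)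

variable {F}

theorem algebraMap_ne_zero {f : F} (hf : f ≠ 0) : algebraMap F K f ≠ 0 :=
  (map_ne_zero _).mpr hf

theorem mem_below {P : ι} {f : F} : f ∈ 𝒮.below F P ↔ 0 ≤ 𝒮.ord P (algebraMap F K f) := mem_valRing

theorem below_ne_top [FiniteDimensional F K] (P : ι) : 𝒮.below F P ≠ ⊤ := by
  intro h
  refine valRing_ne_top (𝒮 := 𝒮) P (top_le_iff.mp fun f _ => ?_)
  let i : F →+* 𝒮.valRing P := (algebraMap F K).codRestrict (𝒮.valRing P).toSubring fun a =>
    (show a ∈ 𝒮.below F P from h ▸ ValuationSubring.mem_top a)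
  have hf : IsIntegral (𝒮.valRing P) f := by
    obtain ⟨p, hp, hpf⟩ := (Algebra.IsIntegral.isIntegral (R := F) f)
    exact ⟨p.map i, hp.map i, by rw [Polynomial.eval₂_map]; exact hpf⟩
  obtain ⟨y, hy⟩ := (IsIntegrallyClosed.isIntegral_iff (R := 𝒮.valRing P) (K := K)).mp hf
  rw [← hy]
  exact y.2

variable (𝒮) in
/-- `π` is a uniformizer of the place of `F` below `P`. -/
structure IsUniformizerBelow (P : ι) (π : F) : Prop where
  pos : 0 < 𝒮.ord P (algebraMap F K π)
  dvd : ∀ f : F, f ≠ 0 → 𝒮.ord P (algebraMap F K π) ∣ 𝒮.ord P (algebraMap F K f)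

namespace IsUniformizerBelow

variable {P₀ : ι} {π : F}

theorem ne_zero (hπ : 𝒮.IsUniformizerBelow P₀ π) : π ≠ 0 := by
  rintro rfl
  have := hπ.pos
  simp [𝒮.ord_zero] at this

theorem exists_eq_zpow_mul (hπ : 𝒮.IsUniformizerBelow P₀ π) {f : F} (hf : f ≠ 0) :
    ∃ (m : ℤ) (u : F), u ≠ 0 ∧ 𝒮.ord P₀ (algebraMap F K u) = 0 ∧ f = π ^ m * u := by
  obtain ⟨m, hm⟩ := hπ.dvd f hf
  have hπ0 := hπ.ne_zero
  refine ⟨m, f / π ^ m, div_ne_zero hf (zpow_ne_zero m hπ0), ?_, ?_⟩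
  · rw [map_div₀, map_zpow₀, 𝒮.ord_div P₀ (by simpa) (zpow_ne_zero m (by simpa)), 𝒮.ord_zpow, hm]
    ring
  · rw [mul_div_cancel₀ _ (zpow_ne_zero m hπ0)]

theorem ord_eq_zero_of_le {P : ι} (h : 𝒮.below F P₀ ≤ 𝒮.below F P) {u : F}
    (hu : 𝒮.ord P₀ (algebraMap F K u) = 0) : 𝒮.ord P (algebraMap F K u) = 0 := by
  have h1 := mem_below.mp (h (mem_below.mpr hu.ge))
  have h2 := mem_below.mp (h ((mem_below (f := u⁻¹)).mpr (by rw [map_inv₀, 𝒮.ord_inv, hu]; rfl)))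
  rw [map_inv₀, 𝒮.ord_inv] at h2
  omega

/-- The ramification indices at places with the same restriction to `F` are proportional. -/
theorem ord_mul_eq (hπ : 𝒮.IsUniformizerBelow P₀ π) {P : ι} (h : 𝒮.below F P₀ ≤ 𝒮.below F P)
    (f : F) : 𝒮.ord P (algebraMap F K f) * 𝒮.ord P₀ (algebraMap F K π) =
      𝒮.ord P₀ (algebraMap F K f) * 𝒮.ord P (algebraMap F K π) := by
  by_cases hf : f = 0
  · simp [hf, 𝒮.ord_zero]
  obtain ⟨m, u, hu0, hu, rfl⟩ := hπ.exists_eq_zpow_mul hf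
  have hπ0 : algebraMap F K π ^ m ≠ 0 := zpow_ne_zero m (by simpa using hπ.ne_zero)
  have hu0' : algebraMap F K u ≠ 0 := by simpa
  rw [map_mul, map_zpow₀, 𝒮.ord_mul P hπ0 hu0', 𝒮.ord_mul P₀ hπ0 hu0', hu,
    ord_eq_zero_of_le h hu, 𝒮.ord_zpow, 𝒮.ord_zpow]
  ring

theorem pos_of_le [FiniteDimensional F K] (hπ : 𝒮.IsUniformizerBelow P₀ π) {P : ι}
    (h : 𝒮.below F P₀ ≤ 𝒮.below F P) : 0 < 𝒮.ord P (algebraMap F K π) := by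
  refine lt_of_le_of_ne (mem_below.mp (h (mem_below.mpr hπ.pos.le))) fun h0 => ?_
  refine below_ne_top (𝒮 := 𝒮) (F := F) P (top_le_iff.mp fun f _ => mem_below.mpr ?_)
  have := hπ.ord_mul_eq h f
  rw [← h0, mul_zero, mul_eq_zero, or_iff_left hπ.pos.ne'] at this
  exact this.ge

/-- There are finitely many places of `K` over a given place of `F`. -/
theorem finite_fibre [FiniteDimensional F K] (hπ : 𝒮.IsUniformizerBelow P₀ π) :
    {P | 𝒮.below F P₀ ≤ 𝒮.below F P}.Finite :=
  (𝒮.finite_support (f := algebraMap F K π) (by simpa using hπ.ne_zero)).subset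
    fun _ h => (hπ.pos_of_le h).ne'

/-- In particular the valuation ring is a principal ideal domain, over which the integral closure in
`K` is a free module of finite rank. -/
theorem isDiscreteValuationRing (hπ : 𝒮.IsUniformizerBelow P₀ π) :
    IsDiscreteValuationRing (𝒮.below F P₀) := by
  let p : 𝒮.below F P₀ := ⟨π, mem_below.mpr hπ.pos.le⟩
  have hπ0 := hπ.ne_zero
  have hunit : ∀ u : 𝒮.below F P₀, IsUnit u ↔ (u : F) ≠ 0 ∧
      𝒮.ord P₀ (algebraMap F K u) = 0 := by
    intro u
    constructor
    · intro hu
      obtain ⟨v, hv⟩ := hu.exists_right_inv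
      have hv' : (u : F) * v = 1 := congrArg Subtype.val hv
      have h0 := left_ne_zero_of_mul_eq_one hv'
      refine ⟨h0, ?_⟩
      have h1 := congrArg (fun z => 𝒮.ord P₀ (algebraMap F K z)) hv'
      simp only [map_mul, map_one, 𝒮.ord_one] at h1
      rw [𝒮.ord_mul _ (algebraMap_ne_zero h0)
        (algebraMap_ne_zero (right_ne_zero_of_mul_eq_one hv'))] at h1
      have h2 := mem_below.mp u.2
      have h3 := mem_below.mp v.2
      omega
    · rintro ⟨h0, h1⟩
      refine IsUnit.of_mul_eq_one ⟨(u : F)⁻¹, mem_below.mpr ?_⟩ (Subtype.ext (mul_inv_cancel₀ h0))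
      rw [map_inv₀, 𝒮.ord_inv, h1]
      rfl
  refine IsDiscreteValuationRing.ofHasUnitMulPowIrreducibleFactorization ⟨p, ⟨?_, ?_⟩, ?_⟩
  · rw [hunit]
    exact fun h => hπ.pos.ne' h.2
  · rintro a b hab
    have hab' : π = (a : F) * b := congrArg Subtype.val hab
    have ha : (a : F) ≠ 0 := left_ne_zero_of_mul (hab' ▸ hπ0)
    have hb : (b : F) ≠ 0 := right_ne_zero_of_mul (hab' ▸ hπ0)
    have h1 := congrArg (fun z => 𝒮.ord P₀ (algebraMap F K z)) hab'
    simp only [map_mul] at h1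
    rw [𝒮.ord_mul _ (algebraMap_ne_zero ha) (algebraMap_ne_zero hb)] at h1
    obtain ⟨i, hi⟩ := hπ.dvd a ha
    obtain ⟨j, hj⟩ := hπ.dvd b hb
    have h2 := mem_below.mp a.2
    have h3 := mem_below.mp b.2
    have h4 := hπ.pos
    rw [hi] at h1 h2
    rw [hj] at h1 h3
    have hi0 : 0 ≤ i := nonneg_of_mul_nonneg_right h2 h4
    have hj0 : 0 ≤ j := nonneg_of_mul_nonneg_right h3 h4
    have hij : i + j = 1 := by
      have : 𝒮.ord P₀ (algebraMap F K π) * (i + j) = 𝒮.ord P₀ (algebraMap F K π) * 1 := by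
        rw [mul_one]; linarith
      exact mul_left_cancel₀ h4.ne' this
    rw [hunit, hunit, hi, hj]
    rcases (by omega : i = 0 ∨ j = 0) with rfl | rfl
    · exact Or.inl ⟨ha, by simp⟩
    · exact Or.inr ⟨hb, by simp⟩
  · rintro ⟨f, hf⟩ hf0
    have hf0' : f ≠ 0 := fun h => hf0 (Subtype.ext h)
    obtain ⟨m, u, hu0, hu, rfl⟩ := hπ.exists_eq_zpow_mul hf0'
    have hm := mem_below.mp hf
    rw [map_mul, map_zpow₀, 𝒮.ord_mul _ (zpow_ne_zero m (by simpa)) (by simpa), 𝒮.ord_zpow, hu,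
      add_zero] at hm
    have hm0 : 0 ≤ m := nonneg_of_mul_nonneg_left hm hπ.pos
    lift m to ℕ using hm0
    let u' : 𝒮.below F P₀ := ⟨u, mem_below.mpr hu.ge⟩
    refine ⟨m, ((hunit u').mpr ⟨hu0, hu⟩).unit, Subtype.ext ?_⟩
    simp [p, u']

end IsUniformizerBelow

variable [Algebra k F] [IsScalarTower k F K]

theorem algebraMap_mem_below (P : ι) (c : k) : algebraMap k F c ∈ 𝒮.below F P := by
  rw [mem_below, ← IsScalarTower.algebraMap_apply, 𝒮.ord_algebraMap]

/-- The functions that are regular at all places over a given place of `F` form a free module over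
the valuation ring of that place, with a basis that is also a basis of `K` over `F`. -/
theorem IsUniformizerBelow.exists_integral_basis [CharZero k] [FiniteDimensional F K] {P₀ : ι}
    {π : F} (hπ : 𝒮.IsUniformizerBelow P₀ π) :
    ∃ b : Module.Basis (Fin (Module.finrank F K)) F K, ∀ β,
      (∀ P, 𝒮.below F P₀ ≤ 𝒮.below F P → 0 ≤ 𝒮.ord P β) ↔ ∀ i, b.repr β i ∈ 𝒮.below F P₀ := by
  have : CharZero F := charZero_of_injective_algebraMap (algebraMap k F).injective
  have := hπ.isDiscreteValuationRing
  let R := 𝒮.below F P₀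
  let C := integralClosure R K
  have : Module.IsTorsionFree R K := Module.IsTorsionFree.trans_faithfulSMul R F K
  have hfree : Module.Free R C := IsIntegralClosure.module_free R F K C
  have hfin : Module.Finite R C := IsIntegralClosure.finite R F K C
  have : IsLocalization (Algebra.algebraMapSubmonoid C (nonZeroDivisors R)) K :=
    IsIntegralClosure.isLocalization R F K C
  let b₀ : Module.Basis (Fin (Module.finrank F K)) R C :=
    Module.finBasisOfFinrankEq R C (IsIntegralClosure.rank R F K C)
  let b := b₀.localizationLocalization F (nonZeroDivisors R) K
  have hC : ∀ β, (∀ P, 𝒮.below F P₀ ≤ 𝒮.below F P → 0 ≤ 𝒮.ord P β) ↔ β ∈ C := by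
    intro β
    constructor
    · intro h
      refine isIntegral_of_forall (𝒮 := 𝒮) (R := R) (fun c => ?_) fun P hP => ?_
      · exact ⟨⟨_, algebraMap_mem_below P₀ c⟩, (IsScalarTower.algebraMap_apply k F K c).symm⟩
      · exact mem_valRing.mpr (h P fun r hr => hP ⟨r, hr⟩)
    · intro hβ P hP
      let i : R →+* 𝒮.valRing P := ((algebraMap F K).comp R.subtype).codRestrict
        (𝒮.valRing P).toSubring fun a => hP a.2
      have hf : IsIntegral (𝒮.valRing P) β := by
        obtain ⟨p, hp, hpf⟩ := hβ
        exact ⟨p.map i, hp.map i, by rw [Polynomial.eval₂_map]; exact hpf⟩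
      obtain ⟨y, hy⟩ := (IsIntegrallyClosed.isIntegral_iff (R := 𝒮.valRing P) (K := K)).mp hf
      rw [← hy]
      exact mem_valRing.mp y.2
  refine ⟨b, fun β => ?_⟩
  rw [hC]
  constructor
  · intro hβ i
    have : b.repr β i = algebraMap R F (b₀.repr ⟨β, hβ⟩ i) :=
      b₀.localizationLocalization_repr_algebraMap F (nonZeroDivisors R) K ⟨β, hβ⟩ i
    rw [this]
    exact (b₀.repr ⟨β, hβ⟩ i).2
  · intro h
    rw [← b.sum_repr β]
    refine sum_mem fun i _ => ?_
    have : b i = (b₀ i : K) := b₀.localizationLocalization_apply F (nonZeroDivisors R) K i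
    rw [this]
    exact C.smul_mem (b₀ i).2 (⟨_, h i⟩ : R)

end Below
end PlaceSystem

/-! ### The fundamental equality and traces -/

/-- In characteristic zero the trace of a nonzero idempotent matrix is nonzero, being its rank. -/
theorem trace_ne_zero_of_isIdempotentElem {κ n : Type*} [Field κ] [CharZero κ] [Fintype n]
    [DecidableEq n] {M : Matrix n n κ} (hM : IsIdempotentElem M) (h0 : M ≠ 0) : M.trace ≠ 0 := by
  have h1 : IsIdempotentElem (Matrix.toLin' M) := by
    rw [IsIdempotentElem, Module.End.mul_eq_comp, ← Matrix.toLin'_mul, hM.eq]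
  have h2 := (LinearMap.IsIdempotentElem.isProj_range _ h1).trace
  rw [Matrix.trace_toLin'_eq] at h2
  rw [h2]
  intro h3
  rw [Nat.cast_eq_zero, Submodule.finrank_eq_zero, LinearMap.range_eq_bot] at h3
  exact h0 (by simpa using h3)

namespace PlaceSystem

variable {k K ι : Type*} [Field k] [Field K] [Algebra k K] {𝒮 : PlaceSystem k K ι}

section Below

variable {F : Type*} [Field F] [Algebra F K] [Algebra k F] [IsScalarTower k F K]

namespace IsUniformizerBelow

variable {P₀ : ι} {π : F}

/-- The residue field of a place of `F` is `k`. -/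
theorem exists_residue (hπ : 𝒮.IsUniformizerBelow P₀ π) {f : F} (hf : f ∈ 𝒮.below F P₀) :
    ∃ (c : k) (s : F), s ∈ 𝒮.below F P₀ ∧ f = algebraMap k F c + π * s := by
  obtain ⟨c, hc⟩ := 𝒮.exists_residue P₀ (mem_below.mp hf)
  have hπ0 := hπ.ne_zero
  refine ⟨c, (f - algebraMap k F c) / π, ?_, by rw [mul_div_cancel₀ _ hπ0]; ring⟩
  rw [IsScalarTower.algebraMap_apply k F K, ← map_sub] at hc
  by_cases h0 : f - algebraMap k F c = 0
  · simp [h0]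
  rw [mem_below, map_div₀, 𝒮.ord_div _ (algebraMap_ne_zero h0) (algebraMap_ne_zero hπ0)]
  have h1 := hc.resolve_left (algebraMap_ne_zero h0)
  obtain ⟨i, hi⟩ := hπ.dvd _ h0
  have h2 := hπ.pos
  rw [hi] at h1 ⊢
  have : 0 < i := pos_of_mul_pos_right (by omega) h2.le
  nlinarith

/-- The fundamental equality: the ramification indices over a place of `F` sum to the degree. -/
theorem sum_ord_fibre [CharZero k] [FiniteDimensional F K] (hπ : 𝒮.IsUniformizerBelow P₀ π) :
    ∑ P ∈ hπ.finite_fibre.toFinset, 𝒮.ord P (algebraMap F K π) = Module.finrank F K := by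
  obtain ⟨b, hb⟩ := hπ.exists_integral_basis (k := k)
  set S := hπ.finite_fibre.toFinset with hS
  have hmemS : ∀ P, P ∈ S ↔ 𝒮.below F P₀ ≤ 𝒮.below F P := fun P => by simp [hS]
  have hπ0 : algebraMap F K π ≠ 0 := algebraMap_ne_zero hπ.ne_zero
  let r : ι → ℕ := fun P => (𝒮.ord P (algebraMap F K π)).toNat
  have hr : ∀ P ∈ S, (r P : ℤ) = 𝒮.ord P (algebraMap F K π) := fun P hP =>
    Int.toNat_of_nonneg (hπ.pos_of_le ((hmemS P).mp hP)).le
  choose g hg hgs using fun P => 𝒮.exists_coeffs P 0 (r P)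
  have hmul : ∀ β, (∀ P, 𝒮.below F P₀ ≤ 𝒮.below F P → 0 ≤ 𝒮.ord P β) → ∀ P ∈ S,
      g P (algebraMap F K π * β) = 0 := by
    intro β hβ P hP
    have h1 : algebraMap F K π * β ∈ 𝒮.sect P (0 - r P) :=
      mul_mem_sect (self_mem_sect P _ le_rfl) (mem_sect_zero.mpr (hβ P ((hmemS P).mp hP)))
        (by rw [hr P hP]; omega)
    rw [← hg P] at h1
    exact h1.2
  let ψ : (Fin (Module.finrank F K) → k) →ₗ[k] (∀ P : S, Fin (r P) → k) :=
    (LinearMap.pi fun P : S => g P) ∘ₗ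
      Fintype.linearCombination k (fun i => b i)
  have hψ : ∀ c P, ψ c P = g P (∑ i, c i • b i) := fun c P => rfl
  have hrepr : ∀ (c : Fin (Module.finrank F K) → k) i,
      b.repr (∑ i, c i • b i) i = algebraMap k F (c i) := by
    intro c i
    have : ∑ i, c i • b i = ∑ i, algebraMap k F (c i) • b i := by simp
    rw [this, b.repr_sum_self]
  have hinj : Function.Injective ψ := by
    rw [← LinearMap.ker_eq_bot, LinearMap.ker_eq_bot']
    intro c hc
    set β := ∑ i, c i • b i with hβ
    have hβB : ∀ P, 𝒮.below F P₀ ≤ 𝒮.below F P → 0 ≤ 𝒮.ord P β := by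
      rw [hb]
      intro i
      rw [hβ, hrepr]
      exact algebraMap_mem_below P₀ _
    have hdiv : ∀ P, 𝒮.below F P₀ ≤ 𝒮.below F P → 0 ≤ 𝒮.ord P (β / algebraMap F K π) := by
      intro P hP
      have hPS := (hmemS P).mpr hP
      have h1 : β ∈ 𝒮.sect P (0 - r P) := by
        rw [← hg P]
        exact ⟨mem_sect_zero.mpr (hβB P hP), (hψ c ⟨P, hPS⟩).symm.trans (congrFun hc ⟨P, hPS⟩)⟩
      rw [← mem_sect_zero, div_eq_mul_inv]
      refine mul_mem_sect h1 (self_mem_sect P _ le_rfl) ?_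
      rw [𝒮.ord_inv, hr P hPS]
      omega
    rw [hb] at hdiv
    ext i
    have h2 := hdiv i
    have h3 : β = π • (β / algebraMap F K π) := by
      rw [Algebra.smul_def, mul_div_cancel₀ _ hπ0]
    have h4 : algebraMap k F (c i) = π * b.repr (β / algebraMap F K π) i := by
      rw [← hrepr c i, ← hβ]
      conv_lhs => rw [h3]
      simp
    by_contra hci
    have hci' : algebraMap k F (c i) ≠ 0 := by simpa using hci
    have h5 : b.repr (β / algebraMap F K π) i ≠ 0 := fun h => hci' (by rw [h4, h, mul_zero])
    have h6 := congrArg (fun z => 𝒮.ord P₀ (algebraMap F K z)) h4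
    simp only [map_mul, ← IsScalarTower.algebraMap_apply, 𝒮.ord_algebraMap] at h6
    rw [𝒮.ord_mul _ hπ0 (algebraMap_ne_zero h5)] at h6
    have h7 := mem_below.mp h2
    have h8 := hπ.pos
    omega
  have hsurj : Function.Surjective ψ := by
    classical
    intro v
    choose f hf hfv using fun P : S => hgs P (v P)
    obtain ⟨β, hβ⟩ := 𝒮.weak_approximation S (fun P => if h : P ∈ S then f ⟨P, h⟩ else 0)
      (fun P => 0 - r P)
    have hβ' : ∀ P : S, β - f P ∈ 𝒮.sect P (0 - r P) := fun P => by simpa using hβ P P.2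
    have hβB : ∀ P, 𝒮.below F P₀ ≤ 𝒮.below F P → 0 ≤ 𝒮.ord P β := by
      intro P hP
      have hPS := (hmemS P).mpr hP
      rw [← mem_sect_zero, ← sub_add_cancel β (f ⟨P, hPS⟩)]
      exact add_mem (sect_mono P (by omega) (hβ' ⟨P, hPS⟩)) (hf ⟨P, hPS⟩)
    have hβg : ∀ P : S, g P β = v P := by
      intro P
      have := hβ' P
      rw [← hg P] at this
      rw [← sub_add_cancel β (f P), map_add, hfv, this.2, zero_add]
    choose c s hs hcs using fun i => hπ.exists_residue (k := k) ((hb β).mp hβB i)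
    refine ⟨c, funext fun P => ?_⟩
    have h1 : β = ∑ i, c i • b i + algebraMap F K π * ∑ i, s i • b i := by
      conv_lhs => rw [← b.sum_repr β]
      rw [Finset.mul_sum, ← Finset.sum_add_distrib]
      refine Finset.sum_congr rfl fun i _ => ?_
      rw [hcs i, add_smul, algebraMap_smul, mul_smul, Algebra.smul_def π]
    rw [hψ, ← hβg P]
    conv_rhs => rw [h1]
    rw [map_add, hmul _ _ P P.2, add_zero]
    rw [hb]
    intro i
    rw [b.repr_sum_self]
    exact hs i
  have h := (LinearEquiv.ofBijective ψ ⟨hinj, hsurj⟩).finrank_eq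
  simp only [Module.finrank_fin_fun, Module.finrank_pi_fintype k
    (M := fun P : S => Fin (r P) → k)] at h
  rw [h, ← Finset.sum_coe_sort]
  push_cast
  exact Finset.sum_congr rfl fun P _ => (hr P P.2).symm

/-- The trace of a function that is close to an idempotent at the places over a given place of `F`
does not vanish there: modulo the place, it is the rank of an idempotent matrix over `k`. -/
theorem ord_trace_eq_zero [CharZero k] [FiniteDimensional F K] (hπ : 𝒮.IsUniformizerBelow P₀ π)
    {u : K} (hu : ∀ P, 𝒮.below F P₀ ≤ 𝒮.below F P → 0 ≤ 𝒮.ord P u)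
    (hu2 : ∀ P, 𝒮.below F P₀ ≤ 𝒮.below F P →
      0 ≤ 𝒮.ord P ((u * u - u) / algebraMap F K π))
    (hu1 : ∃ P, 𝒮.below F P₀ ≤ 𝒮.below F P ∧ 𝒮.ord P u = 0 ∧ u ≠ 0) :
    Algebra.trace F K u ≠ 0 ∧ 𝒮.ord P₀ (algebraMap F K (Algebra.trace F K u)) = 0 := by
  obtain ⟨b, hb⟩ := hπ.exists_integral_basis (k := k)
  have hπ0 := hπ.ne_zero
  have hπ0' := algebraMap_ne_zero (K := K) hπ0
  let R := 𝒮.below F P₀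
  have hR : IsUnit (⟨π, mem_below.mpr hπ.pos.le⟩ : R) → False := by
    intro h
    obtain ⟨v, hv⟩ := h.exists_right_inv
    have hv' : π * v = 1 := congrArg Subtype.val hv
    have h1 := congrArg (fun z => 𝒮.ord P₀ (algebraMap F K z)) hv'
    simp only [map_mul, map_one, 𝒮.ord_one] at h1
    rw [𝒮.ord_mul _ hπ0' (algebraMap_ne_zero (right_ne_zero_of_mul_eq_one hv'))] at h1
    have h2 := mem_below.mp v.2
    have h3 := hπ.pos
    omega
  have hres_pi : ∀ r : R, residue R (⟨π, mem_below.mpr hπ.pos.le⟩ * r) = 0 := by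
    intro r
    rw [residue_eq_zero_iff, mem_maximalIdeal, mem_nonunits_iff]
    exact fun h => hR (isUnit_of_mul_isUnit_left h)
  have hres_zero : ∀ r : R, residue R r = 0 → ∃ s : R, (r : F) = π * s := by
    intro r hr
    obtain ⟨c, s, hs, hcs⟩ := hπ.exists_residue (k := k) r.2
    have hr' : r = ⟨algebraMap k F c, algebraMap_mem_below P₀ c⟩ +
        ⟨π, mem_below.mpr hπ.pos.le⟩ * ⟨s, hs⟩ := Subtype.ext hcs
    rw [hr', map_add, hres_pi, add_zero] at hr
    have hc : c = 0 := by
      by_contra hc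
      rw [residue_eq_zero_iff, mem_maximalIdeal, mem_nonunits_iff] at hr
      refine hr (IsUnit.of_mul_eq_one ⟨algebraMap k F c⁻¹, algebraMap_mem_below P₀ c⁻¹⟩
        (Subtype.ext ?_))
      change algebraMap k F c * algebraMap k F c⁻¹ = 1
      rw [← map_mul, mul_inv_cancel₀ hc, map_one]
    exact ⟨⟨s, hs⟩, by rw [hcs, hc]; simp⟩
  have hbB : ∀ j P, 𝒮.below F P₀ ≤ 𝒮.below F P → 0 ≤ 𝒮.ord P (b j) := by
    intro j
    rw [hb]
    intro i
    rw [b.repr_self, Finsupp.single_apply]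
    split_ifs
    exacts [one_mem _, zero_mem _]
  have hmem : ∀ β, (∀ P, 𝒮.below F P₀ ≤ 𝒮.below F P → 0 ≤ 𝒮.ord P β) →
      ∀ i j, Algebra.leftMulMatrix b β i j ∈ R := by
    intro β hβ i j
    rw [Algebra.leftMulMatrix_eq_repr_mul]
    refine (hb _).mp (fun P hP => ?_) i
    rw [← mem_sect_zero]
    exact mul_mem_sect (mem_sect_zero.mpr (hβ P hP)) (mem_sect_zero.mpr (hbB j P hP)) (by simp)
  let M : Matrix (Fin (Module.finrank F K)) (Fin (Module.finrank F K)) R :=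
    Matrix.of fun i j => ⟨_, hmem u hu i j⟩
  have hM : M.map R.subtype = Algebra.leftMulMatrix b u := rfl
  have hMbar : IsIdempotentElem (M.map (residue R)) := by
    have h1 : Algebra.leftMulMatrix b ((u * u - u) / algebraMap F K π) * Algebra.leftMulMatrix b
        (algebraMap F K π) = (M * M - M).map R.subtype := by
      rw [← map_mul, div_mul_cancel₀ _ hπ0', map_sub, map_mul, ← hM, ← Matrix.map_mul,
        Matrix.map_sub _ (map_sub R.subtype)]
    have h2 : (M * M - M).map (residue R) = 0 := by
      ext i j
      have h3 : (M * M - M) i j =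
          ⟨π, mem_below.mpr hπ.pos.le⟩ * ⟨_, hmem _ hu2 i j⟩ := by
        refine Subtype.ext ?_
        have h4 := congrFun (congrFun h1 i) j
        rw [AlgHom.commutes, ← Algebra.commutes, ← Algebra.smul_def] at h4
        change R.subtype ((M * M - M) i j) = π * _
        exact h4.symm
      rw [Matrix.map_apply, h3, hres_pi]
      rfl
    rw [Matrix.map_sub _ (map_sub (residue R)), sub_eq_zero, Matrix.map_mul] at h2
    exact h2
  have hMbar0 : M.map (residue R) ≠ 0 := by
    intro h0
    obtain ⟨P, hP, hPu, hu0⟩ := hu1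
    have h1 : ∀ i j, ∃ s : R, Algebra.leftMulMatrix b u i j = π * s := fun i j =>
      hres_zero (M i j) (congrFun (congrFun h0 i) j)
    choose s hs using h1
    have hone : ∀ i, b.repr 1 i ∈ R := (hb 1).mp fun P _ => (𝒮.ord_one P).ge
    have h2 : u = algebraMap F K π * ∑ i, (∑ j, s i j * b.repr 1 j) • b i := by
      conv_lhs => rw [← b.sum_repr u]
      rw [Finset.mul_sum]
      refine Finset.sum_congr rfl fun i _ => ?_
      have h3 := congrFun (Algebra.leftMulMatrix_mulVec_repr b u 1) i
      rw [mul_one] at h3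
      rw [← h3, Matrix.mulVec, dotProduct, ← Algebra.smul_def, smul_smul, Finset.mul_sum]
      congr 1
      refine Finset.sum_congr rfl fun j _ => ?_
      rw [hs, mul_assoc]
    have h4 : ∑ i, (∑ j, s i j * b.repr 1 j) • b i ∈ 𝒮.sect P 0 := by
      rw [mem_sect_zero]
      refine (hb _).mpr (fun i => ?_) P hP
      rw [b.repr_sum_self]
      exact sum_mem fun j _ => mul_mem (s i j).2 (hone j)
    have h5 : u ∈ 𝒮.sect P (-1) := by
      rw [h2]
      refine mul_mem_sect (self_mem_sect P _ le_rfl) h4 ?_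
      have := hπ.pos_of_le hP
      omega
    rcases h5 with h5 | h5
    · exact hu0 h5
    · omega
  have htr : residue R M.trace ≠ 0 := by
    have hchar : CharZero (ResidueField R) := by
      let i : k →+* R := (algebraMap k F).codRestrict R.toSubring (algebraMap_mem_below P₀)
      exact charZero_of_injective_ringHom ((residue R).comp i).injective
    rw [AddMonoidHom.map_trace]
    exact trace_ne_zero_of_isIdempotentElem hMbar hMbar0
  have htrace : Algebra.trace F K u = (M.trace : F) := by
    rw [Algebra.trace_eq_matrix_trace b, ← hM]
    exact (AddMonoidHom.map_trace R.subtype M).symm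
  have hunit : IsUnit M.trace := by
    by_contra h
    exact htr ((residue_eq_zero_iff _).mpr ((mem_maximalIdeal _).mpr h))
  obtain ⟨v, hv⟩ := hunit.exists_right_inv
  have hv' : (M.trace : F) * v = 1 := congrArg Subtype.val hv
  have h0 := left_ne_zero_of_mul_eq_one hv'
  rw [htrace]
  refine ⟨h0, ?_⟩
  have h1 := congrArg (fun z => 𝒮.ord P₀ (algebraMap F K z)) hv'
  simp only [map_mul, map_one, 𝒮.ord_one] at h1
  rw [𝒮.ord_mul _ (algebraMap_ne_zero h0)
    (algebraMap_ne_zero (right_ne_zero_of_mul_eq_one hv'))] at h1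
  have h2 := mem_below.mp M.trace.2
  have h3 := mem_below.mp v.2
  omega

end IsUniformizerBelow
end Below
end PlaceSystem

namespace PlaceSystem

variable {k K ι : Type*} [Field k] [Field K] [Algebra k K]

/-! ### Rational subfields and differentials -/

section Finite

open IntermediateField

/-- The function field is generated by the finitely many functions that generate the valuation
rings, since each function or its inverse is regular at a given place. -/
theorem essFiniteType [IsAlgClosed k] (𝒮 : PlaceSystem k K ι) : Algebra.EssFiniteType k K := by
  classical
  rw [← fg_top_iff]
  obtain ⟨𝒯, h𝒯⟩ := 𝒮.generators
  refine ⟨𝒯.biUnion id, top_le_iff.mp fun f _ => ?_⟩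
  rcases isEmpty_or_nonempty ι with hι | ⟨⟨P⟩⟩
  · obtain ⟨c, rfl⟩ := 𝒮.exists_const_of_forall (f := f) fun P => isEmptyElim P
    exact IntermediateField.algebraMap_mem _ c
  obtain ⟨T, hT, -, hTP⟩ := h𝒯 P
  have key : ∀ f, 0 ≤ 𝒮.ord P f → f ∈ adjoin k ((𝒯.biUnion id : Finset K) : Set K) := by
    intro f hf
    obtain ⟨a, ha, b, hb, -, -, rfl⟩ := hTP f hf
    have hsub : Algebra.adjoin k (T : Set K) ≤
        (adjoin k ((𝒯.biUnion id : Finset K) : Set K)).toSubalgebra :=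
      Algebra.adjoin_le fun x hx => subset_adjoin k _ (by
        simp only [Finset.coe_biUnion, id, Set.mem_iUnion]
        exact ⟨T, hT, hx⟩)
    exact div_mem (hsub ha) (hsub hb)
  rcases le_total 0 (𝒮.ord P f) with hf | hf
  · exact key f hf
  · rw [← inv_inv f]
    exact inv_mem (key f⁻¹ (by rw [𝒮.ord_inv]; omega))

theorem D_mem_span {x f : K} (hf : f ∈ k⟮x⟯) :
    KaehlerDifferential.D k K f ∈ K ∙ KaehlerDifferential.D k K x := by
  induction hf using adjoin_induction with
  | mem y hy =>
    rw [Set.mem_singleton_iff.mp hy]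
    exact Submodule.mem_span_singleton_self _
  | algebraMap c => simp
  | add y z _ _ hy hz => rw [map_add]; exact add_mem hy hz
  | inv y _ hy =>
    rw [Derivation.leibniz_inv]
    exact Submodule.smul_mem _ _ hy
  | mul y z _ _ hy hz =>
    rw [Derivation.leibniz]
    exact add_mem (Submodule.smul_mem _ _ hz) (Submodule.smul_mem _ _ hy)

theorem exists_D_ne_zero (𝒮 : PlaceSystem k K ι) : ∃ x, KaehlerDifferential.D k K x ≠ 0 := by
  by_contra! h
  have h1 : (⊤ : Submodule K (Ω[K⁄k])) = ⊥ := by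
    rw [← KaehlerDifferential.span_range_derivation, Submodule.span_eq_bot]
    rintro _ ⟨x, rfl⟩
    exact h x
  have h2 := 𝒮.finrank_kaehler
  rw [← finrank_top, h1, finrank_bot] at h2
  exact zero_ne_one h2

theorem span_D_eq_top (𝒮 : PlaceSystem k K ι) {x : K} (hx : KaehlerDifferential.D k K x ≠ 0) :
    K ∙ KaehlerDifferential.D k K x = ⊤ := by
  refine top_le_iff.mp fun ω _ => ?_
  obtain ⟨c, hc⟩ := (finrank_eq_one_iff_of_nonzero' _ hx).mp 𝒮.finrank_kaehler ω
  exact hc ▸ Submodule.smul_mem _ c (Submodule.mem_span_singleton_self _)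

/-- If `dx ≠ 0`, then `K` is finite over `k(x)`. -/
theorem finiteDimensional_of_D_ne_zero [IsAlgClosed k] (𝒮 : PlaceSystem k K ι) {x : K}
    (hx : KaehlerDifferential.D k K x ≠ 0) : FiniteDimensional k⟮x⟯ K := by
  have := 𝒮.essFiniteType
  have : Algebra.EssFiniteType k⟮x⟯ K := Algebra.EssFiniteType.of_comp k k⟮x⟯ K
  have hsub : Subsingleton (Ω[K⁄k⟮x⟯]) := by
    have h1 : (⊤ : Submodule K (Ω[K⁄k⟮x⟯])) = ⊥ := by
      rw [← LinearMap.range_eq_top.mpr (KaehlerDifferential.map_surjective k k⟮x⟯ K),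
        LinearMap.range_eq_map, ← 𝒮.span_D_eq_top hx, Submodule.map_span,
        Submodule.span_eq_bot]
      rintro _ ⟨_, rfl, rfl⟩
      rw [KaehlerDifferential.map_D]
      exact (KaehlerDifferential.D k⟮x⟯ K).map_algebraMap (AdjoinSimple.gen k x)
    exact (Submodule.subsingleton_iff K).mp (subsingleton_of_bot_eq_top h1.symm)
  have : Algebra.FormallyUnramified k⟮x⟯ K := ⟨hsub⟩
  exact Algebra.FormallyUnramified.finite_of_free _ _

theorem trdeg_le_one [IsAlgClosed k] (𝒮 : PlaceSystem k K ι) : Algebra.trdeg k K ≤ 1 := by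
  obtain ⟨x, hx⟩ := 𝒮.exists_D_ne_zero
  have := 𝒮.finiteDimensional_of_D_ne_zero hx
  have h1 : Algebra.IsAlgebraic (Algebra.adjoin k {x}) K :=
    isAlgebraic_adjoin_iff_top.mp (inferInstanceAs (Algebra.IsAlgebraic k⟮x⟯ K))
  simpa using Algebra.IsAlgebraic.trdeg_le_cardinalMk k {x} (A := K)

/-- The function field is finite over `k(x)` for every nonconstant function `x`. -/
theorem finiteDimensional_adjoin [IsAlgClosed k] (𝒮 : PlaceSystem k K ι) {x : K}
    (hx : x ∉ (algebraMap k K).range) : FiniteDimensional k⟮x⟯ K := by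
  have htr : Transcendental k x := by
    intro h
    exact hx (minpoly.mem_range_of_degree_eq_one k x
      (IsAlgClosed.degree_eq_one_of_irreducible k (minpoly.irreducible h.isIntegral)))
  have hind : AlgebraicIndependent k ((↑) : ({x} : Set K) → K) :=
    (algebraicIndependent_singleton_iff ⟨x, rfl⟩).mpr htr
  have hb : IsTranscendenceBasis k ((↑) : ({x} : Set K) → K) :=
    hind.isTranscendenceBasis_of_trdeg_le_of_finite (by simpa using 𝒮.trdeg_le_one)
  have h1 := hb.isAlgebraic_field
  rw [Subtype.range_coe] at h1
  have := 𝒮.essFiniteType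
  have : Algebra.EssFiniteType k⟮x⟯ K := Algebra.EssFiniteType.of_comp k k⟮x⟯ K
  exact Algebra.finite_of_essFiniteType_of_isAlgebraic

/-- In characteristic zero the finite extension `K` of `k(x)` is separable, so every differential is
a multiple of `dx`. -/
theorem D_ne_zero [IsAlgClosed k] [CharZero k] (𝒮 : PlaceSystem k K ι) {x : K}
    (hx : x ∉ (algebraMap k K).range) : KaehlerDifferential.D k K x ≠ 0 := by
  have := 𝒮.finiteDimensional_adjoin hx
  have : CharZero k⟮x⟯ := charZero_of_injective_algebraMap (algebraMap k k⟮x⟯).injective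
  have : Algebra.FormallyUnramified k⟮x⟯ K := Algebra.FormallyUnramified.of_isSeparable _ _
  intro h0
  obtain ⟨y, hy⟩ := 𝒮.exists_D_ne_zero
  refine hy ?_
  have h1 : (KaehlerDifferential.map k k⟮x⟯ K K) (KaehlerDifferential.D k K y) = 0 :=
    Subsingleton.elim _ _
  obtain ⟨z, hz⟩ := (KaehlerDifferential.exact_mapBaseChange_map k k⟮x⟯ K _).mp h1
  rw [← hz]
  clear hz
  have h2 : ∀ f : k⟮x⟯, KaehlerDifferential.D k K f = 0 := fun f => by
    have := D_mem_span f.2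
    rwa [h0, Submodule.span_zero_singleton, Submodule.mem_bot] at this
  have h3 : KaehlerDifferential.map k k k⟮x⟯ K = 0 := by
    refine LinearMap.ext_on (KaehlerDifferential.span_range_derivation k k⟮x⟯) ?_
    rintro _ ⟨f, rfl⟩
    rw [KaehlerDifferential.map_D]
    exact h2 f
  induction z with
  | zero => simp
  | add a b ha hb => rw [map_add, ha, hb, add_zero]
  | tmul a b => rw [KaehlerDifferential.mapBaseChange_tmul, h3]; simp

/-- Every differential is a unique multiple of `dt`; applied to `df` the linear form `ℓ` is the
derivative `df/dt`. -/
theorem exists_derivation [IsAlgClosed k] [CharZero k] (𝒮 : PlaceSystem k K ι) {t : K}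
    (ht : t ∉ (algebraMap k K).range) :
    ∃ ℓ : Ω[K⁄k] →ₗ[K] K, ℓ (KaehlerDifferential.D k K t) = 1 ∧
      ∀ ω, ω = ℓ ω • KaehlerDifferential.D k K t := by
  have h := 𝒮.D_ne_zero ht
  obtain ⟨ℓ, hℓ⟩ := Module.Projective.exists_dual_eq_one K h
  refine ⟨ℓ, hℓ, fun ω => ?_⟩
  obtain ⟨c, rfl⟩ := (finrank_eq_one_iff_of_nonzero' _ h).mp 𝒮.finrank_kaehler ω
  rw [map_smul, hℓ, smul_eq_mul, mul_one]

/-! ### Places over the projective line -/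

/-- `y` is a parameter of a place of `k(x)`: at the places where `y` vanishes the order of every
function in `k(x)` is the same multiple of the order of `y`. -/
def IsParameter (𝒮 : PlaceSystem k K ι) (x : K) (y : k⟮x⟯) : Prop :=
  (y : K) ∉ (algebraMap k K).range ∧
    ∀ f : k⟮x⟯, f ≠ 0 → ∃ m : ℤ, ∀ P, 0 < 𝒮.ord P y → 𝒮.ord P f = m * 𝒮.ord P y

/-- At a place over the point `a` of the line, a polynomial in `x` has the order of its root at `a`
times the ramification index. -/
theorem ord_aeval_of_pos (𝒮 : PlaceSystem k K ι) {P : ι} {x : K} (a : k)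
    (h : 0 < 𝒮.ord P (x - algebraMap k K a)) {p : Polynomial k} (hp : p ≠ 0) :
    𝒮.ord P (Polynomial.aeval x p) =
      p.rootMultiplicity a * 𝒮.ord P (x - algebraMap k K a) := by
  have hx0 := 𝒮.ne_zero_of_ord_ne_zero h.ne'
  obtain ⟨q, hq, hqa⟩ := Polynomial.exists_eq_pow_rootMultiplicity_mul_and_not_dvd p hp a
  have hqa' : q.eval a ≠ 0 := fun h => hqa (Polynomial.dvd_iff_isRoot.mpr h)
  obtain ⟨r, hr⟩ := Polynomial.X_sub_C_dvd_sub_C_eval (p := q) (a := a)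
  have hq' : Polynomial.aeval x q = algebraMap k K (q.eval a) +
      (x - algebraMap k K a) * Polynomial.aeval x r := by
    rw [eq_add_of_sub_eq hr]
    simp [add_comm]
  have hx : x ∈ 𝒮.valRing P := by
    rw [← sub_add_cancel x (algebraMap k K a)]
    exact add_mem (mem_valRing.mpr h.le) (algebraMap_mem_valRing P a)
  have hr' : Polynomial.aeval x r ∈ 𝒮.sect P 0 := by
    rw [Polynomial.aeval_eq_sum_range]
    refine Submodule.sum_mem _ fun i _ => Submodule.smul_mem _ _ ?_
    exact (pow_mem hx i : _ ∈ 𝒮.valRing P)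
  have hcase : (x - algebraMap k K a) * Polynomial.aeval x r = 0 ∨
      𝒮.ord P (algebraMap k K (q.eval a)) < 𝒮.ord P ((x - algebraMap k K a) *
        Polynomial.aeval x r) := by
    rw [𝒮.ord_algebraMap]
    by_cases h0 : Polynomial.aeval x r = 0
    · exact Or.inl (by rw [h0, mul_zero])
    · rw [𝒮.ord_mul P hx0 h0]
      have := mem_sect_zero.mp hr'
      exact Or.inr (by omega)
  have h2 := 𝒮.ord_add_eq_left (P := P) (algebraMap_ne_zero hqa') hcase
  rw [← hq', 𝒮.ord_algebraMap] at h2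
  conv_lhs => rw [hq]
  rw [map_mul, map_pow, map_sub, Polynomial.aeval_X, Polynomial.aeval_C,
    𝒮.ord_mul P (pow_ne_zero _ hx0) h2.1, h2.2, 𝒮.ord_pow, add_zero]

/-- At a place over infinity, the order of a polynomial in `x` is given by its degree. -/
theorem ord_aeval_of_neg (𝒮 : PlaceSystem k K ι) {P : ι} {x : K} (h : 𝒮.ord P x < 0)
    {p : Polynomial k} (hp : p ≠ 0) :
    Polynomial.aeval x p ≠ 0 ∧ 𝒮.ord P (Polynomial.aeval x p) = p.natDegree * 𝒮.ord P x := by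
  have hx0 := 𝒮.ne_zero_of_ord_ne_zero h.ne
  induction hn : p.natDegree using Nat.strong_induction_on generalizing p with
  | _ n ih =>
    have hl : p.leadingCoeff • x ^ n ≠ 0 :=
      smul_ne_zero (by simpa using hp) (pow_ne_zero n hx0)
    have hol : 𝒮.ord P (p.leadingCoeff • x ^ n) = n * 𝒮.ord P x := by
      rw [Algebra.smul_def, 𝒮.ord_mul P (algebraMap_ne_zero (by simpa using hp))
        (pow_ne_zero n hx0), 𝒮.ord_algebraMap, 𝒮.ord_pow, zero_add]
    have hsum : Polynomial.aeval x p = p.leadingCoeff • x ^ n + Polynomial.aeval x p.eraseLead := by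
      conv_lhs => rw [← p.eraseLead_add_C_mul_X_pow]
      rw [map_add, map_mul, map_pow, Polynomial.aeval_C, Polynomial.aeval_X, hn, add_comm,
        Algebra.smul_def]
    rw [hsum, ← hol]
    refine 𝒮.ord_add_eq_left hl ?_
    by_cases h0 : p.eraseLead = 0
    · exact Or.inl (by rw [h0, map_zero])
    have hlt : p.eraseLead.natDegree < n := by
      rcases p.eraseLead_natDegree_lt_or_eraseLead_eq_zero with h1 | h1
      · omega
      · exact absurd h1 h0
    refine Or.inr ?_
    rw [hol, (ih _ hlt h0 rfl).2]
    exact mul_lt_mul_of_neg_right (by exact_mod_cast hlt) h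

theorem isParameter_sub (𝒮 : PlaceSystem k K ι) {x : K} (hx : x ∉ (algebraMap k K).range) (a : k) :
    𝒮.IsParameter x (AdjoinSimple.gen k x - algebraMap k k⟮x⟯ a) := by
  refine ⟨?_, ?_⟩
  · rintro ⟨c, hc⟩
    exact hx ⟨c + a, by rw [map_add, hc]; simp⟩
  rintro ⟨f, hf⟩ hf0
  obtain ⟨p, q, rfl⟩ := mem_adjoin_simple_iff k f |>.mp hf
  have hf0' : Polynomial.aeval x p / Polynomial.aeval x q ≠ 0 := fun h => hf0 (Subtype.ext h)
  have hp : Polynomial.aeval x p ≠ 0 := fun h => hf0' (by rw [h, zero_div])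
  have hq : Polynomial.aeval x q ≠ 0 := fun h => hf0' (by rw [h, div_zero])
  refine ⟨p.rootMultiplicity a - q.rootMultiplicity a, fun P hP => ?_⟩
  change 𝒮.ord P (_ / _) = _ * 𝒮.ord P (x - algebraMap k K a)
  replace hP : 0 < 𝒮.ord P (x - algebraMap k K a) := hP
  rw [𝒮.ord_div P hp hq, 𝒮.ord_aeval_of_pos a hP (p := p) (by rintro rfl; simp at hp),
    𝒮.ord_aeval_of_pos a hP (p := q) (by rintro rfl; simp at hq)]
  ring

theorem isParameter_inv (𝒮 : PlaceSystem k K ι) {x : K} (hx : x ∉ (algebraMap k K).range) :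
    𝒮.IsParameter x (AdjoinSimple.gen k x)⁻¹ := by
  refine ⟨?_, ?_⟩
  · rintro ⟨c, hc⟩
    exact hx ⟨c⁻¹, by rw [map_inv₀, hc]; simp⟩
  rintro ⟨f, hf⟩ hf0
  obtain ⟨p, q, rfl⟩ := mem_adjoin_simple_iff k f |>.mp hf
  have hf0' : Polynomial.aeval x p / Polynomial.aeval x q ≠ 0 := fun h => hf0 (Subtype.ext h)
  have hp : Polynomial.aeval x p ≠ 0 := fun h => hf0' (by rw [h, zero_div])
  have hq : Polynomial.aeval x q ≠ 0 := fun h => hf0' (by rw [h, div_zero])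
  refine ⟨q.natDegree - p.natDegree, fun P hP => ?_⟩
  change 𝒮.ord P (_ / _) = _ * 𝒮.ord P x⁻¹
  replace hP : 0 < 𝒮.ord P x⁻¹ := hP
  rw [𝒮.ord_inv] at hP ⊢
  rw [𝒮.ord_div P hp hq, (𝒮.ord_aeval_of_neg (by omega) (p := p) (by rintro rfl; simp at hp)).2,
    (𝒮.ord_aeval_of_neg (by omega) (p := q) (by rintro rfl; simp at hq)).2]
  ring

namespace IsParameter

variable {𝒮 : PlaceSystem k K ι} {x : K} {y : k⟮x⟯}

theorem isUniformizerBelow (hy : 𝒮.IsParameter x y) {P : ι} (hP : 0 < 𝒮.ord P y) :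
    𝒮.IsUniformizerBelow P y :=
  ⟨hP, fun f hf => by
    obtain ⟨m, hm⟩ := hy.2 f hf
    exact ⟨m, by rw [mul_comm]; exact hm P hP⟩⟩

theorem below_le (hy : 𝒮.IsParameter x y) {P Q : ι} (hP : 0 < 𝒮.ord P y) (hQ : 0 < 𝒮.ord Q y) :
    𝒮.below k⟮x⟯ P ≤ 𝒮.below k⟮x⟯ Q := by
  intro f hf
  by_cases hf0 : f = 0
  · rw [hf0]; exact zero_mem _
  obtain ⟨m, hm⟩ := hy.2 f hf0
  rw [mem_below] at hf ⊢
  change 0 ≤ 𝒮.ord P f at hf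
  change 0 ≤ 𝒮.ord Q f
  rw [hm P hP] at hf
  rw [hm Q hQ]
  exact mul_nonneg (nonneg_of_mul_nonneg_left hf hP) hQ.le

theorem below_le_iff [FiniteDimensional k⟮x⟯ K] (hy : 𝒮.IsParameter x y) {P Q : ι}
    (hP : 0 < 𝒮.ord P y) : 𝒮.below k⟮x⟯ P ≤ 𝒮.below k⟮x⟯ Q ↔ 0 < 𝒮.ord Q y :=
  ⟨fun h => (hy.isUniformizerBelow hP).pos_of_le h, fun h => hy.below_le hP h⟩

/-- A parameter has a zero, as otherwise its inverse would have no poles. -/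
theorem exists_pos [IsAlgClosed k] (hy : 𝒮.IsParameter x y) : ∃ P, 0 < 𝒮.ord P y := by
  by_contra! h
  obtain ⟨c, hc⟩ := 𝒮.exists_const_of_forall (f := (y : K)⁻¹) fun P => by
    rw [𝒮.ord_inv]
    have := h P
    omega
  exact hy.1 ⟨c⁻¹, by rw [map_inv₀, hc, inv_inv]⟩

/-- The zeros of a parameter, counted with multiplicity, are as many as the degree. -/
theorem sum_ord [IsAlgClosed k] [CharZero k] (hy : 𝒮.IsParameter x y) [FiniteDimensional k⟮x⟯ K]
    (S : Finset ι) (hS : ∀ P, P ∈ S ↔ 0 < 𝒮.ord P y) :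
    ∑ P ∈ S, 𝒮.ord P y = Module.finrank k⟮x⟯ K := by
  obtain ⟨P, hP⟩ := hy.exists_pos
  rw [← (hy.isUniformizerBelow hP).sum_ord_fibre (k := k)]
  refine Finset.sum_congr ?_ fun _ _ => rfl
  ext Q
  rw [hS, Set.Finite.mem_toFinset, Set.mem_ofPred_eq, hy.below_le_iff hP]

end IsParameter

/-- The divisor of a nonzero function has degree zero. -/
theorem sum_ord_eq_zero [IsAlgClosed k] [CharZero k] (𝒮 : PlaceSystem k K ι) {x : K} (hx : x ≠ 0) :
    ∑ P ∈ (𝒮.finite_support hx).toFinset, 𝒮.ord P x = 0 := by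
  classical
  by_cases hc : x ∈ (algebraMap k K).range
  · obtain ⟨c, rfl⟩ := hc
    exact Finset.sum_eq_zero fun P _ => 𝒮.ord_algebraMap P c
  have := 𝒮.finiteDimensional_adjoin hc
  set S := (𝒮.finite_support hx).toFinset with hS
  have hmem : ∀ P, P ∈ S ↔ 𝒮.ord P x ≠ 0 := fun P => by simp [hS]
  have h1 := (𝒮.isParameter_sub hc 0).sum_ord (S.filter fun P => 0 < 𝒮.ord P x) (fun P => by
    rw [Finset.mem_filter, hmem]
    simp only [map_zero, sub_zero, AdjoinSimple.coe_gen]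
    omega)
  have h2 := (𝒮.isParameter_inv hc).sum_ord (S.filter fun P => ¬ 0 < 𝒮.ord P x) (fun P => by
    rw [Finset.mem_filter, hmem]
    simp only [IntermediateField.coe_inv, AdjoinSimple.coe_gen, 𝒮.ord_inv]
    omega)
  simp only [map_zero, sub_zero, AdjoinSimple.coe_gen] at h1
  simp only [IntermediateField.coe_inv, AdjoinSimple.coe_gen, 𝒮.ord_inv,
    Finset.sum_neg_distrib] at h2
  rw [← Finset.sum_filter_add_sum_filter_not S fun P => 0 < 𝒮.ord P x]
  omega

end Finite
end PlaceSystem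

namespace PlaceSystem

variable {k K ι : Type*} [Field k] [Field K] [Algebra k K]

/-! ### Orders of differentials -/

section Derivation

/-- A derivation with bounded poles on generators has the same bound on the localization of the
algebra that they generate, by the quotient rule. -/
theorem derivation_mem_sect (𝒮 : PlaceSystem k K ι) (δ : Derivation k K K) {P : ι} {T : Finset K}
    {N : ℕ} (hT : ∀ a ∈ T, 0 ≤ 𝒮.ord P a) (hδ : ∀ a ∈ T, δ a ∈ 𝒮.sect P N) {f : K}
    (hf : ∃ a ∈ Algebra.adjoin k (T : Set K), ∃ b ∈ Algebra.adjoin k (T : Set K),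
      b ≠ 0 ∧ 𝒮.ord P b = 0 ∧ f = a / b) : δ f ∈ 𝒮.sect P N := by
  have key : ∀ a ∈ Algebra.adjoin k (T : Set K), a ∈ 𝒮.sect P 0 ∧ δ a ∈ 𝒮.sect P N := by
    intro a ha
    induction ha using Algebra.adjoin_induction with
    | mem a ha => exact ⟨mem_sect_zero.mpr (hT a ha), hδ a ha⟩
    | algebraMap c => exact ⟨algebraMap_mem_sect P c, by simp⟩
    | add a b _ _ ha hb => exact ⟨add_mem ha.1 hb.1, by rw [map_add]; exact add_mem ha.2 hb.2⟩
    | mul a b _ _ ha hb =>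
      refine ⟨mul_mem_sect ha.1 hb.1 (by simp), ?_⟩
      rw [Derivation.leibniz]
      exact add_mem (mul_mem_sect ha.1 hb.2 (by simp)) (mul_mem_sect hb.1 ha.2 (by simp))
  obtain ⟨a, ha, b, hb, hb0, hPb, rfl⟩ := hf
  obtain ⟨ha1, ha2⟩ := key a ha
  obtain ⟨hb1, hb2⟩ := key b hb
  rw [Derivation.leibniz_div]
  have hbi : b⁻¹ ∈ 𝒮.sect P 0 := self_mem_sect P _ (by rw [𝒮.ord_inv, hPb]; rfl)
  have hbi2 : b⁻¹ ^ 2 ∈ 𝒮.sect P 0 := by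
    rw [pow_two]
    exact mul_mem_sect hbi hbi (by simp)
  exact mul_mem_sect hbi2 (sub_mem (mul_mem_sect hb1 ha2 (zero_add _).le)
    (mul_mem_sect ha1 hb2 (zero_add _).le)) (by simp)

/-- A derivation of the function field has a pole of bounded order on each valuation ring. -/
theorem exists_derivation_bound (𝒮 : PlaceSystem k K ι) (δ : Derivation k K K) (P : ι) :
    ∃ N : ℕ, ∀ f ∈ 𝒮.sect P 0, δ f ∈ 𝒮.sect P N := by
  obtain ⟨𝒯, h𝒯⟩ := 𝒮.generators
  obtain ⟨T, -, hT, hTP⟩ := h𝒯 P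
  refine ⟨∑ a ∈ T, (𝒮.ord P (δ a)).natAbs, fun f hf => ?_⟩
  refine 𝒮.derivation_mem_sect δ hT (fun a ha => self_mem_sect P _ ?_)
    (hTP f (mem_sect_zero.mp hf))
  have := Finset.single_le_sum (f := fun a => (𝒮.ord P (δ a)).natAbs) (fun _ _ => Nat.zero_le _) ha
  omega

/-- A derivation of the function field preserves almost all valuation rings. -/
theorem exists_finset_derivation (𝒮 : PlaceSystem k K ι) (δ : Derivation k K K) :
    ∃ S : Finset ι, ∀ P ∉ S, ∀ f ∈ 𝒮.sect P 0, δ f ∈ 𝒮.sect P 0 := by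
  classical
  obtain ⟨𝒯, h𝒯⟩ := 𝒮.generators
  have hfin : {P | ∃ T ∈ 𝒯, ∃ a ∈ T, 𝒮.ord P (δ a) ≠ 0}.Finite := by
    have : {P | ∃ T ∈ 𝒯, ∃ a ∈ T, 𝒮.ord P (δ a) ≠ 0} =
        ⋃ T ∈ 𝒯, ⋃ a ∈ T, {P | 𝒮.ord P (δ a) ≠ 0} := by
      ext P
      simp
    rw [this]
    refine 𝒯.finite_toSet.biUnion fun T _ => T.finite_toSet.biUnion fun a _ => ?_
    by_cases h0 : δ a = 0
    · simp [h0, 𝒮.ord_zero]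
    · exact 𝒮.finite_support h0
  refine ⟨hfin.toFinset, fun P hP f hf => ?_⟩
  simp only [Set.Finite.mem_toFinset, Set.mem_ofPred_eq, not_exists, not_and, not_not] at hP
  obtain ⟨T, hT𝒯, hT, hTP⟩ := h𝒯 P
  exact 𝒮.derivation_mem_sect δ (N := 0) hT (fun a ha => mem_sect_zero.mpr (hP T hT𝒯 a ha).ge)
    (hTP f (mem_sect_zero.mp hf))

/-- The derivative of a regular function by a local parameter is regular: expanding
`f = c + t f'` lowers any bound for the poles of derivatives by one. -/
theorem derivation_mem_sect_zero (𝒮 : PlaceSystem k K ι) (δ : Derivation k K K) {P : ι} {t : K}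
    (ht : 𝒮.ord P t = 1) (hδt : δ t ∈ 𝒮.sect P 0) {f : K} (hf : f ∈ 𝒮.sect P 0) :
    δ f ∈ 𝒮.sect P 0 := by
  obtain ⟨N, hN⟩ := 𝒮.exists_derivation_bound δ P
  have ht0 : t ≠ 0 := 𝒮.ne_zero_of_ord_ne_zero (P := P) (by omega)
  induction N generalizing f with
  | zero => exact hN f hf
  | succ N ih =>
    refine ih hf fun f hf => ?_
    obtain ⟨c, hc⟩ := 𝒮.exists_residue P (mem_sect_zero.mp hf)
    have h1 : (f - algebraMap k K c) / t ∈ 𝒮.sect P 0 := by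
      rw [div_eq_mul_inv]
      refine mul_mem_sect (m := -1) (n := 1) ?_ (self_mem_sect P _ ?_) (by simp)
      · exact hc.imp id fun h => by omega
      · rw [𝒮.ord_inv]; omega
    have h2 : f = algebraMap k K c + t * ((f - algebraMap k K c) / t) := by
      rw [mul_div_cancel₀ _ ht0]; ring
    rw [h2, map_add, Derivation.map_algebraMap, zero_add, Derivation.leibniz]
    refine add_mem (mul_mem_sect (self_mem_sect P t le_rfl) (hN _ h1) ?_)
      (mul_mem_sect h1 hδt (by simp))
    push_cast
    omega

theorem notMem_range_of_ord (𝒮 : PlaceSystem k K ι) {P : ι} {t : K} (ht : 𝒮.ord P t ≠ 0) :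
    t ∉ (algebraMap k K).range := by
  rintro ⟨c, rfl⟩
  exact ht (𝒮.ord_algebraMap P c)

variable [IsAlgClosed k] [CharZero k] (𝒮 : PlaceSystem k K ι)

/-- The differentials of two local parameters differ by a unit. -/
theorem exists_D_eq_smul {P : ι} {t t' : K} (ht : 𝒮.ord P t = 1) (ht' : 𝒮.ord P t' = 1) :
    ∃ v : K, v ≠ 0 ∧ 𝒮.ord P v = 0 ∧
      KaehlerDifferential.D k K t' = v • KaehlerDifferential.D k K t := by
  have aux : ∀ {t t' : K}, 𝒮.ord P t = 1 → 𝒮.ord P t' = 1 → ∃ v ∈ 𝒮.sect P 0,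
      KaehlerDifferential.D k K t' = v • KaehlerDifferential.D k K t := by
    intro t t' ht ht'
    have htc := 𝒮.notMem_range_of_ord (P := P) (t := t) (by omega)
    obtain ⟨ℓ, hℓt, hℓ⟩ := 𝒮.exists_derivation htc
    refine ⟨ℓ (KaehlerDifferential.D k K t'), ?_, hℓ _⟩
    refine 𝒮.derivation_mem_sect_zero (ℓ.compDer (KaehlerDifferential.D k K)) ht ?_
      (mem_sect_zero.mpr (by omega))
    change ℓ (KaehlerDifferential.D k K t) ∈ _
    rw [hℓt, mem_sect_zero, 𝒮.ord_one]
  obtain ⟨v, hv, hv'⟩ := aux ht ht'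
  obtain ⟨w, hw, hw'⟩ := aux ht' ht
  have hD := 𝒮.D_ne_zero (𝒮.notMem_range_of_ord (P := P) (t := t) (by omega))
  have hvw : w * v = 1 := by
    by_contra h
    have h3 : (w * v - 1) • KaehlerDifferential.D k K t = 0 := by
      rw [sub_smul, one_smul, mul_smul, ← hv', ← hw', sub_self]
    rcases smul_eq_zero.mp h3 with h4 | h4
    exacts [h (sub_eq_zero.mp h4), hD h4]
  have hv0 := right_ne_zero_of_mul_eq_one hvw
  refine ⟨v, hv0, ?_, hv'⟩
  have h1 := 𝒮.ord_mul P (left_ne_zero_of_mul_eq_one hvw) hv0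
  rw [hvw, 𝒮.ord_one] at h1
  rw [mem_sect_zero] at hv hw
  omega

variable {𝒮} in
theorem ord_eq_of_smul_D_eq {P : ι} {t t' g g' : K} (ht : 𝒮.ord P t = 1) (ht' : 𝒮.ord P t' = 1)
    (hg : g' ≠ 0)
    (h : g • KaehlerDifferential.D k K t = g' • KaehlerDifferential.D k K t') :
    𝒮.ord P g = 𝒮.ord P g' := by
  obtain ⟨v, hv0, hv, hD⟩ := 𝒮.exists_D_eq_smul ht ht'
  have hDt := 𝒮.D_ne_zero (𝒮.notMem_range_of_ord (P := P) (t := t) (by omega))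
  have : g = g' * v := by
    rw [hD, smul_smul] at h
    exact smul_left_injective K hDt h
  rw [this, 𝒮.ord_mul P hg hv0, hv, add_zero]

/-- In characteristic zero the differential of a function of order `e ≠ 0` has order `e - 1`. -/
theorem exists_D_eq_smul_of_ord_ne_zero {P : ι} {x t : K} (ht : 𝒮.ord P t = 1)
    (hx : 𝒮.ord P x ≠ 0) : ∃ g : K, g ≠ 0 ∧ 𝒮.ord P g = 𝒮.ord P x - 1 ∧
      KaehlerDifferential.D k K x = g • KaehlerDifferential.D k K t := by
  have hx0 := 𝒮.ne_zero_of_ord_ne_zero hx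
  have ht0 : t ≠ 0 := 𝒮.ne_zero_of_ord_ne_zero (P := P) (by omega)
  have htc := 𝒮.notMem_range_of_ord (P := P) (t := t) (by omega)
  have hDt := 𝒮.D_ne_zero htc
  obtain ⟨ℓ, hℓt, hℓ⟩ := 𝒮.exists_derivation htc
  set e := 𝒮.ord P x with he
  set v := x / t ^ e with hv
  have hte : t ^ e ≠ 0 := zpow_ne_zero e ht0
  have hv0 : v ≠ 0 := div_ne_zero hx0 hte
  have hvo : 𝒮.ord P v = 0 := by
    rw [hv, 𝒮.ord_div P hx0 hte, 𝒮.ord_zpow, ht]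
    omega
  have hxe : x = t ^ e * v := by rw [hv, mul_div_cancel₀ _ hte]
  set w := ℓ (KaehlerDifferential.D k K v) with hw
  have hwm : w ∈ 𝒮.sect P 0 := by
    refine 𝒮.derivation_mem_sect_zero (ℓ.compDer (KaehlerDifferential.D k K)) ht ?_
      (mem_sect_zero.mpr hvo.ge)
    change ℓ (KaehlerDifferential.D k K t) ∈ _
    rw [hℓt, mem_sect_zero, 𝒮.ord_one]
  have hek : algebraMap k K (e : k) ≠ 0 := algebraMap_ne_zero (by exact_mod_cast hx)
  have hs := 𝒮.ord_add_eq_left (P := P) (f := algebraMap k K (e : k) * v) (g := t * w)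
    (mul_ne_zero hek hv0) (by
      rw [𝒮.ord_mul P hek hv0, 𝒮.ord_algebraMap, hvo]
      by_cases hw0 : w = 0
      · exact Or.inl (by rw [hw0, mul_zero])
      · rw [𝒮.ord_mul P ht0 hw0, ht]
        have := mem_sect_zero.mp hwm
        exact Or.inr (by omega))
  refine ⟨t ^ (e - 1) * (algebraMap k K (e : k) * v + t * w),
    mul_ne_zero (zpow_ne_zero _ ht0) hs.1, ?_, ?_⟩
  · rw [𝒮.ord_mul P (zpow_ne_zero _ ht0) hs.1, hs.2, 𝒮.ord_mul P hek hv0, 𝒮.ord_algebraMap, hvo,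
      𝒮.ord_zpow, ht]
    ring
  · conv_lhs => rw [hxe, Derivation.leibniz, Derivation.leibniz_zpow, hℓ (KaehlerDifferential.D k K v)]
    rw [← hw, smul_smul, ← Int.cast_smul_eq_zsmul K, smul_smul, smul_smul, ← add_smul]
    congr 1
    rw [map_intCast, zpow_sub_one₀ ht0]
    field_simp
    ring

/-! ### Canonical divisors -/

/-- `W` is the divisor of a nonzero differential. -/
def IsCanonical (W : ι →₀ ℤ) : Prop :=
  ∃ ω : Ω[K⁄k], ω ≠ 0 ∧ ∀ P, ∃ t g : K, 𝒮.ord P t = 1 ∧ g ≠ 0 ∧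
    ω = g • KaehlerDifferential.D k K t ∧ 𝒮.ord P g = W P

/-- The differential `dx` of a nonconstant function has a divisor: at all but finitely many places
`d/dx` and `d/dt` both preserve the valuation ring, so that `dx/dt` is a unit there. -/
theorem exists_isCanonical : ∃ W, 𝒮.IsCanonical W := by
  classical
  obtain ⟨x, hDx⟩ := 𝒮.exists_D_ne_zero
  have hx : x ∉ (algebraMap k K).range := by
    rintro ⟨c, rfl⟩
    simp at hDx
  have hx0 : x ≠ 0 := by
    rintro rfl
    simp at hDx
  obtain ⟨ℓ, -, hℓ⟩ := 𝒮.exists_derivation hx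
  choose t ht using 𝒮.exists_uniformizer
  have htc : ∀ P, t P ∉ (algebraMap k K).range := fun P =>
    𝒮.notMem_range_of_ord (P := P) (by rw [ht]; simp)
  choose m hmt hm using fun P => 𝒮.exists_derivation (htc P)
  have hg0 : ∀ P, m P (KaehlerDifferential.D k K x) ≠ 0 := fun P h => by
    have := hm P (KaehlerDifferential.D k K x)
    rw [h, zero_smul] at this
    exact hDx this
  obtain ⟨S, hS⟩ := 𝒮.exists_finset_derivation (ℓ.compDer (KaehlerDifferential.D k K))
  have hfin : (Function.support fun P => 𝒮.ord P (m P (KaehlerDifferential.D k K x))).Finite := by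
    refine ((𝒮.finite_support hx0).union S.finite_toSet).subset fun P hP => ?_
    by_contra h
    simp only [Set.mem_union, Set.mem_ofPred_eq, not_or, not_not, Finset.mem_coe] at h
    refine hP ?_
    -- `d/dx` and `d/dt` both preserve the valuation ring
    set g := m P (KaehlerDifferential.D k K x) with hg
    set w := ℓ (KaehlerDifferential.D k K (t P)) with hw
    have h1 : w ∈ 𝒮.sect P 0 := hS P h.2 (t P) (mem_sect_zero.mpr (by rw [ht]; simp))
    have h2 : w * g = 1 := by
      by_contra hne
      have h3 : (w * g - 1) • KaehlerDifferential.D k K (t P) = 0 := by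
        rw [sub_smul, one_smul, mul_smul, ← hm, ← hℓ, sub_self]
      rcases smul_eq_zero.mp h3 with h4 | h4
      exacts [hne (sub_eq_zero.mp h4), 𝒮.D_ne_zero (htc P) h4]
    have h3 : g ∈ 𝒮.sect P 0 := by
      refine 𝒮.derivation_mem_sect_zero ((m P).compDer (KaehlerDifferential.D k K)) (ht P) ?_
        (mem_sect_zero.mpr h.1.ge)
      change m P (KaehlerDifferential.D k K (t P)) ∈ _
      rw [hmt, mem_sect_zero, 𝒮.ord_one]
    have h4 := 𝒮.ord_mul P (left_ne_zero_of_mul_eq_one h2) (right_ne_zero_of_mul_eq_one h2)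
    rw [h2, 𝒮.ord_one] at h4
    rw [mem_sect_zero] at h1 h3
    change 𝒮.ord P g = 0
    omega
  exact ⟨Finsupp.ofSupportFinite _ hfin, KaehlerDifferential.D k K x, hDx, fun P =>
    ⟨t P, m P (KaehlerDifferential.D k K x), ht P, hg0 P, hm P _, rfl⟩⟩

variable {𝒮}

namespace IsCanonical

/-- Canonical divisors are linearly equivalent, the differentials having rank one. -/
theorem exists_ord_eq_sub {W W' : ι →₀ ℤ} (hW : 𝒮.IsCanonical W) (hW' : 𝒮.IsCanonical W') :
    ∃ f : K, f ≠ 0 ∧ ∀ P, W P - W' P = 𝒮.ord P f := by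
  obtain ⟨ω, hω, h⟩ := hW
  obtain ⟨ω', hω', h'⟩ := hW'
  obtain ⟨f, rfl⟩ := (finrank_eq_one_iff_of_nonzero' _ hω').mp 𝒮.finrank_kaehler ω
  have hf0 : f ≠ 0 := by
    rintro rfl
    simp at hω
  refine ⟨f, hf0, fun P => ?_⟩
  obtain ⟨t, g, ht, hg0, hg, hgW⟩ := h P
  obtain ⟨t', g', ht', hg'0, hg', hgW'⟩ := h' P
  have h1 : g • KaehlerDifferential.D k K t = (f * g') • KaehlerDifferential.D k K t' := by
    rw [← hg, hg', smul_smul]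
  have h2 := ord_eq_of_smul_D_eq ht ht' (mul_ne_zero hf0 hg'0) h1
  rw [𝒮.ord_mul P hf0 hg'0] at h2
  omega

omit [IsAlgClosed k] [CharZero k] in
/-- A divisor linearly equivalent to a canonical one is canonical. -/
theorem of_ord_eq_sub {W W' : ι →₀ ℤ} (hW : 𝒮.IsCanonical W) {f : K} (hf : f ≠ 0)
    (h : ∀ P, W' P - W P = 𝒮.ord P f) : 𝒮.IsCanonical W' := by
  obtain ⟨ω, hω, hP⟩ := hW
  refine ⟨f • ω, smul_ne_zero hf hω, fun P => ?_⟩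
  obtain ⟨t, g, ht, hg0, hg, hgW⟩ := hP P
  refine ⟨t, f * g, ht, mul_ne_zero hf hg0, by rw [hg, smul_smul], ?_⟩
  rw [𝒮.ord_mul P hf hg0, ← h P]
  omega

/-- The orders of a differential are determined by its quotient by `dx`. -/
theorem exists_eq_ord_add {W : ι →₀ ℤ} (hW : 𝒮.IsCanonical W) {x : K}
    (hx : x ∉ (algebraMap k K).range) : ∃ h : K, h ≠ 0 ∧ ∀ P (a : k),
      𝒮.ord P (x - algebraMap k K a) ≠ 0 →
        W P = 𝒮.ord P h + 𝒮.ord P (x - algebraMap k K a) - 1 := by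
  obtain ⟨ω, hω, hP⟩ := hW
  have hDx := 𝒮.D_ne_zero hx
  obtain ⟨h, rfl⟩ := (finrank_eq_one_iff_of_nonzero' _ hDx).mp 𝒮.finrank_kaehler ω
  have hh0 : h ≠ 0 := by
    rintro rfl
    simp at hω
  refine ⟨h, hh0, fun P a ha => ?_⟩
  obtain ⟨t, g, ht, hg0, hg, hgW⟩ := hP P
  obtain ⟨g', hg'0, hg'o, hg'⟩ := 𝒮.exists_D_eq_smul_of_ord_ne_zero ht ha
  rw [map_sub, Derivation.map_algebraMap, sub_zero] at hg'
  have h1 : g • KaehlerDifferential.D k K t = (h * g') • KaehlerDifferential.D k K t := by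
    rw [← hg, hg', smul_smul]
  have h2 := ord_eq_of_smul_D_eq ht ht (mul_ne_zero hh0 hg'0) h1
  rw [𝒮.ord_mul P hh0 hg'0, hg'o] at h2
  omega

end IsCanonical

end Derivation
end PlaceSystem

namespace PlaceSystem

open IntermediateField

variable {k K ι : Type*} [Field k] [Field K] [Algebra k K] [IsAlgClosed k] [CharZero k]

/-! ### The residue at infinity on the projective line -/

section Residue

variable (𝒮 : PlaceSystem k K ι) {x : K} {P₁ : ι}

local notation "gen" => AdjoinSimple.gen k x

omit [IsAlgClosed k] [CharZero k]

theorem coe_aeval_gen (p : Polynomial k) :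
    ((Polynomial.aeval gen p : k⟮x⟯) : K) = Polynomial.aeval x p := by
  simp

/-- Functions of `k(x)` that vanish to order at least `m` at the place `x = ∞`, which lies below
`P₁`. -/
def vanishing (x : K) (P₁ : ι) (m : ℤ) : Submodule k k⟮x⟯ :=
  (𝒮.sect P₁ (m * 𝒮.ord P₁ x)).comap k⟮x⟯.val.toLinearMap

variable {𝒮}

theorem mem_vanishing {m : ℤ} {f : k⟮x⟯} :
    f ∈ 𝒮.vanishing x P₁ m ↔ (f : K) ∈ 𝒮.sect P₁ (m * 𝒮.ord P₁ x) := Iff.rfl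

theorem vanishing_anti (hx : 𝒮.ord P₁ x < 0) {m n : ℤ} (h : m ≤ n) :
    𝒮.vanishing x P₁ n ≤ 𝒮.vanishing x P₁ m :=
  fun _ hf => sect_mono P₁ (mul_le_mul_of_nonpos_right h hx.le) hf

theorem mul_mem_vanishing {m n : ℤ} {f g : k⟮x⟯} (hf : f ∈ 𝒮.vanishing x P₁ m)
    (hg : g ∈ 𝒮.vanishing x P₁ n) : f * g ∈ 𝒮.vanishing x P₁ (m + n) :=
  mul_mem_sect hf hg (by rw [add_mul])

theorem zpow_gen_mem_vanishing (n : ℤ) : gen ^ n ∈ 𝒮.vanishing x P₁ (-n) := by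
  rw [mem_vanishing]
  refine self_mem_sect P₁ _ ?_
  have h : ((gen ^ n : k⟮x⟯) : K) = x ^ n := map_zpow₀ k⟮x⟯.val gen n
  rw [h, 𝒮.ord_zpow]
  linarith

theorem notMem_range_of_ord_neg (hx : 𝒮.ord P₁ x < 0) : x ∉ (algebraMap k K).range :=
  𝒮.notMem_range_of_ord hx.ne

theorem gen_ne_zero (hx : 𝒮.ord P₁ x < 0) : gen ≠ 0 := fun h => by
  have : x = 0 := congrArg Subtype.val h
  simp [this, 𝒮.ord_zero] at hx

/-- Every function of `k(x)` is the sum of a polynomial and a function vanishing at infinity. -/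
theorem exists_polynomial_add (hx : 𝒮.ord P₁ x < 0) (f : k⟮x⟯) :
    ∃ p : Polynomial k, ∃ s ∈ 𝒮.vanishing x P₁ 1, f = Polynomial.aeval gen p + s := by
  obtain ⟨p, q, hf⟩ := mem_adjoin_simple_iff k (f : K) |>.mp f.2
  by_cases hq : q = 0
  · refine ⟨0, 0, zero_mem _, Subtype.ext ?_⟩
    simp [hf, hq]
  have hq' := (𝒮.ord_aeval_of_neg hx hq).1
  refine ⟨p / q, f - Polynomial.aeval gen (p / q), ?_, by ring⟩
  have h1 : Polynomial.aeval x p = Polynomial.aeval x q * Polynomial.aeval x (p / q) +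
      Polynomial.aeval x (p % q) := by
    rw [← map_mul, ← map_add, EuclideanDomain.div_add_mod]
  have h2 : ((f - Polynomial.aeval gen (p / q) : k⟮x⟯) : K) =
      Polynomial.aeval x (p % q) / Polynomial.aeval x q := by
    rw [AddSubgroupClass.coe_sub, coe_aeval_gen, hf, h1]
    field_simp
    ring
  rw [mem_vanishing, h2]
  by_cases hr : p % q = 0
  · rw [hr, map_zero, zero_div]; exact zero_mem _
  have hr' := 𝒮.ord_aeval_of_neg hx hr
  refine self_mem_sect P₁ _ ?_
  rw [𝒮.ord_div P₁ hr'.1 hq', hr'.2, (𝒮.ord_aeval_of_neg hx hq).2]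
  have hdeg : (p % q).natDegree < q.natDegree :=
    Polynomial.natDegree_lt_natDegree hr (EuclideanDomain.mod_lt p hq)
  have : (((p % q).natDegree : ℤ) + 1) ≤ q.natDegree := by exact_mod_cast hdeg
  nlinarith

/-- The leading coefficient at infinity. -/
theorem exists_smul_zpow_add (hx : 𝒮.ord P₁ x < 0) {m : ℤ} {s : k⟮x⟯}
    (hs : s ∈ 𝒮.vanishing x P₁ m) :
    ∃ c : k, ∃ s' ∈ 𝒮.vanishing x P₁ (m + 1), s = c • gen ^ (-m) + s' := by
  have hg := gen_ne_zero (𝒮 := 𝒮) hx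
  have hπ := (𝒮.isParameter_inv (notMem_range_of_ord_neg (𝒮 := 𝒮) hx)).isUniformizerBelow (P := P₁)
    (by simp only [IntermediateField.coe_inv, AdjoinSimple.coe_gen, 𝒮.ord_inv]; omega)
  have h1 : s * gen ^ m ∈ 𝒮.below k⟮x⟯ P₁ := by
    have := mul_mem_vanishing hs (zpow_gen_mem_vanishing (𝒮 := 𝒮) (P₁ := P₁) (x := x) m)
    rw [mem_vanishing, add_neg_cancel, zero_mul] at this
    exact this
  obtain ⟨c, s', hs', h2⟩ := hπ.exists_residue (k := k) h1
  refine ⟨c, gen⁻¹ * s' * gen ^ (-m), ?_, ?_⟩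
  · have h3 : s' ∈ 𝒮.vanishing x P₁ 0 := by
      rw [mem_vanishing, zero_mul]
      exact hs'
    have h4 := mul_mem_vanishing (mul_mem_vanishing (zpow_gen_mem_vanishing (𝒮 := 𝒮) (P₁ := P₁)
      (x := x) (-1)) h3) (zpow_gen_mem_vanishing (𝒮 := 𝒮) (P₁ := P₁) (x := x) (-m))
    rw [zpow_neg_one] at h4
    convert h4 using 2
    ring
  · rw [Algebra.smul_def, ← add_mul, ← h2, mul_assoc, ← zpow_add₀ hg, add_neg_cancel, zpow_zero,
      mul_one]

variable (𝒮) in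
/-- `ρ` is the coefficient of `x⁻¹` in the expansion at infinity, that is, up to sign the residue
at infinity of the product with `dx`. -/
structure IsResidue (x : K) (P₁ : ι) (ρ : k⟮x⟯ →ₗ[k] k) : Prop where
  polynomial : ∀ p : Polynomial k, ρ (Polynomial.aeval (AdjoinSimple.gen k x) p) = 0
  vanishing : ∀ s ∈ 𝒮.vanishing x P₁ 2, ρ s = 0
  inv_gen : ρ (AdjoinSimple.gen k x)⁻¹ = 1

/-- The residue at infinity: the coefficient of `x⁻¹` of the part that vanishes at infinity. -/
theorem exists_isResidue (hx : 𝒮.ord P₁ x < 0) : ∃ ρ, 𝒮.IsResidue x P₁ ρ := by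
  have h1 : gen⁻¹ ∉ LinearMap.range (Polynomial.aeval gen).toLinearMap ⊔ 𝒮.vanishing x P₁ 2 := by
    intro h
    obtain ⟨_, ⟨p, rfl⟩, s, hs, h⟩ := Submodule.mem_sup.mp h
    replace h : Polynomial.aeval gen p + s = gen⁻¹ := h
    have h2 : Polynomial.aeval x p ∈ 𝒮.sect P₁ (𝒮.ord P₁ x) := by
      have h3 : Polynomial.aeval gen p ∈ 𝒮.vanishing x P₁ 1 := by
        rw [eq_sub_of_add_eq h]
        refine sub_mem ?_ (vanishing_anti hx (by norm_num) hs)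
        have := zpow_gen_mem_vanishing (𝒮 := 𝒮) (P₁ := P₁) (x := x) (-1)
        rwa [zpow_neg_one] at this
      rwa [mem_vanishing, coe_aeval_gen, one_mul] at h3
    have hp : p = 0 := by
      by_contra hp
      have h4 := 𝒮.ord_aeval_of_neg hx hp
      rw [mem_sect_of_ne h4.1, h4.2] at h2
      have : (p.natDegree : ℤ) * 𝒮.ord P₁ x ≤ 0 :=
        mul_nonpos_of_nonneg_of_nonpos (by positivity) hx.le
      omega
    rw [hp, map_zero, zero_add] at h
    rw [h, mem_vanishing, IntermediateField.coe_inv, AdjoinSimple.coe_gen,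
      mem_sect_of_ne (inv_ne_zero (𝒮.ne_zero_of_ord_ne_zero hx.ne)), 𝒮.ord_inv] at hs
    omega
  obtain ⟨φ, hφ, hle⟩ := Submodule.exists_le_ker_of_notMem h1
  refine ⟨(φ gen⁻¹)⁻¹ • φ, ⟨fun p => ?_, fun s hs => ?_, by simp [hφ]⟩⟩
  · have : φ (Polynomial.aeval gen p) = 0 := hle (Submodule.mem_sup_left ⟨p, rfl⟩)
    simp [this]
  · have : φ s = 0 := hle (Submodule.mem_sup_right hs)
    simp [this]

/-- A functional on `k(x)` that vanishes on the polynomials and on the functions that vanish to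
high order at infinity is the residue of a multiple. -/
theorem IsResidue.exists_eq_mul {ρ : k⟮x⟯ →ₗ[k] k} (hρ : 𝒮.IsResidue x P₁ ρ)
    (hx : 𝒮.ord P₁ x < 0) (M : ℕ) (μ : k⟮x⟯ →ₗ[k] k)
    (h1 : ∀ p : Polynomial k, μ (Polynomial.aeval gen p) = 0)
    (h2 : ∀ s ∈ 𝒮.vanishing x P₁ (M + 1), μ s = 0) : ∃ q, ∀ f, μ f = ρ (f * q) := by
  have hg := gen_ne_zero (𝒮 := 𝒮) hx
  induction M generalizing μ with
  | zero =>
    refine ⟨0, fun f => ?_⟩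
    obtain ⟨p, s, hs, rfl⟩ := exists_polynomial_add hx f
    rw [map_add, h1, h2 s (by simpa using hs)]
    simp
  | succ M ih =>
    set c := μ (gen ^ (-(M + 1 : ℤ))) with hc
    obtain ⟨q, hq⟩ := ih (μ - c • ρ ∘ₗ LinearMap.mulRight k (gen ^ M)) (fun p => by
      have h3 := hρ.polynomial (p * Polynomial.X ^ M)
      rw [map_mul, map_pow, Polynomial.aeval_X] at h3
      simp [h1, h3]) (fun s hs => by
      obtain ⟨a, s', hs', rfl⟩ := exists_smul_zpow_add hx hs
      have h3 : ρ (gen ^ (-(M + 1 : ℤ)) * gen ^ M) = 1 := by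
        rw [← zpow_natCast, ← zpow_add₀ hg, show -(M + 1 : ℤ) + M = -1 by ring, zpow_neg_one,
          hρ.inv_gen]
      have h4 : ρ (s' * gen ^ M) = 0 := by
        refine hρ.vanishing _ ?_
        have := mul_mem_vanishing hs' (zpow_gen_mem_vanishing (𝒮 := 𝒮) (P₁ := P₁) (x := x) M)
        rw [zpow_natCast] at this
        convert this using 2
        ring
      have h5 : μ s' = 0 := h2 s' (by push_cast; exact hs')
      simp only [LinearMap.sub_apply, LinearMap.smul_apply, LinearMap.comp_apply,
        LinearMap.mulRight_apply, map_add, map_smul, h3, h4, h5, ← hc]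
      simp [mul_comm])
    refine ⟨q + c • gen ^ M, fun f => ?_⟩
    have := hq f
    simp only [LinearMap.sub_apply, LinearMap.smul_apply, LinearMap.comp_apply,
        LinearMap.mulRight_apply] at this
    rw [mul_add, map_add, ← this, mul_smul_comm, map_smul]
    ring

/-- The residue of `s / (x - a)` for a polynomial `s` is the value of `s` at `a`. -/
theorem IsResidue.apply_div {ρ : k⟮x⟯ →ₗ[k] k} (hρ : 𝒮.IsResidue x P₁ ρ)
    (hx : 𝒮.ord P₁ x < 0) (a : k) (p : Polynomial k) :
    ρ (Polynomial.aeval gen p / (gen - algebraMap k k⟮x⟯ a)) = p.eval a := by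
  have hg := gen_ne_zero (𝒮 := 𝒮) hx
  have hy : gen - algebraMap k k⟮x⟯ a ≠ 0 := fun h => by
    have : x - algebraMap k K a = 0 := congrArg Subtype.val h
    exact notMem_range_of_ord_neg (𝒮 := 𝒮) hx ⟨a, (sub_eq_zero.mp this).symm⟩
  have aux {F : Type _} [Field F] (G A c R : F) (hG : G ≠ 0) (hy : G - A ≠ 0) :
      ((G - A) * R + c) / (G - A) = R + c * (G⁻¹ + A * G⁻¹ * (G - A)⁻¹) := by
    field_simp
    ring
  obtain ⟨r, hr⟩ := Polynomial.X_sub_C_dvd_sub_C_eval (p := p) (a := a)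
  have h1 : Polynomial.aeval gen p / (gen - algebraMap k k⟮x⟯ a) = Polynomial.aeval gen r +
      p.eval a • (gen⁻¹ + algebraMap k k⟮x⟯ a * gen⁻¹ * (gen - algebraMap k k⟮x⟯ a)⁻¹) := by
    conv_lhs => rw [eq_add_of_sub_eq hr]
    simp only [map_add, map_mul, map_sub, Polynomial.aeval_X, Polynomial.aeval_C, Algebra.smul_def]
    exact aux _ _ _ _ hg hy
  have h2 : algebraMap k k⟮x⟯ a * gen⁻¹ * (gen - algebraMap k k⟮x⟯ a)⁻¹ ∈ 𝒮.vanishing x P₁ 2 := by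
    have h3 : algebraMap k k⟮x⟯ a ∈ 𝒮.vanishing x P₁ 0 := by
      rw [mem_vanishing, zero_mul]
      exact algebraMap_mem_sect P₁ a
    have h4 := zpow_gen_mem_vanishing (𝒮 := 𝒮) (P₁ := P₁) (x := x) (-1)
    rw [zpow_neg_one, neg_neg] at h4
    have h5 : (gen - algebraMap k k⟮x⟯ a)⁻¹ ∈ 𝒮.vanishing x P₁ 1 := by
      rw [mem_vanishing]
      refine self_mem_sect P₁ _ ?_
      have h6 := 𝒮.ord_aeval_of_neg hx (Polynomial.X_sub_C_ne_zero a)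
      rw [map_sub, Polynomial.aeval_X, Polynomial.aeval_C, Polynomial.natDegree_X_sub_C] at h6
      rw [IntermediateField.coe_inv, 𝒮.ord_inv]
      change - -𝒮.ord P₁ (x - algebraMap k K a) ≤ _
      rw [h6.2]
      simp
    have h7 := mul_mem_vanishing (mul_mem_vanishing h3 h4) h5
    rwa [zero_add, one_add_one_eq_two] at h7
  rw [h1, map_add, hρ.polynomial, map_smul, map_add, hρ.inv_gen, hρ.vanishing _ h2]
  simp

end Residue

end PlaceSystem

namespace PlaceSystem

open IntermediateField

variable {k K ι : Type*} [Field k] [Field K] [Algebra k K] {𝒮 : PlaceSystem k K ι}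

/-! ### Duality -/

theorem finite_notMem_sect (v : K) (E : ι →₀ ℤ) : {P | v ∉ 𝒮.sect P (E P)}.Finite := by
  by_cases hv : v = 0
  · convert Set.finite_empty
    ext P
    simp [hv]
  refine ((𝒮.finite_support hv).union E.hasFiniteSupport).subset fun P hP => ?_
  by_contra h
  simp only [Set.mem_union, Set.mem_ofPred_eq, Function.mem_support, not_or, not_not] at h
  exact hP (self_mem_sect P v (by omega))

/-- Poles at places where `x` is finite are cleared by a polynomial in `x`, which need not vanish
at points of the line not below these places. -/
theorem exists_polynomial_mul_mem_sect {x : K} (hx : x ∉ (algebraMap k K).range) (Z : Set ι)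
    (hZ : ∀ P ∈ Z, 0 ≤ 𝒮.ord P x) (v : K) (E : ι →₀ ℤ) :
    ∃ p : Polynomial k, p ≠ 0 ∧ (∀ P ∈ Z, Polynomial.aeval x p * v ∈ 𝒮.sect P (E P)) ∧
      ∀ a : k, (∀ P ∈ Z, 𝒮.ord P (x - algebraMap k K a) ≤ 0) → p.eval a ≠ 0 := by
  classical
  have hfin : {P | P ∈ Z ∧ v ∉ 𝒮.sect P (E P)}.Finite :=
    (finite_notMem_sect (𝒮 := 𝒮) v E).subset fun P hP => hP.2
  set B := hfin.toFinset with hB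
  have hres : ∀ P : ι, ∃ c : k, P ∈ Z → 1 ≤ 𝒮.ord P (x - algebraMap k K c) := fun P => by
    by_cases hP : P ∈ Z
    · obtain ⟨c, hc⟩ := 𝒮.exists_residue P (hZ P hP)
      exact ⟨c, fun _ => hc.resolve_left fun h => hx ⟨c, (sub_eq_zero.mp h).symm⟩⟩
    · exact ⟨0, fun h => absurd h hP⟩
  choose c hc using hres
  set N : ℕ := ∑ P ∈ B, ((𝒮.ord P v).natAbs + (E P).natAbs) with hN
  have hsub : ∀ a : k, x - algebraMap k K a ≠ 0 := fun a h => hx ⟨a, (sub_eq_zero.mp h).symm⟩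
  refine ⟨∏ P ∈ B, (Polynomial.X - Polynomial.C (c P)) ^ N,
    Finset.prod_ne_zero_iff.mpr fun P _ => pow_ne_zero _ (Polynomial.X_sub_C_ne_zero _), ?_, ?_⟩
  · intro P hP
    have h1 : Polynomial.aeval x (∏ P ∈ B, (Polynomial.X - Polynomial.C (c P)) ^ N) =
        ∏ P ∈ B, (x - algebraMap k K (c P)) ^ N := by simp [map_prod]
    have hnn : ∀ Q ∈ B, 0 ≤ 𝒮.ord P ((x - algebraMap k K (c Q)) ^ N) := fun Q _ => by
      rw [𝒮.ord_pow]
      refine mul_nonneg (by positivity) (mem_sect_zero.mp (sub_mem (mem_sect_zero.mpr (hZ P hP))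
        (algebraMap_mem_sect P _)))
    have h2 := 𝒮.ord_prod P B (fun Q => (x - algebraMap k K (c Q)) ^ N)
      fun Q _ => pow_ne_zero _ (hsub _)
    rw [h1]
    by_cases hPB : P ∈ B
    · have h3 := Finset.single_le_sum hnn hPB
      rw [← h2, 𝒮.ord_pow] at h3
      have h4 := Finset.single_le_sum (f := fun P => (𝒮.ord P v).natAbs + (E P).natAbs)
        (fun _ _ => Nat.zero_le _) hPB
      refine mul_mem_sect (self_mem_sect P _ (neg_le_neg h3)) (self_mem_sect P v le_rfl) ?_
      have h5 : (N : ℤ) * 1 ≤ N * 𝒮.ord P (x - algebraMap k K (c P)) :=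
        mul_le_mul_of_nonneg_left (hc P hP) (by positivity)
      simp only [← hN] at h4
      omega
    · have h3 : v ∈ 𝒮.sect P (E P) := by
        by_contra h
        exact hPB (by rw [hB, Set.Finite.mem_toFinset]; exact ⟨hP, h⟩)
      refine mul_mem_sect (mem_sect_zero.mpr ?_) h3 (zero_add _).le
      rw [h2]
      exact Finset.sum_nonneg hnn
  · intro a ha
    simp only [Polynomial.eval_prod, Polynomial.eval_pow, Polynomial.eval_sub, Polynomial.eval_X,
      Polynomial.eval_C]
    refine Finset.prod_ne_zero_iff.mpr fun P hP => pow_ne_zero _ fun h => ?_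
    rw [hB, Set.Finite.mem_toFinset] at hP
    have h1 := hc P hP.1
    rw [← sub_eq_zero.mp h] at h1
    have := ha P hP.1
    omega

variable [CharZero k]

/-- At the places over a point of the line, a function that is close to `1` at one of them and
close to `0` at the others has a trace that is a unit. -/
theorem IsParameter.exists_trace_ne_zero {x : K} {y : k⟮x⟯} (hy : 𝒮.IsParameter x y)
    [FiniteDimensional k⟮x⟯ K] {P₀ : ι} (hP₀ : 0 < 𝒮.ord P₀ y) (N : ℕ) :
    ∃ u : K, u ∈ 𝒮.sect P₀ 0 ∧ (∀ P, P ≠ P₀ → 0 < 𝒮.ord P y → u ∈ 𝒮.sect P (-N)) ∧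
      Algebra.trace k⟮x⟯ K u ≠ 0 ∧
      ∀ P, 0 < 𝒮.ord P y → 𝒮.ord P (Algebra.trace k⟮x⟯ K u : k⟮x⟯) = 0 := by
  classical
  have hy0 : (y : K) ≠ 0 := 𝒮.ne_zero_of_ord_ne_zero hP₀.ne'
  have hfin : {P | 0 < 𝒮.ord P y}.Finite := (𝒮.finite_support hy0).subset fun P h => ne_of_gt h
  set S := hfin.toFinset with hS
  have hmem : ∀ P, P ∈ S ↔ 0 < 𝒮.ord P y := fun P => by simp [hS]
  set M : ℕ := N + 1 + ∑ P ∈ S, (𝒮.ord P y).natAbs with hM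
  have hMle : ∀ P ∈ S, 𝒮.ord P y ≤ M := fun P hP => by
    have := Finset.single_le_sum (f := fun P => (𝒮.ord P y).natAbs) (fun _ _ => Nat.zero_le _) hP
    omega
  obtain ⟨u, hu⟩ := 𝒮.weak_approximation S (fun P => if P = P₀ then 1 else 0) (fun _ => -M)
  have hu0 : u - 1 ∈ 𝒮.sect P₀ (-M) := by simpa using hu P₀ ((hmem P₀).mpr hP₀)
  have hu1 : ∀ P, P ≠ P₀ → 0 < 𝒮.ord P y → u ∈ 𝒮.sect P (-M) := fun P h1 h2 => by
    simpa [h1] using hu P ((hmem P).mpr h2)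
  have h1 := ord_eq_zero_of_sub_one_mem (sect_mono P₀ (by omega : -(M : ℤ) ≤ -1) hu0)
  have hπ := hy.isUniformizerBelow hP₀
  have hle : ∀ P, 𝒮.below k⟮x⟯ P₀ ≤ 𝒮.below k⟮x⟯ P ↔ 0 < 𝒮.ord P y :=
    fun P => hy.below_le_iff hP₀
  have hreg : ∀ P, 0 < 𝒮.ord P y → u ∈ 𝒮.sect P 0 := fun P hP => by
    by_cases h : P = P₀
    · rw [h]; exact mem_sect_zero.mpr h1.2.ge
    · exact sect_mono P (by omega) (hu1 P h hP)
  have h2 := hπ.ord_trace_eq_zero (k := k) (u := u)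
    (fun P hP => mem_sect_zero.mp (hreg P ((hle P).mp hP)))
    (fun P hP => by
      have hP' := (hle P).mp hP
      have h3 : u * u - u ∈ 𝒮.sect P (-M) := by
        by_cases h : P = P₀
        · subst h
          rw [show u * u - u = u * (u - 1) by ring]
          exact mul_mem_sect (hreg P hP') hu0 (zero_add _).le
        · exact sub_mem (mul_mem_sect (hreg P hP') (hu1 P h hP') (zero_add _).le) (hu1 P h hP')
      rw [← mem_sect_zero, div_eq_mul_inv]
      refine mul_mem_sect h3 (self_mem_sect P _ le_rfl) ?_
      rw [𝒮.ord_inv]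
      have := hMle P ((hmem P).mpr hP')
      change _ + - -𝒮.ord P (y : K) ≤ _
      omega)
    ⟨P₀, le_rfl, h1.2, h1.1⟩
  refine ⟨u, hreg P₀ hP₀, fun P h hP => sect_mono P (by omega) (hu1 P h hP), h2.1, fun P hP => ?_⟩
  exact IsUniformizerBelow.ord_eq_zero_of_le ((hle P).mpr hP) h2.2

/-- If `f / h` has too large a pole at some place over a point of the line, then `(x - a)⁻¹` is
the trace of `f v` with `v` of controlled poles over that point. -/
theorem IsParameter.exists_trace_mul_eq {x : K} {y : k⟮x⟯} (hy : 𝒮.IsParameter x y)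
    [FiniteDimensional k⟮x⟯ K] {P₀ : ι} (hP₀ : 0 < 𝒮.ord P₀ y) (a : k)
    (ha : ∀ P, 0 < 𝒮.ord P y → 𝒮.ord P (x - algebraMap k K a) ≠ 0)
    {f h : K} (hf : f ≠ 0) (hh : h ≠ 0) {W D : ι →₀ ℤ}
    (hW : ∀ P, 0 < 𝒮.ord P y → W P = 𝒮.ord P h + 𝒮.ord P (x - algebraMap k K a) - 1)
    (hfh : f / h ∉ 𝒮.sect P₀ (D P₀)) :
    ∃ v : K, v ≠ 0 ∧ (∀ P, 0 < 𝒮.ord P y → v ∈ 𝒮.sect P (W P - D P)) ∧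
      Algebra.trace k⟮x⟯ K (f * v) = (AdjoinSimple.gen k x - algebraMap k k⟮x⟯ a)⁻¹ := by
  classical
  have hy0 : (y : K) ≠ 0 := 𝒮.ne_zero_of_ord_ne_zero hP₀.ne'
  have hfin : {P | 0 < 𝒮.ord P y}.Finite := (𝒮.finite_support hy0).subset fun P h => ne_of_gt h
  set S := hfin.toFinset with hS
  set N : ℕ := 1 + ∑ P ∈ S, ((𝒮.ord P f).natAbs + (𝒮.ord P h).natAbs + (D P).natAbs) with hN
  obtain ⟨u, hu0, hu, hT0, hT⟩ := hy.exists_trace_ne_zero hP₀ N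
  set T := Algebra.trace k⟮x⟯ K u with hTdef
  have hT0' : (T : K) ≠ 0 := fun h => hT0 (Subtype.ext h)
  have hxa := 𝒮.ne_zero_of_ord_ne_zero (ha P₀ hP₀)
  have hune : u ≠ 0 := by
    rintro rfl
    exact hT0 (map_zero _)
  have hden : (T : K) * (x - algebraMap k K a) * f ≠ 0 := mul_ne_zero (mul_ne_zero hT0' hxa) hf
  refine ⟨u / (T * (x - algebraMap k K a) * f), div_ne_zero hune hden, fun P hP => ?_, ?_⟩
  · have h1 : 𝒮.ord P ((T : K) * (x - algebraMap k K a) * f) =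
        𝒮.ord P (x - algebraMap k K a) + 𝒮.ord P f := by
      rw [𝒮.ord_mul P (mul_ne_zero hT0' hxa) hf, 𝒮.ord_mul P hT0' hxa, hT P hP, zero_add]
    rw [mem_sect_of_ne (div_ne_zero hune hden), 𝒮.ord_div P hune hden, h1, hW P hP]
    by_cases hPP : P = P₀
    · subst hPP
      rw [mem_sect_of_ne (div_ne_zero hf hh), 𝒮.ord_div P hf hh] at hfh
      rw [mem_sect_zero] at hu0
      omega
    · have h2 := hu P hPP hP
      rw [mem_sect_of_ne hune] at h2
      have h3 := Finset.single_le_sum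
        (f := fun P => (𝒮.ord P f).natAbs + (𝒮.ord P h).natAbs + (D P).natAbs)
        (fun _ _ => Nat.zero_le _) (hfin.mem_toFinset.mpr hP)
      rw [← hS] at h3
      omega
  · have h1 : f * (u / (T * (x - algebraMap k K a) * f)) =
        (T * (AdjoinSimple.gen k x - algebraMap k k⟮x⟯ a))⁻¹ • u := by
      have h2 : algebraMap k⟮x⟯ K ((T * (AdjoinSimple.gen k x - algebraMap k k⟮x⟯ a))⁻¹) =
        ((T : K) * (x - algebraMap k K a))⁻¹ := rfl
      rw [Algebra.smul_def, h2, mul_comm _ u, div_eq_mul_inv, mul_inv, mul_left_comm, mul_comm f,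
        mul_assoc _ _ f, inv_mul_cancel₀ hf, mul_one]
    rw [h1, map_smul, ← hTdef, smul_eq_mul, mul_inv, mul_comm, ← mul_assoc, mul_inv_cancel₀ hT0,
      one_mul]

omit [CharZero k] in
/-- Vanishing at infinity is defined with one place `P₁` over infinity; it implies vanishing at every
other place `P` over infinity. -/
theorem mem_sect_of_mem_vanishing {x : K} {P₁ P : ι} (hx : 𝒮.ord P₁ x < 0) (hP : 𝒮.ord P x < 0)
    {m : ℤ} {s : k⟮x⟯} (hs : s ∈ 𝒮.vanishing x P₁ m) : (s : K) ∈ 𝒮.sect P (m * 𝒮.ord P x) := by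
  by_cases hs0 : s = 0
  · rw [hs0]; exact zero_mem _
  have hs0' : (s : K) ≠ 0 := fun h => hs0 (Subtype.ext h)
  obtain ⟨n, hn⟩ := (𝒮.isParameter_inv (notMem_range_of_ord_neg (𝒮 := 𝒮) hx)).2 s hs0
  simp only [IntermediateField.coe_inv, AdjoinSimple.coe_gen, 𝒮.ord_inv] at hn
  rw [mem_vanishing, mem_sect_of_ne hs0', hn P₁ (by omega)] at hs
  rw [mem_sect_of_ne hs0', hn P (by omega)]
  have : m ≤ n := by nlinarith
  nlinarith

variable [IsAlgClosed k]

/-- A functional on `K` that is local at the places over infinity and also at the places over the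
finite points of the line is the residue at infinity of a trace. -/
theorem IsResidue.exists_eq_trace {x : K} {P₁ : ι} {ρ : k⟮x⟯ →ₗ[k] k} (hρ : 𝒮.IsResidue x P₁ ρ)
    (hx : 𝒮.ord P₁ x < 0) (E : ι →₀ ℤ) (μ : K →ₗ[k] k)
    (h1 : ∀ β, (∀ P, 𝒮.ord P x < 0 → β ∈ 𝒮.sect P (E P)) → μ β = 0)
    (h2 : ∀ β, (∀ P, 0 ≤ 𝒮.ord P x → β ∈ 𝒮.sect P (E P)) → μ β = 0) :
    ∃ f : K, ∀ β, μ β = ρ (Algebra.trace k⟮x⟯ K (f * β)) := by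
  classical
  have hxc := notMem_range_of_ord_neg (𝒮 := 𝒮) hx
  have := 𝒮.finiteDimensional_adjoin hxc
  have : CharZero k⟮x⟯ := charZero_of_injective_algebraMap (algebraMap k k⟮x⟯).injective
  have key : ∀ β : K, ∃ τ : k⟮x⟯, ∀ h : k⟮x⟯, μ (h • β) = ρ (h * τ) := by
    intro β
    obtain ⟨p, hp0, hp, -⟩ := exists_polynomial_mul_mem_sect (𝒮 := 𝒮) hxc {P | 0 ≤ 𝒮.ord P x}
      (fun P hP => hP) β E
    have hp0' : Polynomial.aeval (AdjoinSimple.gen k x) p ≠ 0 := fun h => by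
      have := congrArg (Subtype.val) h
      rw [coe_aeval_gen] at this
      exact (𝒮.ord_aeval_of_neg hx hp0).1 this
    have hfin : {P | 𝒮.ord P x < 0}.Finite :=
      (𝒮.finite_support (𝒮.ne_zero_of_ord_ne_zero hx.ne)).subset fun P h => ne_of_lt h
    set C : ℕ := ∑ P ∈ hfin.toFinset, ((𝒮.ord P β).natAbs + (E P).natAbs) with hC
    obtain ⟨q, hq⟩ := hρ.exists_eq_mul hx (p.natDegree + C)
      (μ ∘ₗ (LinearMap.toSpanSingleton k⟮x⟯ K β).restrictScalars k ∘ₗ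
        LinearMap.mulRight k (Polynomial.aeval (AdjoinSimple.gen k x) p)) (fun r => by
        refine h2 _ fun P hP => ?_
        change (Polynomial.aeval (AdjoinSimple.gen k x) r *
          Polynomial.aeval (AdjoinSimple.gen k x) p) • β ∈ _
        rw [Algebra.smul_def, map_mul, mul_assoc]
        refine mul_mem_sect (m := 0) ?_ ?_ (zero_add (E P)).le
        · change ((Polynomial.aeval (AdjoinSimple.gen k x) r : k⟮x⟯) : K) ∈ 𝒮.valRing P
          rw [coe_aeval_gen]
          have h3 := Polynomial.aeval_mem_adjoin_singleton k x (p := r)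
          generalize Polynomial.aeval x r = z at h3
          induction h3 using Algebra.adjoin_induction with
          | mem y hy => rw [hy]; exact mem_valRing.mpr hP
          | algebraMap c => exact algebraMap_mem_valRing P c
          | add y z _ _ hy hz => exact add_mem hy hz
          | mul y z _ _ hy hz => exact mul_mem hy hz
        · change ((Polynomial.aeval (AdjoinSimple.gen k x) p : k⟮x⟯) : K) * β ∈ _
          rw [coe_aeval_gen]
          exact hp P hP) (fun s hs => by
        refine h1 _ fun P hP => ?_
        change (s * Polynomial.aeval (AdjoinSimple.gen k x) p) • β ∈ _
        rw [Algebra.smul_def, map_mul]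
        have h3 := mem_sect_of_mem_vanishing hx hP hs
        have h4 : algebraMap k⟮x⟯ K (Polynomial.aeval (AdjoinSimple.gen k x) p) ∈
            𝒮.sect P (-(p.natDegree * 𝒮.ord P x)) := by
          change ((Polynomial.aeval (AdjoinSimple.gen k x) p : k⟮x⟯) : K) ∈ _
          rw [coe_aeval_gen]
          exact self_mem_sect P _ (by rw [(𝒮.ord_aeval_of_neg hP hp0).2])
        refine mul_mem_sect (mul_mem_sect h3 h4 le_rfl) (self_mem_sect P β le_rfl) ?_
        have h5 := Finset.single_le_sum (f := fun P => (𝒮.ord P β).natAbs + (E P).natAbs)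
          (fun _ _ => Nat.zero_le _) (hfin.mem_toFinset.mpr hP)
        simp only [← hC] at h5
        push_cast
        have h6 : ((C : ℤ) + 1) * 𝒮.ord P x ≤ -(C + 1) := by nlinarith
        have h7 : ((p.natDegree : ℤ) + C + 1) * 𝒮.ord P x + -(p.natDegree * 𝒮.ord P x) =
          ((C : ℤ) + 1) * 𝒮.ord P x := by ring
        omega)
    refine ⟨q / Polynomial.aeval (AdjoinSimple.gen k x) p, fun h => ?_⟩
    have h3 := hq (h / Polynomial.aeval (AdjoinSimple.gen k x) p)
    simp only [LinearMap.comp_apply, LinearMap.mulRight_apply, LinearMap.restrictScalars_apply,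
      LinearMap.toSpanSingleton_apply, div_mul_cancel₀ h hp0'] at h3
    rw [h3, div_mul_eq_mul_div, mul_div_assoc]
  choose τ hτ using key
  let b := Module.finBasis k⟮x⟯ K
  let T : Module.Dual k⟮x⟯ K := b.constr k⟮x⟯ fun i => τ (b i)
  have hT : ∀ β, μ β = ρ (T β) := fun β => by
    conv_lhs => rw [← b.sum_repr β]
    rw [map_sum, Module.Basis.constr_apply_fintype, map_sum]
    refine Finset.sum_congr rfl fun i _ => ?_
    rw [hτ]
    rfl
  obtain ⟨f, hf⟩ := ((Algebra.traceForm k⟮x⟯ K).toDual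
    (traceForm_nondegenerate k⟮x⟯ K)).surjective T
  refine ⟨f, fun β => ?_⟩
  rw [hT, ← hf]
  rfl

/-- Half of Serre duality, in the language of repartitions: if `H⁰(D) = 0` and `W` is canonical,
then `H¹(W - D) = 0`. -/
theorem IsCanonical.exists_sub_mem_sect {W D : ι →₀ ℤ} (hW : 𝒮.IsCanonical W)
    (hD : ∀ f, (∀ P, f ∈ 𝒮.sect P (D P)) → f = 0) {α : ι → K}
    (hα : {P | α P ∉ 𝒮.sect P 0}.Finite) : ∃ f, ∀ P, α P - f ∈ 𝒮.sect P (W P - D P) := by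
  classical
  set Bd : Submodule k (ι → K) := Submodule.pi Set.univ fun P => 𝒮.sect P (W P - D P) with hBd
  set Pr : Submodule k (ι → K) := LinearMap.range (LinearMap.pi fun _ : ι => LinearMap.id) with hPr
  have hmemB : ∀ γ : ι → K, (∀ P, γ P ∈ 𝒮.sect P (W P - D P)) → γ ∈ Bd := fun γ h P _ => h P
  suffices h : α ∈ Bd ⊔ Pr by
    obtain ⟨β, hβ, _, ⟨f, rfl⟩, h⟩ := Submodule.mem_sup.mp h
    refine ⟨f, fun P => ?_⟩
    rw [← h]
    simpa using hβ P trivial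
  by_contra hn
  obtain ⟨Λ, hΛ, hle⟩ := Submodule.exists_le_ker_of_notMem hn
  have hΛB : ∀ γ : ι → K, (∀ P, γ P ∈ 𝒮.sect P (W P - D P)) → Λ γ = 0 :=
    fun γ h => hle (Submodule.mem_sup_left (hmemB γ h))
  have hΛP : ∀ f : K, Λ (fun _ => f) = 0 := fun f => hle (Submodule.mem_sup_right ⟨f, rfl⟩)
  obtain ⟨P₁, hP₁⟩ : ∃ P₁, Λ (Pi.single P₁ (α P₁)) ≠ 0 := by
    by_contra! h
    set S : Finset ι := hα.toFinset ∪ (W.support ∪ D.support) with hS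
    have h1 : Λ (α - ∑ P ∈ S, Pi.single P (α P)) = 0 := by
      refine hΛB _ fun P => ?_
      rw [Pi.sub_apply, Finset.sum_apply, Finset.sum_pi_single]
      split_ifs with hP
      · rw [sub_self]; exact zero_mem _
      · simp only [hS, Finset.mem_union, Set.Finite.mem_toFinset, Set.mem_ofPred_eq,
          Finsupp.mem_support_iff, not_or, not_not] at hP
        rw [sub_zero, hP.2.1, hP.2.2, sub_zero]
        exact hP.1
    rw [map_sub, map_sum, Finset.sum_eq_zero fun P _ => h P, sub_zero] at h1
    exact hΛ h1
  obtain ⟨t, ht0, ht⟩ := 𝒮.exists_pos_ord P₁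
  set x := t⁻¹ with hxdef
  have hx : 𝒮.ord P₁ x < 0 := by rw [hxdef, 𝒮.ord_inv]; omega
  have hxc := notMem_range_of_ord_neg (𝒮 := 𝒮) hx
  have := 𝒮.finiteDimensional_adjoin hxc
  -- `Λ` on the families that are constant along the poles of `x` and zero elsewhere
  let μ : K →ₗ[k] k :=
    Λ ∘ₗ LinearMap.pi fun P => if 𝒮.ord P x < 0 then LinearMap.id else 0
  have hμ : ∀ β, μ β = Λ fun P => if 𝒮.ord P x < 0 then β else 0 := fun β => by
    simp only [μ, LinearMap.comp_apply]
    congr 1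
    ext P
    simp only [LinearMap.pi_apply]
    split_ifs <;> rfl
  have h1 : ∀ β, (∀ P, 𝒮.ord P x < 0 → β ∈ 𝒮.sect P ((W - D) P)) → μ β = 0 := fun β h => by
    rw [hμ]
    refine hΛB _ fun P => ?_
    split_ifs with hP
    · exact h P hP
    · exact zero_mem _
  have h2 : ∀ β, (∀ P, 0 ≤ 𝒮.ord P x → β ∈ 𝒮.sect P ((W - D) P)) → μ β = 0 := fun β h => by
    have h3 : (fun P => if 𝒮.ord P x < 0 then β else 0) =
        (fun _ => β) - fun P => if 𝒮.ord P x < 0 then 0 else β := by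
      ext P
      simp only [Pi.sub_apply]
      split_ifs <;> simp
    rw [hμ, h3, map_sub, hΛP, hΛB, sub_zero]
    intro P
    split_ifs with hP
    · exact zero_mem _
    · exact h P (not_lt.mp hP)
  obtain ⟨β₀, hβ₀⟩ : ∃ β₀, μ β₀ ≠ 0 := by
    have hfin : {P | 𝒮.ord P x < 0}.Finite :=
      (𝒮.finite_support (𝒮.ne_zero_of_ord_ne_zero hx.ne)).subset fun P h => ne_of_lt h
    obtain ⟨β, hβ⟩ := 𝒮.weak_approximation hfin.toFinset (Pi.single P₁ (α P₁))
      (fun P => W P - D P)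
    refine ⟨β, fun h => hP₁ ?_⟩
    rw [hμ] at h
    have h3 : Λ ((fun P => if 𝒮.ord P x < 0 then β else 0) - Pi.single P₁ (α P₁)) = 0 := by
      refine hΛB _ fun P => ?_
      rw [Pi.sub_apply]
      split_ifs with hP
      · exact hβ P (hfin.mem_toFinset.mpr hP)
      · have : P ≠ P₁ := by rintro rfl; exact hP hx
        rw [Pi.single_eq_of_ne this, sub_zero]
        exact zero_mem _
    rwa [map_sub, h, zero_sub, neg_eq_zero] at h3
  obtain ⟨ρ, hρ⟩ := exists_isResidue hx
  obtain ⟨f, hf⟩ := hρ.exists_eq_trace hx (W - D) μ h1 h2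
  have hf0 : f ≠ 0 := by
    rintro rfl
    exact hβ₀ (by rw [hf, zero_mul, map_zero, map_zero])
  obtain ⟨h, hh0, hh⟩ := hW.exists_eq_ord_add hxc
  refine div_ne_zero hf0 hh0 (hD _ fun P₀ => ?_)
  by_contra hP₀
  by_cases hpole : 𝒮.ord P₀ x < 0
  · -- a bad place over infinity contradicts `h1`
    have hord : ∀ P, 𝒮.ord P ((AdjoinSimple.gen k x)⁻¹ : k⟮x⟯) = -𝒮.ord P x := fun P => by
      rw [IntermediateField.coe_inv, AdjoinSimple.coe_gen, 𝒮.ord_inv]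
    obtain ⟨v, -, hv, htr⟩ := (𝒮.isParameter_inv hxc).exists_trace_mul_eq (P₀ := P₀)
      (by rw [hord]; omega) 0 (fun P hP => by rw [hord] at hP; rw [map_zero, sub_zero]; omega)
      hf0 hh0 (fun P hP => hh P 0 (by rw [hord] at hP; rw [map_zero, sub_zero]; omega)) hP₀
    have h3 := h1 v fun P hP => hv P (by rw [hord]; omega)
    rw [hf, htr, map_zero, sub_zero, hρ.inv_gen] at h3
    exact one_ne_zero h3
  · -- a bad place over the finite point `a` contradicts `h2`
    obtain ⟨a, ha⟩ := 𝒮.exists_residue P₀ (not_lt.mp hpole)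
    have hsub : x - algebraMap k K a ≠ 0 := fun h => hxc ⟨a, (sub_eq_zero.mp h).symm⟩
    replace ha := ha.resolve_left hsub
    have hord : ∀ P, 𝒮.ord P (AdjoinSimple.gen k x - algebraMap k k⟮x⟯ a : k⟮x⟯) =
      𝒮.ord P (x - algebraMap k K a) := fun P => rfl
    obtain ⟨v, -, hv, htr⟩ := (𝒮.isParameter_sub hxc a).exists_trace_mul_eq (P₀ := P₀)
      (by rw [hord]; omega) a (fun P hP => by rw [hord] at hP; omega)
      hf0 hh0 (fun P hP => hh P a (by rw [hord] at hP; omega)) hP₀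
    obtain ⟨p, -, hp, hpa⟩ := exists_polynomial_mul_mem_sect (𝒮 := 𝒮) hxc
      {P | 0 ≤ 𝒮.ord P x ∧ 𝒮.ord P (x - algebraMap k K a) ≤ 0} (fun P hP => hP.1) v (W - D)
    have h3 := h2 (Polynomial.aeval x p * v) fun P hP => by
      by_cases hPa : 𝒮.ord P (x - algebraMap k K a) ≤ 0
      · exact hp P ⟨hP, hPa⟩
      · refine mul_mem_sect (m := 0) ?_ (hv P (by rw [hord]; omega)) (zero_add _).le
        by_cases hp0 : p = 0
        · rw [hp0, map_zero]; exact zero_mem _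
        rw [mem_sect_zero, 𝒮.ord_aeval_of_pos a (by omega) hp0]
        exact mul_nonneg (by positivity) (by omega)
    have h4 : f * (Polynomial.aeval x p * v) =
        (Polynomial.aeval (AdjoinSimple.gen k x) p : k⟮x⟯) • (f * v) := by
      rw [Algebra.smul_def, mul_left_comm]
      congr 1
      exact (coe_aeval_gen p).symm
    rw [hf, h4, map_smul, htr, smul_eq_mul, ← div_eq_mul_inv, hρ.apply_div hx] at h3
    exact hpa a (fun P hP => hP.2) h3

end PlaceSystem

namespace PlaceSystem

variable {k K ι : Type*} [Field k] [Field K] [Algebra k K] (𝒮 : PlaceSystem k K ι)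

/-! ### Global sections -/

/-- The functions whose poles are bounded by `D`. -/
def sections (D : ι →₀ ℤ) : Submodule k K := ⨅ P, 𝒮.sect P (D P)

variable {𝒮}

theorem mem_sections {D : ι →₀ ℤ} {f : K} : f ∈ 𝒮.sections D ↔ ∀ P, f ∈ 𝒮.sect P (D P) :=
  Submodule.mem_iInf _

theorem finiteDimensional_sections [IsAlgClosed k] (D : ι →₀ ℤ) :
    FiniteDimensional k (𝒮.sections D) := by
  choose g hg _ using fun P => exists_coeffs (𝒮 := 𝒮) P (D P) (D P).toNat
  let G : K →ₗ[k] (P : D.support) → Fin (D P.1).toNat → k := LinearMap.pi fun P => g P.1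
  have hker : 𝒮.sections D ⊓ LinearMap.ker G ≤ k ∙ (1 : K) := by
    rintro f ⟨hf, hG⟩
    obtain ⟨c, hc⟩ := 𝒮.exists_const_of_forall (f := f) fun P => by
      have h1 := mem_sections.mp hf P
      by_cases hP : P ∈ D.support
      · have h2 : f ∈ 𝒮.sect P (D P - (D P).toNat) := by
          rw [← hg P]
          exact ⟨h1, LinearMap.mem_ker.mpr (congrFun (LinearMap.mem_ker.mp hG) ⟨P, hP⟩)⟩
        exact mem_sect_zero.mp (sect_mono P (by omega) h2)
      · rw [Finsupp.notMem_support_iff.mp hP] at h1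
        exact mem_sect_zero.mp h1
    rw [Submodule.mem_span_singleton]
    exact ⟨c, by rw [← Algebra.algebraMap_eq_smul_one, hc]⟩
  have := Submodule.finiteDimensional_of_le hker
  exact Module.Finite.iff_fg.mpr (Submodule.fg_of_fg_map_of_fg_inf_ker G
    (Module.Finite.iff_fg.mp inferInstance) (Module.Finite.iff_fg.mp this))

end PlaceSystem

namespace SmoothCurve

variable {k : Type u} [Field k] (X : SmoothCurve k)

/-! ### Orders and local rings -/

theorem ord_mul (P : X.Point) {f g : X.K} (hf : f ≠ 0) (hg : g ≠ 0) :
    X.ord P (f * g) = X.ord P f + X.ord P g :=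
  Scheme.ord_mul hf hg

theorem ord_algebraMap (P : X.Point) (c : k) : X.ord P (algebraMap k X.K c) = 0 := by
  by_cases hc : c = 0
  · rw [hc, map_zero, X.ord_zero]
  exact Scheme.ord_of_isUnit (U := ⊤) ((IsUnit.mk0 c hc).map X.constants) trivial

/-- A constant as an element of a local ring. -/
def toStalk (x : X.scheme) : k →+* X.scheme.presheaf.stalk x :=
  (X.scheme.presheaf.germ ⊤ x trivial).hom.comp X.constants

theorem algebraMap_toStalk (x : X.scheme) (c : k) :
    algebraMap (X.scheme.presheaf.stalk x) X.K (X.toStalk x c) = algebraMap k X.K c :=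
  Scheme.algebraMap_germ_eq_germToFunctionField (X := X.scheme) (U := ⊤) (x := x) trivial (X.constants c)

variable [IsAlgClosed k]

theorem coheight_point (P : X.Point) : Order.coheight P.1 = 1 := by
  have h := ringKrullDim_stalk_eq_coheight P.1
  rw [IsDiscreteValuationRing.ringKrullDim_eq_one] at h
  exact_mod_cast h.symm

theorem le_ord_iff (P : X.Point) {f : X.K} (hf : f ≠ 0) (n : ℤ) :
    n ≤ X.ord P f ↔ WithZero.exp n ≤ Ring.ordFrac (X.scheme.presheaf.stalk P.1) f :=
  Scheme.le_ord_iff (X.coheight_point P) hf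

theorem ord_eq_iff (P : X.Point) {f : X.K} (hf : f ≠ 0) (n : ℤ) :
    X.ord P f = n ↔ Ring.ordFrac (X.scheme.presheaf.stalk P.1) f = WithZero.exp n :=
  Scheme.ord_eq_iff (X.coheight_point P) hf

/-- The functions of nonnegative order at a point form the local ring. -/
theorem zero_le_ord_iff (P : X.Point) (f : X.K) :
    0 ≤ X.ord P f ↔ f ∈ (algebraMap (X.scheme.presheaf.stalk P.1) X.K).range := by
  by_cases hf : f = 0
  · simp [hf, X.ord_zero]
  rw [X.le_ord_iff P hf, Ring.ordFrac_eq_valuation_inv, WithZero.exp_zero,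
    one_le_inv₀ (zero_lt_iff.mpr ((map_ne_zero _).mpr hf))]
  constructor
  · intro h
    exact IsDiscreteValuationRing.exists_lift_of_le_one h
  · rintro ⟨a, rfl⟩
    exact IsDedekindDomain.HeightOneSpectrum.valuation_le_one _ a

theorem exists_ord_eq_one (P : X.Point) : ∃ t, X.ord P t = 1 := by
  obtain ⟨ϖ, hϖ⟩ := IsDiscreteValuationRing.exists_irreducible (X.scheme.presheaf.stalk P.1)
  have h0 : algebraMap _ X.K ϖ ≠ 0 :=
    (map_ne_zero_iff _ (IsFractionRing.injective (X.scheme.presheaf.stalk P.1) X.K)).mpr hϖ.ne_zero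
  exact ⟨algebraMap _ X.K ϖ, (X.ord_eq_iff P h0 1).mpr (Ring.ordFrac_irreducible hϖ)⟩

theorem isUnit_iff_ord_eq_zero (P : X.Point) {a : X.scheme.presheaf.stalk P.1} (ha : a ≠ 0) :
    IsUnit a ↔ X.ord P (algebraMap _ X.K a) = 0 := by
  have h0 : algebraMap _ X.K a ≠ 0 :=
    (map_ne_zero_iff _ (IsFractionRing.injective (X.scheme.presheaf.stalk P.1) X.K)).mpr ha
  rw [X.ord_eq_iff P h0, WithZero.exp_zero]
  exact Ring.isUnit_iff_ordFrac_one_of_isDiscreteValuationRing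

theorem ord_add (P : X.Point) {f g : X.K} (hfg : f + g ≠ 0) :
    min (X.ord P f) (X.ord P g) ≤ X.ord P (f + g) :=
  Scheme.ord_add hfg

theorem exists_residue (P : X.Point) {f : X.K} (hf : 0 ≤ X.ord P f) :
    ∃ c : k, f - algebraMap k X.K c = 0 ∨ 1 ≤ X.ord P (f - algebraMap k X.K c) := by
  obtain ⟨a, rfl⟩ := (X.zero_le_ord_iff P f).mp hf
  have h := isIso_base_to_residue X.structureMap P.1 P.2
  rw [ConcreteCategory.isIso_iff_bijective] at h
  obtain ⟨b, hb⟩ := h.2 (X.scheme.residue P.1 a)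
  obtain ⟨c, rfl⟩ : ∃ c, (Scheme.ΓSpecIso (.of k)).inv c = b :=
    ⟨(Scheme.ΓSpecIso (.of k)).hom b, by
      rw [← CommRingCat.comp_apply, Iso.hom_inv_id, CommRingCat.id_apply]⟩
  have hc : IsLocalRing.residue _ (X.toStalk P.1 c) = IsLocalRing.residue _ a := hb
  refine ⟨c, ?_⟩
  rw [← X.algebraMap_toStalk P.1, ← map_sub]
  by_cases h0 : a - X.toStalk P.1 c = 0
  · exact Or.inl (by rw [h0, map_zero])
  · have h1 : ¬IsUnit (a - X.toStalk P.1 c) := by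
      rw [← mem_nonunits_iff, ← IsLocalRing.mem_maximalIdeal, ← IsLocalRing.residue_eq_zero_iff,
        map_sub, hc, sub_self]
    rw [X.isUnit_iff_ord_eq_zero P h0] at h1
    have h2 := (X.zero_le_ord_iff P (algebraMap _ X.K (a - X.toStalk P.1 c))).mpr ⟨_, rfl⟩
    exact Or.inr (by omega)

/-! ### Points of the curve -/

/-- The only proper generization of a closed point is the generic point. -/
theorem eq_or_eq_of_specializes (P : X.Point) {x : X.scheme} (h : x ⤳ P.1) :
    x = genericPoint X.scheme ∨ x = P.1 := by
  have hx : x ∈ Set.range (X.scheme.fromSpecStalk P.1) := by rw [Scheme.range_fromSpecStalk]; exact h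
  have hη : genericPoint X.scheme ∈ Set.range (X.scheme.fromSpecStalk P.1) := by
    rw [Scheme.range_fromSpecStalk]
    exact (genericPoint_spec X.scheme).specializes trivial
  obtain ⟨p, rfl⟩ := hx
  obtain ⟨q, hq⟩ := hη
  have hp := p.isPrime
  by_cases h0 : p.asIdeal = ⊥
  · left
    have h1 : p ⤳ q := by
      refine (PrimeSpectrum.le_iff_specializes p q).mp ?_
      change p.asIdeal ≤ q.asIdeal
      rw [h0]
      exact bot_le
    have h2 := h1.map (X.scheme.fromSpecStalk P.1).continuous
    rw [hq] at h2
    exact (h2.antisymm ((genericPoint_spec X.scheme).specializes trivial)).eq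
  · right
    have h1 : p = closedPoint (X.scheme.presheaf.stalk P.1) :=
      PrimeSpectrum.ext (IsLocalRing.eq_maximalIdeal (hp.isMaximal h0))
    rw [h1]
    exact Scheme.fromSpecStalk_closedPoint

instance compactSpace : CompactSpace X.scheme :=
  QuasiCompact.compactSpace_of_compactSpace X.structureMap

instance isNoetherian : IsNoetherian X.scheme where

/-- A point that is not the generic point is closed. -/
theorem isClosed_of_ne (x : X.scheme) (hx : x ≠ genericPoint X.scheme) : IsClosed {x} := by
  obtain ⟨y, hy, hyc⟩ := (isClosed_closure (s := {x})).exists_closed_singleton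
    ⟨x, subset_closure rfl⟩
  have h : x ⤳ y := specializes_iff_mem_closure.mpr hy
  rw [(X.eq_or_eq_of_specializes ⟨y, hyc⟩ h).resolve_left hx]
  exact hyc

theorem point_ne_genericPoint (P : X.Point) : P.1 ≠ genericPoint X.scheme := by
  intro h
  obtain ⟨t, ht⟩ := X.exists_ord_eq_one P
  have h1 : IsField (X.scheme.presheaf.stalk P.1) := by
    rw [h]
    exact Field.toIsField X.K
  exact IsDiscreteValuationRing.not_isField _ h1

/-- A proper closed subset of a curve is finite: the closed points in it are generic points of its
irreducible components. -/
theorem finite_compl (U : X.scheme.Opens) [hU : Nonempty U] : {P : X.Point | P.1 ∉ U}.Finite := by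
  obtain ⟨S, hS, hcl, hirr, hSup⟩ :=
    TopologicalSpace.NoetherianSpace.exists_finite_set_isClosed_irreducible U.isOpen.isClosed_compl
  have hη : genericPoint X.scheme ∈ U :=
    ((genericPoint_spec X.scheme).mem_open_set_iff U.isOpen).mpr (by simpa using hU)
  refine Set.Finite.of_finite_image (f := Subtype.val) (s := {P : X.Point | P.1 ∉ U})
    ((hS.biUnion (t := fun s => {x | IsGenericPoint x s}) fun s _ =>
      Set.Subsingleton.finite fun x hx y hy => hx.eq hy).subset ?_) Subtype.val_injective.injOn
  rintro _ ⟨P, hP, rfl⟩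
  have h1 : P.1 ∈ ⋃₀ S := hSup ▸ hP
  obtain ⟨s, hs, hPs⟩ := h1
  obtain ⟨x, hx⟩ := QuasiSober.sober (hirr s hs) (hcl s hs)
  rw [Set.mem_iUnion₂]
  refine ⟨s, hs, ?_⟩
  rcases X.eq_or_eq_of_specializes P (hx.specializes hPs) with h2 | h2
  · have h3 : genericPoint X.scheme ∈ ((U : Set X.scheme)ᶜ) := by
      rw [hSup]
      exact ⟨s, hs, h2 ▸ hx.mem⟩
    exact absurd hη h3
  · rw [← h2]
    exact hx

theorem finite_support {f : X.K} (hf : f ≠ 0) : {P | X.ord P f ≠ 0}.Finite := by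
  obtain ⟨U, -, f', hU, rfl, hu⟩ := exists_isUnit_germ_eq X.scheme f hf
  exact (X.finite_compl U).subset fun P hP hPU => hP (Scheme.ord_of_isUnit hu hPU)

end SmoothCurve

namespace SmoothCurve

variable {k : Type u} [Field k] (X : SmoothCurve k)

/-! ### The valuative criterion -/

theorem fromSpecStalk_structureMap (x : X.scheme) :
    X.scheme.fromSpecStalk x ≫ X.structureMap = Spec.map (CommRingCat.ofHom (X.toStalk x)) := by
  refine ext_of_isAffine ?_
  rw [Scheme.Hom.comp_appTop, Scheme.fromSpecStalk_appTop]
  have h3 := Scheme.ΓSpecIso_inv_naturality (CommRingCat.ofHom (X.toStalk x))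
  have h4 : CommRingCat.ofHom (X.toStalk x) = (Scheme.ΓSpecIso (.of k)).inv ≫
    X.structureMap.appTop ≫ X.scheme.presheaf.germ ⊤ x trivial := rfl
  rw [h4] at h3
  rw [← cancel_epi (Scheme.ΓSpecIso (.of k)).inv]
  refine Eq.trans ?_ h3
  simp

/-- The local ring at `x` is dominated by the valuation ring `V` of the function field. -/
def IsDominated (x : X.scheme) (V : ValuationSubring X.K) : Prop :=
  ∀ a : X.scheme.presheaf.stalk x, algebraMap _ X.K a ∈ V ∧
    (a ∈ maximalIdeal (X.scheme.presheaf.stalk x) → algebraMap _ X.K a ≠ 0 →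
      (algebraMap _ X.K a)⁻¹ ∉ V)

/-- The square of the valuative criterion given by a valuation ring of the function field that
contains the constants. -/
def valuativeCommSq (V : ValuationSubring X.K) (hV : ∀ c : k, algebraMap k X.K c ∈ V) :
    ValuativeCommSq X.structureMap where
  R := V
  K := X.K
  i₁ := X.scheme.fromSpecStalk (genericPoint X.scheme)
  i₂ := Spec.map (CommRingCat.ofHom ((algebraMap k X.K).codRestrict V.toSubring hV))
  commSq := ⟨by
    rw [fromSpecStalk_structureMap, ← Spec.map_comp]
    congr 1⟩

variable {X}

theorem fromSpecStalk_genericPoint (x : X.scheme) :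
    Spec.map (CommRingCat.ofHom (algebraMap (X.scheme.presheaf.stalk x) X.K)) ≫
      X.scheme.fromSpecStalk x = X.scheme.fromSpecStalk (genericPoint X.scheme) :=
  Scheme.SpecMap_stalkSpecializes_fromSpecStalk ((genericPoint_spec X.scheme).specializes trivial)

/-- The existence half of the valuative criterion of properness. -/
theorem exists_isDominated {V : ValuationSubring X.K} (hV : ∀ c : k, algebraMap k X.K c ∈ V) :
    ∃ x, X.IsDominated x V := by
  have h : ValuativeCriterion.Existence X.structureMap := by
    have := X.isProper
    rw [IsProper.eq_valuativeCriterion] at this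
    exact this.1.1.1.existence
  obtain ⟨⟨l, hl₁, -⟩⟩ := h (X.valuativeCommSq V hV)
  let R : CommRingCat := .of V
  let l' : Spec R ⟶ X.scheme := l
  let φ := Scheme.stalkClosedPointTo l'
  have h1 : Spec.map φ ≫ X.scheme.fromSpecStalk _ = l' :=
    Scheme.Spec_stalkClosedPointTo_fromSpecStalk l'
  have h2 : Spec.map (CommRingCat.ofHom V.subtype) ≫ l' =
    X.scheme.fromSpecStalk (genericPoint X.scheme) := hl₁
  rw [← h1, ← Category.assoc, ← Spec.map_comp, ← fromSpecStalk_genericPoint, cancel_mono] at h2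
  have h3 := Spec.map_injective h2
  have h4 : ∀ a, (φ a : X.K) = algebraMap _ X.K a := fun a => by
    have := ConcreteCategory.congr_hom h3 a
    exact this
  refine ⟨_, fun a => ⟨h4 a ▸ (φ a).2, fun ha h0 hinv => ?_⟩⟩
  rw [IsLocalRing.mem_maximalIdeal, mem_nonunits_iff] at ha
  refine ha (isUnit_of_map_unit φ.hom a ?_)
  rw [← h4] at h0 hinv
  exact IsUnit.of_mul_eq_one ⟨_, hinv⟩ (Subtype.ext (mul_inv_cancel₀ h0))

/-- The uniqueness half of the valuative criterion: two points dominated by the same valuation ring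
give two lifts of the same square. -/
theorem IsDominated.eq {V : ValuationSubring X.K} (hV : ∀ c : k, algebraMap k X.K c ∈ V)
    {x y : X.scheme} (hx : X.IsDominated x V) (hy : X.IsDominated y V) : x = y := by
  have h := IsSeparated.valuativeCriterion X.structureMap (X.valuativeCommSq V hV)
  have key : ∀ {x : X.scheme}, X.IsDominated x V →
      ∃ l : (X.valuativeCommSq V hV).commSq.LiftStruct,
        l.l (closedPoint V) = x := by
    intro x hx
    let φ : X.scheme.presheaf.stalk x ⟶ CommRingCat.of V := CommRingCat.ofHom
      ((algebraMap (X.scheme.presheaf.stalk x) X.K).codRestrict V.toSubring fun a => (hx a).1)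
    have hφ : ∀ a, (φ a : X.K) = algebraMap _ X.K a := fun _ => rfl
    have hφl : IsLocalHom φ.hom := ⟨fun a ha => by
      by_contra hn
      have h0 : algebraMap _ X.K a ≠ 0 := fun h => ha.ne_zero (Subtype.ext h)
      refine (hx a).2 ((IsLocalRing.mem_maximalIdeal _).mpr hn) h0 ?_
      obtain ⟨b, hb⟩ := ha.exists_right_inv
      have h1 : algebraMap _ X.K a * b = 1 := congrArg Subtype.val hb
      rw [← eq_inv_of_mul_eq_one_right h1]
      exact b.2⟩
    refine ⟨⟨Spec.map φ ≫ X.scheme.fromSpecStalk x, ?_, ?_⟩, ?_⟩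
    · exact (Category.assoc _ _ _).symm.trans ((congrArg (· ≫ X.scheme.fromSpecStalk x)
        (Spec.map_comp _ _).symm).trans (fromSpecStalk_genericPoint x))
    · have h1 : CommRingCat.ofHom (X.toStalk x) ≫ φ =
          CommRingCat.ofHom ((algebraMap k X.K).codRestrict V.toSubring hV) :=
        CommRingCat.hom_ext (RingHom.ext fun c => Subtype.ext (X.algebraMap_toStalk x c))
      have h2 : (Spec.map φ ≫ X.scheme.fromSpecStalk x) ≫ X.structureMap =
          Spec.map (CommRingCat.ofHom ((algebraMap k X.K).codRestrict V.toSubring hV)) := by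
        rw [Category.assoc, fromSpecStalk_structureMap, ← Spec.map_comp, h1]
      exact h2
    · have h1 : (Spec.map φ ≫ X.scheme.fromSpecStalk x) (closedPoint V) = x := by
        have h2 : Spec.map φ (closedPoint V) = closedPoint (X.scheme.presheaf.stalk x) :=
          IsLocalRing.comap_closedPoint φ.hom
        exact (Scheme.Hom.comp_apply _ _ _).trans
          ((congrArg _ h2).trans Scheme.fromSpecStalk_closedPoint)
      exact h1
  obtain ⟨l₁, h₁⟩ := key hx
  obtain ⟨l₂, h₂⟩ := key hy
  rw [← h₁, ← h₂, Subsingleton.elim l₁ l₂]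

variable (X) in
theorem ord_inv (P : X.Point) {f : X.K} (hf : f ≠ 0) : X.ord P f⁻¹ = -X.ord P f := by
  have h := X.ord_mul P hf (inv_ne_zero hf)
  have h1 : X.ord P 1 = 0 := by simpa using X.ord_algebraMap P 1
  rw [mul_inv_cancel₀ hf, h1] at h
  omega

variable [IsAlgClosed k] (X)

/-- The local ring at a closed point is a discrete valuation ring, so a valuation ring that dominates
it is equal to it. -/
theorem isDominated_iff (P : X.Point) {V : ValuationSubring X.K} :
    X.IsDominated P.1 V ↔ ∀ f, f ∈ V ↔ 0 ≤ X.ord P f := by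
  constructor
  · intro h f
    constructor
    · intro hf
      by_contra! hlt
      have hf0 : f ≠ 0 := by
        rintro rfl
        simp [X.ord_zero] at hlt
      have h1 := X.ord_inv P hf0
      obtain ⟨a, ha⟩ := (X.zero_le_ord_iff P f⁻¹).mp (by omega)
      have ha0 : a ≠ 0 := by
        rintro rfl
        exact inv_ne_zero hf0 (by rw [← ha, map_zero])
      refine (h a).2 ((IsLocalRing.mem_maximalIdeal _).mpr fun hu => ?_) (ha ▸ inv_ne_zero hf0)
        (by rwa [ha, inv_inv])
      rw [X.isUnit_iff_ord_eq_zero P ha0, ha] at hu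
      omega
    · intro hf
      obtain ⟨a, rfl⟩ := (X.zero_le_ord_iff P f).mp hf
      exact (h a).1
  · refine fun h a => ⟨(h _).mpr ((X.zero_le_ord_iff P _).mpr ⟨a, rfl⟩), fun ha h0 hinv => ?_⟩
    rw [h, X.ord_inv P h0] at hinv
    have h1 := (X.zero_le_ord_iff P (algebraMap _ X.K a)).mpr ⟨a, rfl⟩
    have ha0 : a ≠ 0 := by
      rintro rfl
      exact h0 (map_zero _)
    exact ha ((X.isUnit_iff_ord_eq_zero P ha0).mpr (by omega))

/-- Every proper valuation ring of the function field that contains the constants is the local ring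
at a closed point. The point it dominates is closed because it is not the generic point, whose
local ring is the whole function field. -/
theorem exists_point_of_valuationSubring (V : ValuationSubring X.K)
    (hV : ∀ c : k, algebraMap k X.K c ∈ V) (hVt : V ≠ ⊤) : ∃ P, ∀ f, f ∈ V ↔ 0 ≤ X.ord P f := by
  obtain ⟨x, hx⟩ := exists_isDominated hV
  have h : x ≠ genericPoint X.scheme := by
    rintro rfl
    refine hVt (top_le_iff.mp fun f _ => ?_)
    have h1 : @algebraMap _ X.K _ _ (stalkFunctionFieldAlgebra X.scheme (genericPoint X.scheme)) f =
        f := by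
      obtain ⟨U, hU, g, rfl⟩ := X.scheme.presheaf.exists_germ_eq f
      have : Nonempty U := ⟨⟨_, hU⟩⟩
      exact Scheme.algebraMap_germ_eq_germToFunctionField (X := X.scheme) hU g
    rw [← h1]
    exact (hx f).1
  exact ⟨⟨x, X.isClosed_of_ne x h⟩, (X.isDominated_iff ⟨x, _⟩).mp hx⟩

/-- A closed point is determined by its local ring, since the curve is separated. -/
theorem point_eq (P Q : X.Point) (h : ∀ f, 0 ≤ X.ord P f ↔ 0 ≤ X.ord Q f) : P = Q := by
  let V : ValuationSubring X.K :=
    { (algebraMap (X.scheme.presheaf.stalk P.1) X.K).range with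
      mem_or_inv_mem' := fun f => by
        by_cases hf : f = 0
        · exact Or.inl (hf ▸ zero_mem (algebraMap (X.scheme.presheaf.stalk P.1) X.K).range)
        have h1 := X.ord_inv P hf
        rcases le_total 0 (X.ord P f) with h2 | h2
        · exact Or.inl ((X.zero_le_ord_iff P f).mp h2)
        · exact Or.inr ((X.zero_le_ord_iff P f⁻¹).mp (by omega)) }
  have hV : ∀ f, f ∈ V ↔ 0 ≤ X.ord P f := fun f => (X.zero_le_ord_iff P f).symm
  refine Subtype.ext (IsDominated.eq (V := V) (fun c => (hV _).mpr (X.ord_algebraMap P c).ge)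
    ((X.isDominated_iff P).mpr hV) ((X.isDominated_iff Q).mpr fun f => (hV f).trans (h f)))

end SmoothCurve

namespace SmoothCurve

variable {k : Type u} [Field k] (X : SmoothCurve k)

/-! ### The places of a curve -/

/-- The constants as functions on an open subset. -/
def toSection (U : X.scheme.Opens) : k →+* Γ(X.scheme, U) :=
  (X.scheme.presheaf.map (homOfLE le_top).op).hom.comp X.constants

theorem algebraMap_toSection (U : X.scheme.Opens) [Nonempty U] (c : k) :
    algebraMap Γ(X.scheme, U) X.K (X.toSection U c) = algebraMap k X.K c := by
  change X.scheme.germToFunctionField U (X.scheme.presheaf.map (homOfLE le_top).op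
    (X.constants c)) = X.scheme.germToFunctionField ⊤ (X.constants c)
  exact X.scheme.presheaf.germ_res_apply (homOfLE le_top) (genericPoint X.scheme) _ (X.constants c)

theorem exists_isStandardSmooth (x : X.scheme) : ∃ U : X.scheme.Opens, IsAffineOpen U ∧ x ∈ U ∧
    RingHom.IsStandardSmoothOfRelativeDimension 1 (X.toSection U) := by
  obtain ⟨W, hW, U, hU, hxU, e, hs⟩ :=
    SmoothOfRelativeDimension.exists_isStandardSmoothOfRelativeDimension (n := 1)
      (f := X.structureMap) x
  obtain rfl : W = ⊤ := top_le_iff.mp fun y _ => by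
    rw [Subsingleton.elim y (X.structureMap x)]; exact e hxU
  refine ⟨U, hU, hxU, ?_⟩
  have h := hs.comp (RingHom.IsStandardSmoothOfRelativeDimension.equiv
    (Scheme.ΓSpecIso (.of k)).symm.commRingCatIsoToRingEquiv)
  exact h

/-- The curve has standard smooth charts of relative dimension one, on which the differentials are
free of rank one; the function field is a localization of their coordinate rings. -/
theorem finrank_kaehler : Module.finrank X.K (Ω[X.K⁄k]) = 1 := by
  obtain ⟨U, hU, hx, h⟩ := X.exists_isStandardSmooth (genericPoint X.scheme)
  have : Nonempty U := ⟨⟨_, hx⟩⟩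
  algebraize [X.toSection U]
  have := functionField_isFractionRing_of_isAffineOpen X.scheme U hU
  have : IsScalarTower k Γ(X.scheme, U) X.K :=
    .of_algebraMap_eq fun c => (X.algebraMap_toSection U c).symm
  have : Algebra.IsStandardSmooth k Γ(X.scheme, U) :=
    Algebra.IsStandardSmoothOfRelativeDimension.isStandardSmooth 1
  have : Algebra.FormallyEtale Γ(X.scheme, U) X.K :=
    Algebra.FormallyEtale.of_isLocalization (nonZeroDivisors Γ(X.scheme, U))
  have e := KaehlerDifferential.tensorKaehlerEquivOfFormallyEtale k Γ(X.scheme, U) X.K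
  rw [← e.finrank_eq, Module.finrank_baseChange]
  have := Algebra.IsStandardSmoothOfRelativeDimension.rank_kaehlerDifferential (R := k)
    (S := Γ(X.scheme, U)) 1
  exact Module.finrank_eq_of_rank_eq (by simpa using this)

variable [IsAlgClosed k]

/-- Near `x` the local rings of closed points are localizations of one finitely generated algebra,
the coordinate ring of an affine chart. -/
theorem exists_local_generators (x : X.scheme) : ∃ U : X.scheme.Opens, x ∈ U ∧ ∃ T : Finset X.K,
    ∀ P : X.Point, P.1 ∈ U → (∀ a ∈ T, 0 ≤ X.ord P a) ∧ ∀ f, 0 ≤ X.ord P f →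
      ∃ a ∈ Algebra.adjoin k (T : Set X.K), ∃ b ∈ Algebra.adjoin k (T : Set X.K),
        b ≠ 0 ∧ X.ord P b = 0 ∧ f = a / b := by
  classical
  obtain ⟨U, hU, hx, h⟩ := X.exists_isStandardSmooth x
  have : Nonempty U := ⟨⟨_, hx⟩⟩
  algebraize [X.toSection U]
  have : IsScalarTower k Γ(X.scheme, U) X.K :=
    .of_algebraMap_eq fun c => (X.algebraMap_toSection U c).symm
  have : Algebra.IsStandardSmooth k Γ(X.scheme, U) :=
    Algebra.IsStandardSmoothOfRelativeDimension.isStandardSmooth 1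
  have : Algebra.FiniteType k Γ(X.scheme, U) := inferInstance
  obtain ⟨s, hs⟩ := this.out
  refine ⟨U, hx, s.image (algebraMap Γ(X.scheme, U) X.K), fun P hP => ?_⟩
  have hmem : ∀ a : Γ(X.scheme, U), algebraMap Γ(X.scheme, U) X.K a ∈
      Algebra.adjoin k (s.image (algebraMap Γ(X.scheme, U) X.K) : Set X.K) := fun a => by
    have h1 := (Algebra.adjoin k (s : Set Γ(X.scheme, U))).mem_map (f := IsScalarTower.toAlgHom k Γ(X.scheme, U) X.K)
      (y := algebraMap Γ(X.scheme, U) X.K a) |>.mpr ⟨a, hs ▸ trivial, rfl⟩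
    rw [AlgHom.map_adjoin] at h1
    rw [Finset.coe_image]
    exact h1
  let := TopCat.Presheaf.algebra_section_stalk X.scheme.presheaf (⟨P.1, hP⟩ : U)
  have hloc := hU.isLocalization_stalk ⟨P.1, hP⟩
  have htower := functionField_isScalarTower X.scheme U ⟨P.1, hP⟩
  have halg : ∀ a : Γ(X.scheme, U), algebraMap (X.scheme.presheaf.stalk P.1) X.K
      (algebraMap Γ(X.scheme, U) (X.scheme.presheaf.stalk P.1) a) =
        algebraMap Γ(X.scheme, U) X.K a :=
    fun a => (IsScalarTower.algebraMap_apply Γ(X.scheme, U) (X.scheme.presheaf.stalk P.1) X.K a).symm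
  constructor
  · intro b hb
    obtain ⟨a, -, rfl⟩ := Finset.mem_image.mp hb
    exact (X.zero_le_ord_iff P _).mpr ⟨_, halg a⟩
  · intro f hf
    obtain ⟨g, rfl⟩ := (X.zero_le_ord_iff P f).mp hf
    obtain ⟨a, b, hab⟩ := IsLocalization.exists_mk'_eq
      (hU.primeIdealOf ⟨P.1, hP⟩).asIdeal.primeCompl g
    have hb := IsLocalization.map_units (X.scheme.presheaf.stalk P.1) b
    have hb0 : algebraMap Γ(X.scheme, U) X.K b ≠ 0 := by
      rw [← halg]
      exact (hb.map (algebraMap _ X.K)).ne_zero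
    refine ⟨_, hmem a, _, hmem b, hb0, ?_, ?_⟩
    · rw [← halg]
      exact (X.isUnit_iff_ord_eq_zero P hb.ne_zero).mp hb
    · rw [eq_div_iff hb0, ← halg, ← halg, ← map_mul, ← hab, IsLocalization.mk'_spec]

/-- The closed points of a curve are the places of its function field. -/
def placeSystem : PlaceSystem k X.K X.Point where
  ord := X.ord
  ord_zero := X.ord_zero
  ord_mul P _ _ := X.ord_mul P
  ord_add P _ _ := X.ord_add P
  ord_algebraMap := X.ord_algebraMap
  exists_uniformizer := X.exists_ord_eq_one
  exists_residue P _ := X.exists_residue P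
  finite_support := X.finite_support
  complete := X.exists_point_of_valuationSubring
  separated := X.point_eq
  generators := by
    classical
    choose U hxU T hT using X.exists_local_generators
    obtain ⟨t, -, ht⟩ := isCompact_univ.elim_nhds_subcover (fun x => (U x : Set X.scheme))
      fun x _ => (U x).isOpen.mem_nhds (hxU x)
    refine ⟨t.image T, fun P => ?_⟩
    obtain ⟨x, hx, hPx⟩ := Set.mem_iUnion₂.mp (ht (Set.mem_univ P.1))
    exact ⟨T x, Finset.mem_image_of_mem T hx, hT x P hPx⟩
  finrank_kaehler := X.finrank_kaehler

end SmoothCurve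

/-! ### Functions and coverings -/

/-- A function field has infinitely many places. -/
theorem PlaceSystem.infinite {k K ι : Type*} [Field k] [Field K] [Algebra k K] [IsAlgClosed k]
    [CharZero k] (𝒮 : PlaceSystem k K ι) : Infinite ι := by
  obtain ⟨x, hDx⟩ := 𝒮.exists_D_ne_zero
  have hx : x ∉ (algebraMap k K).range := by
    rintro ⟨c, rfl⟩
    simp at hDx
  have h : ∀ a : k, ∃ P, 0 < 𝒮.ord P (x - algebraMap k K a) := fun a =>
    (𝒮.isParameter_sub hx a).exists_pos
  choose P hP using h
  have := IsAlgClosed.instInfinite (K := k)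
  refine Infinite.of_injective P fun a b hab => ?_
  by_contra hne
  have h1 : x - algebraMap k K a ∈ 𝒮.sect (P a) (-1) := self_mem_sect _ _ (by have := hP a; omega)
  have h2 : x - algebraMap k K b ∈ 𝒮.sect (P a) (-1) :=
    self_mem_sect _ _ (by have := hab ▸ hP b; omega)
  have h3 := sub_mem h1 h2
  rw [sub_sub_sub_cancel_left, ← map_sub, mem_sect_of_ne ((map_ne_zero _).mpr
    (sub_ne_zero.mpr (Ne.symm hne))), 𝒮.ord_algebraMap] at h3
  omega

namespace Covering

variable {k : Type u} [Field k] {X Y : SmoothCurve k} (φ : Covering X Y)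

theorem app_constants (c : k) : φ.hom.appTop (Y.constants c) = X.constants c := by
  have h := congrArg (fun f => Scheme.Hom.appTop f) φ.isOver
  rw [Scheme.Hom.comp_appTop] at h
  exact ConcreteCategory.congr_hom h _

section Dominant

variable [IsAlgClosed k] [CharZero k]

/-- A covering is dominant: otherwise the curve `X`, which has infinitely many points, would be
contained in one fibre of a finite morphism. -/
theorem hom_genericPoint : φ.hom (genericPoint X.scheme) = genericPoint Y.scheme := by
  by_contra hne
  have hcl := Y.isClosed_of_ne _ hne
  have h1 : ∀ x : X.scheme, φ.hom x = φ.hom (genericPoint X.scheme) := fun x => by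
    have h2 := ((genericPoint_spec X.scheme).specializes (Set.mem_univ x)).map φ.hom.continuous
    exact (h2.mem_closed hcl rfl)
  have h2 := φ.hom.finite_preimage_singleton (φ.hom (genericPoint X.scheme))
  have h3 : (Set.univ : Set X.scheme).Finite := h2.subset fun x _ => h1 x
  have h4 : Finite X.scheme := Set.finite_univ_iff.mp h3
  have := X.placeSystem.infinite
  exact not_finite X.Point

/-- The pullback of rational functions. -/
def pullbackFun : Y.K →+* X.K :=
  (Y.scheme.presheaf.stalkSpecializes (specializes_of_eq φ.hom_genericPoint) ≫
    φ.hom.stalkMap (genericPoint X.scheme)).hom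

theorem pullbackFun_algebraMap_stalk (P : X.Point) (a : Y.scheme.presheaf.stalk (φ.onPoints P).1) :
    φ.pullbackFun (algebraMap _ Y.K a) = algebraMap (X.scheme.presheaf.stalk P.1) X.K
      (φ.hom.stalkMap P.1 a) := by
  have h := Scheme.Hom.stalkSpecializes_stalkMap φ.hom (genericPoint X.scheme) P.1
    ((genericPoint_spec X.scheme).specializes trivial)
  have h1 := TopCat.Presheaf.stalkSpecializes_comp Y.scheme.presheaf
    (specializes_of_eq φ.hom_genericPoint)
    ((genericPoint_spec Y.scheme).specializes (Set.mem_univ (φ.hom P.1)))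
  rw [← h1, Category.assoc] at h
  exact ConcreteCategory.congr_hom h a

theorem pullbackFun_algebraMap (c : k) :
    φ.pullbackFun (algebraMap k Y.K c) = algebraMap k X.K c := by
  have h1 : Y.scheme.presheaf.stalkSpecializes (specializes_of_eq φ.hom_genericPoint)
      (algebraMap k Y.K c) = Y.scheme.presheaf.germ ⊤ (φ.hom (genericPoint X.scheme)) trivial
        (Y.constants c) :=
    TopCat.Presheaf.germ_stalkSpecializes_apply ..
  change φ.hom.stalkMap (genericPoint X.scheme) (Y.scheme.presheaf.stalkSpecializes
    (specializes_of_eq φ.hom_genericPoint) (algebraMap k Y.K c)) = _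
  rw [h1]
  refine (Scheme.Hom.germ_stalkMap_apply φ.hom ⊤ (genericPoint X.scheme) trivial
    (Y.constants c)).trans ?_
  exact congrArg (X.scheme.presheaf.germ ⊤ (genericPoint X.scheme) trivial) (φ.app_constants c)

theorem pullbackFun_ne_zero {h : Y.K} (hh : h ≠ 0) : φ.pullbackFun h ≠ 0 :=
  (map_ne_zero φ.pullbackFun).mpr hh

/-- The pullback of a uniformizer at the image of `P` has the ramification index as its order. The
index is positive as the homomorphism of local rings is local. -/
theorem exists_ord_eq_ramification (P : X.Point) : ∃ t : Y.K, Y.ord (φ.onPoints P) t = 1 ∧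
    X.ord P (φ.pullbackFun t) = φ.ramification P ∧ 0 < φ.ramification P := by
  let alg : Algebra (Y.scheme.presheaf.stalk (φ.onPoints P).1) (X.scheme.presheaf.stalk P.1) :=
    (φ.hom.stalkMap P.1).hom.toAlgebra
  have halg : ∀ a, algebraMap (Y.scheme.presheaf.stalk (φ.onPoints P).1)
    (X.scheme.presheaf.stalk P.1) a = φ.hom.stalkMap P.1 a := fun _ => rfl
  obtain ⟨ϖ, hϖ⟩ := IsDiscreteValuationRing.exists_irreducible
    (Y.scheme.presheaf.stalk (φ.onPoints P).1)
  obtain ⟨ϖ', hϖ'⟩ := IsDiscreteValuationRing.exists_irreducible (X.scheme.presheaf.stalk P.1)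
  have hinj := IsFractionRing.injective (Y.scheme.presheaf.stalk (φ.onPoints P).1) Y.K
  have hinj' := IsFractionRing.injective (X.scheme.presheaf.stalk P.1) X.K
  have h0 : algebraMap _ Y.K ϖ ≠ 0 := (map_ne_zero_iff _ hinj).mpr hϖ.ne_zero
  have h0' : algebraMap _ X.K ϖ' ≠ 0 := (map_ne_zero_iff _ hinj').mpr hϖ'.ne_zero
  have hord' : X.ord P (algebraMap _ X.K ϖ') = 1 :=
    (X.ord_eq_iff P h0' 1).mpr (Ring.ordFrac_irreducible hϖ')
  have hψ := φ.pullbackFun_algebraMap_stalk P ϖ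
  have hψ0 : algebraMap (Y.scheme.presheaf.stalk (φ.onPoints P).1)
      (X.scheme.presheaf.stalk P.1) ϖ ≠ 0 := fun h => by
    rw [← halg, h, map_zero] at hψ
    exact φ.pullbackFun_ne_zero h0 hψ
  obtain ⟨e, he⟩ := IsDiscreteValuationRing.associated_pow_irreducible hψ0 hϖ'
  have hmap : (maximalIdeal (Y.scheme.presheaf.stalk (φ.onPoints P).1)).map
      (algebraMap (Y.scheme.presheaf.stalk (φ.onPoints P).1) (X.scheme.presheaf.stalk P.1)) =
        maximalIdeal (X.scheme.presheaf.stalk P.1) ^ e := by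
    rw [hϖ.maximalIdeal_eq, hϖ'.maximalIdeal_eq, Ideal.map_span, Set.image_singleton,
      Ideal.span_singleton_pow]
    exact Ideal.span_singleton_eq_span_singleton.mpr he
  have hram : φ.ramification P = e := by
    refine Ideal.ramificationIdx'_spec (p := maximalIdeal (Y.scheme.presheaf.stalk (φ.onPoints P).1))
      hmap.le fun h => ?_
    rw [hmap] at h
    have := (hϖ'.maximalIdeal_eq ▸ h : (Ideal.span {ϖ'} ^ e ≤ Ideal.span {ϖ'} ^ (e + 1)))
    rw [Ideal.span_singleton_pow, Ideal.span_singleton_pow, Ideal.span_singleton_le_span_singleton,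
      pow_dvd_pow_iff hϖ'.ne_zero hϖ'.not_isUnit] at this
    omega
  have hord : X.ord P (φ.pullbackFun (algebraMap _ Y.K ϖ)) = e := by
    obtain ⟨u, hu⟩ := he
    have h1 : φ.pullbackFun (algebraMap _ Y.K ϖ) * algebraMap _ X.K (u : X.scheme.presheaf.stalk P.1)
        = algebraMap _ X.K ϖ' ^ e := by
      rw [hψ, ← halg, ← map_mul, hu, map_pow]
    have h2 := X.ord_mul P (φ.pullbackFun_ne_zero h0) ((u.isUnit.map (algebraMap _ X.K)).ne_zero)
    rw [h1, (X.isUnit_iff_ord_eq_zero P u.ne_zero).mp u.isUnit, add_zero] at h2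
    have h3 := X.placeSystem.ord_pow P (algebraMap _ X.K ϖ') e
    change X.ord P _ = _ * X.ord P _ at h3
    rw [← h2, h3, hord', mul_one]
  refine ⟨algebraMap _ Y.K ϖ, (Y.ord_eq_iff _ h0 1).mpr (Ring.ordFrac_irreducible hϖ), ?_, ?_⟩
  · rw [hord, hram]
  · rw [hram]
    by_contra hn
    obtain rfl : e = 0 := by omega
    rw [pow_zero] at he
    have h1 : IsUnit (φ.hom.stalkMap P.1 ϖ) := (associated_one_iff_isUnit.mp he)
    have hl : IsLocalHom (φ.hom.stalkMap P.1).hom := inferInstance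
    exact hϖ.not_isUnit (hl.map_nonunit ϖ h1)

/-- The order of a pulled back function is multiplied by the ramification index. -/
theorem ord_pullbackFun (P : X.Point) (h : Y.K) :
    X.ord P (φ.pullbackFun h) = φ.ramification P * Y.ord (φ.onPoints P) h := by
  by_cases hh : h = 0
  · simp [hh, X.ord_zero, Y.ord_zero]
  obtain ⟨t, ht, htr, -⟩ := φ.exists_ord_eq_ramification P
  have ht0 : t ≠ 0 := by
    rintro rfl
    simp [Y.ord_zero] at ht
  set m := Y.ord (φ.onPoints P) h with hm
  have hw0 : h / t ^ m ≠ 0 := div_ne_zero hh (zpow_ne_zero m ht0)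
  have hw : Y.ord (φ.onPoints P) (h / t ^ m) = 0 := by
    have h1 := Y.placeSystem.ord_div (φ.onPoints P) hh (zpow_ne_zero m ht0)
    rw [Y.placeSystem.ord_zpow] at h1
    change Y.ord _ _ = Y.ord _ _ - m * Y.ord _ t at h1
    rw [h1, ht, mul_one, ← hm, sub_self]
  have hw' : X.ord P (φ.pullbackFun (h / t ^ m)) = 0 := by
    obtain ⟨a, ha⟩ := (Y.zero_le_ord_iff _ _).mp hw.ge
    have ha0 : a ≠ 0 := by
      rintro rfl
      exact hw0 (by rw [← ha, map_zero])
    have hu : IsUnit a := (Y.isUnit_iff_ord_eq_zero _ ha0).mpr (by rw [ha, hw])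
    have hu' : IsUnit (φ.hom.stalkMap P.1 a) := hu.map (φ.hom.stalkMap P.1).hom
    rw [← ha, φ.pullbackFun_algebraMap_stalk]
    exact (X.isUnit_iff_ord_eq_zero P hu'.ne_zero).mp hu'
  have h2 := X.placeSystem.ord_mul P (φ.pullbackFun_ne_zero (zpow_ne_zero m ht0))
    (φ.pullbackFun_ne_zero hw0)
  rw [← map_mul, mul_div_cancel₀ _ (zpow_ne_zero m ht0), map_zpow₀, X.placeSystem.ord_zpow] at h2
  change X.ord P _ = m * X.ord P _ + X.ord P _ at h2
  rw [h2, hw', htr, add_zero, mul_comm]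

theorem ramification_pos (P : X.Point) : 0 < φ.ramification P := by
  obtain ⟨-, -, -, h⟩ := φ.exists_ord_eq_ramification P
  exact h

end Dominant

end Covering

namespace Covering

variable {k : Type u} [Field k] [IsAlgClosed k] [CharZero k] {X Y : SmoothCurve k}
  (φ : Covering X Y)

/-! ### Fibres of coverings -/

theorem pullbackFun_notMem_range {x : Y.K} (hx : x ∉ (algebraMap k Y.K).range) :
    φ.pullbackFun x ∉ (algebraMap k X.K).range := by
  rintro ⟨c, hc⟩
  rw [← φ.pullbackFun_algebraMap] at hc
  exact hx ⟨c, φ.pullbackFun.injective hc⟩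

/-- The function field of `X` is finite over that of `Y`, since it is finite over `k(x)` for a
nonconstant function `x` on `Y`. -/
theorem finite_pullbackFun : φ.pullbackFun.Finite := by
  algebraize [φ.pullbackFun]
  obtain ⟨x, hDx⟩ := Y.placeSystem.exists_D_ne_zero
  have hx : x ∉ (algebraMap k Y.K).range := by
    rintro ⟨c, rfl⟩
    simp at hDx
  have := X.placeSystem.finiteDimensional_adjoin (φ.pullbackFun_notMem_range hx)
  have htower : IsScalarTower k Y.K X.K := .of_algebraMap_eq fun c => (φ.pullbackFun_algebraMap c).symm
  let L : IntermediateField k X.K := (IsScalarTower.toAlgHom k Y.K X.K).fieldRange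
  have hle : IntermediateField.adjoin k {φ.pullbackFun x} ≤ L := by
    rw [IntermediateField.adjoin_simple_le_iff]
    exact ⟨x, rfl⟩
  obtain ⟨s, hs⟩ := this.fg_top
  refine ⟨⟨s, top_le_iff.mp fun f _ => ?_⟩⟩
  have hf : f ∈ Submodule.span (IntermediateField.adjoin k {φ.pullbackFun x}) (s : Set X.K) :=
    hs ▸ trivial
  induction hf using Submodule.span_induction with
  | mem y hy => exact Submodule.subset_span hy
  | zero => exact zero_mem _
  | add y z _ _ hy hz => exact add_mem (hy trivial) (hz trivial)
  | smul c y _ hy =>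
    obtain ⟨d, hd⟩ := hle c.2
    have : c • y = d • y := by
      rw [Algebra.smul_def, Algebra.smul_def]
      exact congrArg (· * y) hd.symm
    rw [this]
    exact Submodule.smul_mem _ _ (hy trivial)

/-- The degree of the covering, defined with the stalk of `Y` at the image of the generic point of
`X`, is the degree of the extension of function fields. -/
theorem degree_eq : φ.degree = @Module.finrank Y.K X.K _ _ φ.pullbackFun.toModule := by
  let : Algebra (Y.scheme.presheaf.stalk (φ.hom (genericPoint X.scheme))) X.K :=
    (φ.hom.stalkMap (genericPoint X.scheme)).hom.toAlgebra
  let : Algebra Y.K X.K := φ.pullbackFun.toAlgebra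
  let i : Y.K ≃+* Y.scheme.presheaf.stalk (φ.hom (genericPoint X.scheme)) :=
    (Y.scheme.presheaf.stalkCongr (.of_eq φ.hom_genericPoint)).symm.commRingCatIsoToRingEquiv
  exact (Algebra.finrank_eq_of_equiv_equiv i (RingEquiv.refl X.K) (by
    ext h
    rfl)).symm

theorem onPoints_surjective : Function.Surjective φ.onPoints := by
  intro Q
  have h1 : Set.range φ.hom = Set.univ := by
    refine Set.eq_univ_of_univ_subset ?_
    rw [← (genericPoint_spec Y.scheme).def]
    refine closure_minimal ?_ φ.hom.isClosedMap.isClosed_range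
    rintro _ rfl
    exact ⟨_, φ.hom_genericPoint⟩
  obtain ⟨x, hx⟩ : Q.1 ∈ Set.range φ.hom := h1 ▸ trivial
  have hne : x ≠ genericPoint X.scheme := by
    rintro rfl
    rw [φ.hom_genericPoint] at hx
    exact Y.point_ne_genericPoint Q hx.symm
  exact ⟨⟨x, X.isClosed_of_ne x hne⟩, Subtype.ext hx⟩

/-- The fibre over `Q` has `n` points, counted with multiplicity. -/
theorem sum_ramification (Q : Y.Point) (S : Finset X.Point) (hS : ∀ P, P ∈ S ↔ φ.onPoints P = Q) :
    ∑ P ∈ S, φ.ramification P = φ.degree := by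
  algebraize [φ.pullbackFun]
  have : FiniteDimensional Y.K X.K := φ.finite_pullbackFun
  have htower : IsScalarTower k Y.K X.K := .of_algebraMap_eq fun c => (φ.pullbackFun_algebraMap c).symm
  have halg : ∀ h, algebraMap Y.K X.K h = φ.pullbackFun h := fun _ => rfl
  obtain ⟨P₀, rfl⟩ := φ.onPoints_surjective Q
  obtain ⟨t, ht⟩ := Y.exists_ord_eq_one (φ.onPoints P₀)
  have hord : ∀ P h, X.placeSystem.ord P (algebraMap Y.K X.K h) =
      φ.ramification P * Y.ord (φ.onPoints P) h := φ.ord_pullbackFun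
  have hram : ∀ P, 0 < (φ.ramification P : ℤ) := fun P => by exact_mod_cast φ.ramification_pos P
  have hπ : X.placeSystem.IsUniformizerBelow P₀ t := by
    refine ⟨?_, fun f _ => ?_⟩
    · rw [hord, ht, mul_one]
      exact hram P₀
    · rw [hord, hord, ht, mul_one]
      exact dvd_mul_right _ _
  have hbelow : ∀ P, X.placeSystem.below Y.K P₀ ≤ X.placeSystem.below Y.K P ↔
      φ.onPoints P = φ.onPoints P₀ := fun P => by
    have hmem : ∀ P h, h ∈ X.placeSystem.below Y.K P ↔ 0 ≤ Y.ord (φ.onPoints P) h := fun P h => by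
      rw [PlaceSystem.mem_below, hord, mul_nonneg_iff_of_pos_left (hram P)]
    constructor
    · intro h
      refine (PlaceSystem.eq_of_valRing_le_valRing (𝒮 := Y.placeSystem) fun f hf => ?_).symm
      exact (hmem P f).mp (h ((hmem P₀ f).mpr (PlaceSystem.mem_valRing.mp hf))) |> PlaceSystem.mem_valRing.mpr
    · intro h f hf
      rw [hmem] at hf ⊢
      rwa [h]
  have h1 := hπ.sum_ord_fibre (k := k)
  have h2 : S = hπ.finite_fibre.toFinset := by
    ext P
    rw [hS, Set.Finite.mem_toFinset, Set.mem_ofPred_eq, hbelow]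
  rw [← h2, Finset.sum_congr rfl fun P hP => by rw [hord, (hS P).mp hP, ht, mul_one]] at h1
  rw [φ.degree_eq]
  exact_mod_cast h1

end Covering

/-! ### Degrees of divisors -/

namespace SmoothCurve

section Degree

variable {k : Type u} [Field k] (X : SmoothCurve k)

/-- The degree of divisors as a homomorphism. -/
def degHom : X.Divisor →+ ℤ := Finsupp.liftAddHom fun _ => AddMonoidHom.id ℤ

theorem degHom_apply (D : X.Divisor) : X.degHom D = X.deg D := rfl

theorem deg_add (D E : X.Divisor) : X.deg (D + E) = X.deg D + X.deg E := map_add X.degHom D E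

theorem deg_sub (D E : X.Divisor) : X.deg (D - E) = X.deg D - X.deg E := map_sub X.degHom D E

theorem deg_sum_zsmul {α : Type*} (s : Finset α) (m : α → ℤ) (D : α → X.Divisor) :
    X.deg (∑ a ∈ s, m a • D a) = ∑ a ∈ s, m a * X.deg (D a) := by
  simp only [← degHom_apply, map_sum, map_zsmul, smul_eq_mul]

theorem deg_nonneg {D : X.Divisor} (hD : 0 ≤ D) : 0 ≤ X.deg D :=
  Finset.sum_nonneg fun P _ => hD P

theorem deg_mono {D E : X.Divisor} (h : D ≤ E) : X.deg D ≤ X.deg E := by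
  have h1 := X.deg_nonneg (sub_nonneg.mpr h)
  rw [deg_sub] at h1
  omega

theorem deg_eq_sum (D : X.Divisor) (S : Finset X.Point) (hS : D.support ⊆ S) :
    X.deg D = ∑ P ∈ S, D P :=
  Finsupp.sum_of_support_subset D hS _ fun _ _ => rfl

variable {X}

theorem eq_zero_of_inf_eq_zero {D E : X.Divisor} (h : D ⊓ E = 0) (P : X.Point) :
    min (D P) (E P) = 0 := by
  have := DFunLike.congr_fun h P
  simpa using this

end Degree

section Principal

variable {k : Type u} [Field k] [IsAlgClosed k] (X : SmoothCurve k)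

/-- The divisor of a rational function, with value `0` at the function `0`. -/
def div (f : X.K) : X.Divisor := Finsupp.ofSupportFinite (fun P => X.ord P f) (by
  by_cases hf : f = 0
  · convert Set.finite_empty
    ext P
    simp [hf, X.ord_zero]
  · exact X.finite_support hf)

theorem div_apply (f : X.K) (P : X.Point) : X.div f P = X.ord P f := rfl

theorem mem_H0 {D : X.Divisor} {f : X.K} : f ∈ X.H0 D ↔ ∀ P, f = 0 ∨ 0 ≤ X.ord P f + D P :=
  Submodule.mem_iInf _

theorem finiteDimensional_H0 (D : X.Divisor) : FiniteDimensional k (X.H0 D) :=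
  X.placeSystem.finiteDimensional_sections D

theorem ord_one (P : X.Point) : X.ord P 1 = 0 := X.placeSystem.ord_one P

theorem one_mem_H0 {D : X.Divisor} (hD : 0 ≤ D) : 1 ∈ X.H0 D :=
  X.mem_H0.mpr fun P => Or.inr (by rw [X.ord_one, zero_add]; exact hD P)

variable {X}

/-- The sections of `𝒪(D)` are constant if `D` is effective with `h⁰ = 1`. -/
theorem exists_const_of_mem_H0 {D : X.Divisor} (hD : 0 ≤ D) (h : X.h0 D = 1) {f : X.K}
    (hf : f ∈ X.H0 D) : ∃ c : k, algebraMap k X.K c = f := by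
  obtain ⟨c, hc⟩ := (finrank_eq_one_iff_of_nonzero' (⟨1, X.one_mem_H0 hD⟩ : X.H0 D)
    fun h => one_ne_zero (congrArg Subtype.val h)).mp h ⟨f, hf⟩
  refine ⟨c, ?_⟩
  rw [Algebra.algebraMap_eq_smul_one]
  exact congrArg Subtype.val hc

variable [CharZero k]

theorem deg_div {f : X.K} (hf : f ≠ 0) : X.deg (X.div f) = 0 := by
  rw [X.deg_eq_sum _ (X.finite_support hf).toFinset fun P hP => by simpa [div_apply] using hP]
  exact X.placeSystem.sum_ord_eq_zero hf

/-- A line bundle with a presentation is nonspecial: by duality it suffices that `𝒪(D - E)` has no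
sections, and they are constants that vanish at the points of `E`, which are not points of `D`. -/
theorem nonspecial_of_isPresentation {L D E : X.Divisor} (h : X.IsPresentation L D E) :
    X.Nonspecial L := by
  obtain ⟨hD, hD1, hE, hDE, W, hW, f, hf, hfL⟩ := h
  have hcan : X.placeSystem.IsCanonical W := hW
  have hW' := hcan.of_ord_eq_sub (W' := W + X.div f) hf fun P => by
    rw [Finsupp.add_apply, add_sub_cancel_left]
    rfl
  have hH0 : ∀ s, (∀ P, s ∈ X.placeSystem.sect P ((D - E) P)) → s = 0 := by
    intro s hs
    have h1 : s ∈ X.H0 D := X.mem_H0.mpr fun P =>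
      PlaceSystem.sect_mono P (by
        rw [Finsupp.sub_apply]
        have := hE.le P
        rw [Finsupp.zero_apply] at this
        omega) (hs P)
    obtain ⟨c, rfl⟩ := exists_const_of_mem_H0 hD hD1 h1
    by_contra hc
    obtain ⟨P, hP⟩ : ∃ P, 0 < E P := by
      by_contra! h2
      exact hE.not_ge fun P => h2 P
    have h3 := (hs P).resolve_left hc
    have h4 := eq_zero_of_inf_eq_zero hDE P
    rw [X.placeSystem.ord_algebraMap, Finsupp.sub_apply] at h3
    omega
  refine Submodule.Quotient.subsingleton_iff.mpr (Submodule.eq_top_iff'.mpr fun α => ?_)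
  obtain ⟨s, hs⟩ := hW'.exists_sub_mem_sect hH0 (α := α.1) α.2
  refine Submodule.mem_sup.mpr ⟨fun P => α.1 P - s, fun P _ => ?_, fun _ => s, ⟨s, rfl⟩, ?_⟩
  · have h1 := hfL P
    have h2 : L P = (W + X.div f) P - (D - E) P := by
      simp only [Finsupp.add_apply, Finsupp.sub_apply, div_apply] at h1 ⊢
      omega
    have h3 := hs P
    rw [← h2] at h3
    exact h3
  · ext P
    simp

end Principal

end SmoothCurve

namespace Covering

variable {k : Type u} [Field k] {X Y : SmoothCurve k} (φ : Covering X Y)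

theorem pullback_apply (D : Y.Divisor) (P : X.Point) :
    φ.pullback D P = φ.ramification P * D (φ.onPoints P) := rfl

theorem pullback_eq_sum (D : Y.Divisor) :
    φ.pullback D = ∑ Q ∈ D.support, D Q • φ.pullbackPoint Q := by
  classical
  ext P
  simp only [pullbackPoint, pullback_apply, Finsupp.finsetSum_apply, Finsupp.smul_apply,
    smul_eq_mul, Finsupp.single_apply]
  rw [Finset.sum_eq_single (φ.onPoints P)]
  · simp [mul_comm]
  · intro Q _ hQ
    simp [hQ]
  · intro h
    simp [Finsupp.notMem_support_iff.mp h]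

/-- The common part of `D` with the pullback of `A` is bounded by its common parts with the
pullbacks of the points of `A`. -/
theorem deg_inf_pullback_le {D : X.Divisor} (hD : 0 ≤ D) {A : Y.Divisor} (hA : 0 ≤ A) :
    X.deg (D ⊓ φ.pullback A) ≤ ∑ Q ∈ A.support, A Q * X.deg (D ⊓ φ.pullbackPoint Q) := by
  classical
  rw [← X.deg_sum_zsmul]
  refine X.deg_mono fun P => ?_
  have hnn : ∀ Q, 0 ≤ (D ⊓ φ.pullbackPoint Q) P := fun Q => by
    rw [Finsupp.inf_apply]
    refine le_min (hD P) ?_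
    rw [pullbackPoint, pullback_apply, Finsupp.single_apply]
    split_ifs <;> simp
  rw [Finsupp.finsetSum_apply]
  simp only [Finsupp.smul_apply, smul_eq_mul]
  have hDP : 0 ≤ D P := hD P
  by_cases h : φ.onPoints P ∈ A.support
  · refine le_trans ?_ (Finset.single_le_sum (fun Q _ => mul_nonneg (hA Q) (hnn Q)) h)
    have h1 : 1 ≤ A (φ.onPoints P) := by
      have := hA (φ.onPoints P)
      rw [Finsupp.mem_support_iff] at h
      rw [Finsupp.zero_apply] at this
      omega
    rw [Finsupp.inf_apply, Finsupp.inf_apply, pullbackPoint, pullback_apply, pullback_apply,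
      Finsupp.single_eq_same, mul_one, mul_min_of_nonneg _ _ (by omega), mul_comm (A _) (φ.ramification P : ℤ)]
    exact min_le_min_right _ (by nlinarith)
  · refine le_trans ?_ (Finset.sum_nonneg fun Q _ => mul_nonneg (hA Q) (hnn Q))
    rw [Finsupp.inf_apply, pullback_apply, Finsupp.notMem_support_iff.mp h, mul_zero]
    exact min_le_right _ _

variable [IsAlgClosed k] [CharZero k]

theorem deg_pullbackPoint (Q : Y.Point) : X.deg (φ.pullbackPoint Q) = φ.degree := by
  classical
  rw [← φ.sum_ramification Q (φ.pullbackPoint Q).support fun P => by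
    have := (φ.ramification_pos P).ne'
    rw [Finsupp.mem_support_iff, pullbackPoint, pullback_apply, Finsupp.single_apply]
    split_ifs with h
    · simp [this, h]
    · simp [Ne.symm h]]
  push_cast
  refine Finset.sum_congr rfl fun P hP => ?_
  have : φ.onPoints P = Q := by
    by_contra h
    simp [pullbackPoint, pullback_apply, Ne.symm h] at hP
  simp [pullbackPoint, pullback_apply, this]

theorem deg_pullback (D : Y.Divisor) : X.deg (φ.pullback D) = φ.degree * Y.deg D := by
  rw [pullback_eq_sum, X.deg_sum_zsmul]
  simp only [deg_pullbackPoint]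
  rw [← Finset.sum_mul, mul_comm]
  rfl

end Covering

/-! ### Minimality -/

namespace SmoothCurve

variable {k : Type u} [Field k] [IsAlgClosed k] (X : SmoothCurve k)

/-- The divisor of poles of `f` is generated by its sections `1` and `f`. -/
theorem globallyGenerated_poles {f : X.K} (hf : f ≠ 0) : X.GloballyGenerated ((X.div f)⁻) := by
  have happ : ∀ P, (X.div f)⁻ P = max (-X.ord P f) 0 := fun P => rfl
  intro P
  rcases le_total 0 (X.ord P f) with h | h
  · refine ⟨1, X.one_mem_H0 (negPart_nonneg _), one_ne_zero, ?_⟩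
    rw [X.ord_one, happ]
    omega
  · refine ⟨f, X.mem_H0.mpr fun Q => Or.inr ?_, hf, ?_⟩ <;> rw [happ] <;> omega

end SmoothCurve

namespace Covering

variable {k : Type u} [Field k] {X Y : SmoothCurve k} (φ : Covering X Y)

/-- If the common parts of `g` and of `ξ` with the fibres have total degree at most `n`, the degree
of the common part of `g` with `φ^* A` and that of `ξ` with `φ^* B` add up to at most `n deg A`,
where `A` and `B` are effective of the same degree. -/
theorem deg_inf_pullback_add_le {g ξ : X.Divisor} (hg : 0 ≤ g) (hξ : 0 ≤ ξ) {n : ℤ}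
    (hφ : ∀ P Q : Y.Point,
      X.deg (g ⊓ φ.pullbackPoint P) + X.deg (ξ ⊓ φ.pullbackPoint Q) ≤ n)
    {A B : Y.Divisor} (hA : 0 ≤ A) (hB : 0 ≤ B) (hAB : Y.deg A = Y.deg B) :
    X.deg (g ⊓ φ.pullback A) + X.deg (ξ ⊓ φ.pullback B) ≤ n * Y.deg A := by
  have h1 := φ.deg_inf_pullback_le hg hA
  have h2 := φ.deg_inf_pullback_le hξ hB
  refine (add_le_add h1 h2).trans ?_
  set G : Y.Point → ℤ := fun Q => X.deg (g ⊓ φ.pullbackPoint Q) with hG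
  set H : Y.Point → ℤ := fun Q => X.deg (ξ ⊓ φ.pullbackPoint Q) with hH
  have hAa : ∑ Q ∈ A.support, A Q = Y.deg A := rfl
  have hBa : ∑ Q ∈ B.support, B Q = Y.deg A := by rw [hAB]; rfl
  rcases (Y.deg_nonneg hA).eq_or_lt with h0 | h0
  · have hz : ∀ {C : Y.Divisor}, 0 ≤ C → ∑ Q ∈ C.support, C Q = 0 → ∀ Q ∈ C.support, C Q = 0 :=
      fun hC h => (Finset.sum_eq_zero_iff_of_nonneg fun Q _ => hC Q).mp h
    rw [← h0] at hAa hBa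
    rw [Finset.sum_eq_zero fun Q hQ => by rw [hz hA hAa Q hQ, zero_mul],
      Finset.sum_eq_zero fun Q hQ => by rw [hz hB hBa Q hQ, zero_mul], ← h0]
    simp
  · have h3 : ∑ Q ∈ A.support, ∑ R ∈ B.support, A Q * B R * (G Q + H R) ≤
        ∑ Q ∈ A.support, ∑ R ∈ B.support, A Q * B R * n :=
      Finset.sum_le_sum fun Q _ => Finset.sum_le_sum fun R _ =>
        mul_le_mul_of_nonneg_left (hφ Q R) (mul_nonneg (hA Q) (hB R))
    have h4 : ∑ Q ∈ A.support, ∑ R ∈ B.support, A Q * B R * n = Y.deg A * (n * Y.deg A) := by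
      simp_rw [← Finset.sum_mul, ← Finset.sum_mul_sum, hAa, hBa]
      ring
    have h5 : ∑ Q ∈ A.support, ∑ R ∈ B.support, A Q * B R * (G Q + H R) =
        Y.deg A * (∑ Q ∈ A.support, A Q * G Q + ∑ Q ∈ B.support, B Q * H Q) := by
      have h6 : ∀ Q R, A Q * B R * (G Q + H R) = A Q * G Q * B R + A Q * (B R * H R) := fun Q R => by
        ring
      simp_rw [h6, Finset.sum_add_distrib, ← Finset.sum_mul_sum, hAa, hBa]
      ring
    rw [h4, h5] at h3
    exact le_of_mul_le_mul_left h3 h0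

variable [IsAlgClosed k] [CharZero k]

/-- If `𝒪(N)` is composed with `φ` and `1` is among its sections, then all of them are functions
on `Y`. -/
theorem exists_eq_pullbackFun {N : X.Divisor} (hN : φ.Composed N) {f : X.K} (h1 : 1 ∈ X.H0 N)
    (hf : f ∈ X.H0 N) : ∃ h, f = φ.pullbackFun h := by
  obtain ⟨M, ⟨s, hs, hsM⟩, hh⟩ := hN
  have hord : ∀ P h, h ≠ 0 → X.ord P (φ.pullbackFun h / s) =
      φ.ramification P * Y.ord (φ.onPoints P) h - X.ord P s := fun P h hh0 => by
    rw [← φ.ord_pullbackFun]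
    exact X.placeSystem.ord_div P (φ.pullbackFun_ne_zero hh0) hs
  let T : Y.K →ₗ[k] X.K :=
    { toFun := fun h => φ.pullbackFun h / s
      map_add' := fun a b => by rw [map_add, add_div]
      map_smul' := fun c a => by
        rw [Algebra.smul_def, map_mul, φ.pullbackFun_algebraMap, mul_div_assoc, RingHom.id_apply,
          Algebra.smul_def] }
  have hT : ∀ h ∈ Y.H0 M, T h ∈ X.H0 N := fun h hM => by
    by_cases hh0 : h = 0
    · rw [hh0, map_zero]
      exact zero_mem _
    refine X.mem_H0.mpr fun P => Or.inr ?_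
    have h2 := (Y.mem_H0.mp hM (φ.onPoints P)).resolve_left hh0
    have h3 := hsM P
    rw [pullback_apply] at h3
    change 0 ≤ X.ord P (φ.pullbackFun h / s) + N P
    rw [hord P h hh0]
    have h4 : 0 ≤ (φ.ramification P : ℤ) * (Y.ord (φ.onPoints P) h + M (φ.onPoints P)) :=
      mul_nonneg (by positivity) h2
    rw [mul_add] at h4
    omega
  let T' : Y.H0 M →ₗ[k] X.H0 N := T.restrict hT
  have hinj : Function.Injective T' := fun a b hab => by
    have h2 : φ.pullbackFun a / s = φ.pullbackFun b / s := congrArg Subtype.val hab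
    exact Subtype.ext (φ.pullbackFun.injective ((div_left_inj' hs).mp h2))
  have := X.finiteDimensional_H0 N
  have := Y.finiteDimensional_H0 M
  have hsurj : Function.Surjective T' :=
    (LinearMap.injective_iff_surjective_of_finrank_eq_finrank hh.symm).mp hinj
  obtain ⟨a, ha⟩ := hsurj ⟨1, h1⟩
  obtain ⟨b, hb⟩ := hsurj ⟨f, hf⟩
  have ha' : φ.pullbackFun a / s = 1 := congrArg Subtype.val ha
  have hb' : φ.pullbackFun b / s = f := congrArg Subtype.val hb
  refine ⟨b / a, ?_⟩
  rw [map_div₀, (div_eq_one_iff_eq hs).mp ha', hb']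

/-- Minimality: a presentation with `deg E < deg ξ` is related to the given one by a function `f` with
divisor `g + E - D - ξ`, whose poles have degree less than `d + e ≤ μ`. So `f` is pulled back from
`Y`, and the hypothesis on the fibres bounds how much of its divisor `g` and `ξ` can absorb. -/
theorem deg_le_of_isPresentation {g ξ : X.Divisor} {d e : ℕ} (hg : X.IsG0 g d) (hξ : X.IsG0 ξ e)
    (hgcd : g ⊓ ξ = 0) (hμ : ((d + e : ℕ) : ℕ∞) ≤ φ.mu)
    (hφ : ∀ P Q : Y.Point,
      X.deg (g ⊓ φ.pullbackPoint P) + X.deg (ξ ⊓ φ.pullbackPoint Q) ≤ (φ.degree : ℤ))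
    {L D E : X.Divisor} (hL : X.IsResidual L g ξ) (hDE : X.IsPresentation L D E) :
    X.deg ξ ≤ X.deg E := by
  classical
  obtain ⟨hg0, hgd, -⟩ := hg
  obtain ⟨hξ0, hξe, -⟩ := hξ
  obtain ⟨W₁, hW₁, f₁, hf₁, h₁⟩ := hL
  obtain ⟨hD, -, hE, -, W₂, hW₂, f₂, hf₂, h₂⟩ := hDE
  obtain ⟨w, hw, hW⟩ := PlaceSystem.IsCanonical.exists_ord_eq_sub (𝒮 := X.placeSystem) hW₁ hW₂
  replace hW : ∀ P, W₁ P - W₂ P = X.ord P w := hW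
  by_contra! hlt
  rw [hξe] at hlt
  set f := f₁ / f₂ * w with hfdef
  have hf : f ≠ 0 := mul_ne_zero (div_ne_zero hf₁ hf₂) hw
  have hord : ∀ P, X.ord P f = g P + E P - D P - ξ P := fun P => by
    have h3 := X.ord_mul P (div_ne_zero hf₁ hf₂) hw
    have h4 : X.ord P (f₁ / f₂) = X.ord P f₁ - X.ord P f₂ := X.placeSystem.ord_div P hf₁ hf₂
    have h5 := h₁ P
    have h6 := h₂ P
    have h7 := hW P
    simp only [Finsupp.add_apply, Finsupp.sub_apply] at h5 h6
    rw [hfdef, h3, h4]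
    omega
  -- the poles of `f` have degree less than `μ`
  have hN : X.deg ((X.div f)⁻) < d + e := by
    have h3 : X.deg ((X.div f)⁺) ≤ X.deg (g + E) := X.deg_mono fun P => by
      change max (X.ord P f) 0 ≤ g P + E P
      have h4 := hord P
      have h5 := hg0 P
      have h6 := hE.le P
      have h7 := hD P
      have h8 := hξ0 P
      simp only [Finsupp.zero_apply] at h5 h6 h7 h8
      omega
    have h4 := X.deg_div hf
    rw [← posPart_sub_negPart (X.div f), X.deg_sub] at h4
    rw [X.deg_add, hgd] at h3
    omega
  have hcomp : φ.Composed ((X.div f)⁻) := by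
    by_contra h
    have h3 : φ.mu ≤ ((X.deg ((X.div f)⁻)).toNat : ℕ∞) :=
      sInf_le ⟨_, X.globallyGenerated_poles hf, h, rfl⟩
    have h4 := Nat.cast_le.mp (hμ.trans h3)
    have h5 := X.deg_nonneg (negPart_nonneg (X.div f))
    omega
  obtain ⟨h, hh⟩ := φ.exists_eq_pullbackFun hcomp (f := f) (X.one_mem_H0 (negPart_nonneg _))
    (X.mem_H0.mpr fun P => Or.inr (by
      change 0 ≤ X.ord P f + max (-X.ord P f) 0
      omega))
  have hh0 : h ≠ 0 := by
    rintro rfl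
    exact hf (by rw [hh, map_zero])
  set A := (Y.div h)⁺ with hAdef
  set B := (Y.div h)⁻ with hBdef
  have hAB : Y.deg A = Y.deg B := by
    have h3 := Y.deg_div hh0
    rw [← posPart_sub_negPart (Y.div h), Y.deg_sub] at h3
    rw [hAdef, hBdef]
    omega
  have h3 := φ.deg_inf_pullback_add_le hg0 hξ0 hφ (posPart_nonneg (Y.div h))
    (negPart_nonneg (Y.div h)) hAB
  rw [← φ.deg_pullback] at h3
  -- `φ^* A - φ^* B = g + E - D - ξ`, where `g` and `ξ` have no common points: `E` contains the zeros
  -- of `f` that do not come from `g`, and the points of `ξ` that are not poles of `f`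
  have h4 : φ.pullback A - g ⊓ φ.pullback A + (ξ - ξ ⊓ φ.pullback B) ≤ E := fun P => by
    have h5 := hord P
    rw [hh, φ.ord_pullbackFun] at h5
    have hAP : A (φ.onPoints P) = max (Y.ord (φ.onPoints P) h) 0 := rfl
    have hBP : B (φ.onPoints P) = max (-Y.ord (φ.onPoints P) h) 0 := rfl
    simp only [Finsupp.add_apply, Finsupp.sub_apply, Finsupp.inf_apply, pullback_apply, hAP, hBP]
    have h6 := hg0 P
    have h7 := hE.le P
    have h8 := hD P
    have h9 := hξ0 P
    have h10 := SmoothCurve.eq_zero_of_inf_eq_zero hgcd P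
    simp only [Finsupp.zero_apply] at h6 h7 h8 h9
    rw [mul_max_of_nonneg _ _ (by positivity), mul_max_of_nonneg _ _ (by positivity), mul_neg,
      mul_zero]
    omega
  have h5 := X.deg_mono h4
  rw [X.deg_add, X.deg_sub, X.deg_sub, hξe, hAdef, hBdef] at h5
  omega

end Covering
end CurvePresentation
end

theorem theorem3p2 {k : Type u} [Field k] [IsAlgClosed k] [CharZero k]
    (X Y : SmoothCurve k) (φ : Covering X Y) (n : ℕ) (hn : φ.degree = n)
    (g ξ : X.Divisor) (d e : ℕ) (hg : X.IsG0 g d) (hξ : X.IsG0 ξ e) (hgcd : g ⊓ ξ = 0)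
    (he : 2 ≤ e) (hμ : ((d + e : ℕ) : ℕ∞) ≤ φ.mu)
    (hφ : ∀ P Q : Y.Point,
      X.deg (g ⊓ φ.pullbackPoint P) + X.deg (ξ ⊓ φ.pullbackPoint Q) ≤ (n : ℤ)) :
    (∃ L : X.Divisor, X.IsResidual L g ξ) ∧
      ∀ L : X.Divisor, X.IsResidual L g ξ →
        X.Nonspecial L ∧ X.IsMinimalPresentation L g ξ := by
  subst hn
  refine ⟨?_, fun L hL => ?_⟩
  · obtain ⟨W, hW⟩ := X.placeSystem.exists_isCanonical
    exact ⟨W - g + ξ, W, hW, 1, one_ne_zero, fun P => by rw [sub_self, X.ord_one]⟩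
  have hpos : 0 < ξ := lt_of_le_of_ne hξ.1 fun h => by
    have h1 : X.deg ξ = e := hξ.2.1
    rw [← h] at h1
    have h2 : X.deg 0 = 0 := map_zero X.degHom
    omega
  have hpres : X.IsPresentation L g ξ := ⟨hg.1, hg.2.2, hpos, hgcd, hL⟩
  exact ⟨SmoothCurve.nonspecial_of_isPresentation hpres, hpres,
    fun D E hDE => φ.deg_le_of_isPresentation hg hξ hgcd hμ hφ hL hDE⟩
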